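/- **Setting.** Let $(\Omega,\mathcal F,\mathbb P)$ be a probability space and $\tau>0$. *Driving process.* Let $0=t_0<t_1<\cdots$ be a partition of $[0,\infty)$ with cells $A_j=[t_{j-1},t_j)$, such that for some integer $l\ge 1$ we have $|A_{j+l}|=|A_j|$ for all $j$ and $\tau=\sum_{j=1}^l|A_j|$. Put $\mathfrak D_j=\bigcup_{k\ge0}A_{j+kl}$, $1\le j\le l$. Let $\lambda:[0,\infty)\to[0,\infty)$ be $\tau$-periodic and integrable on $[0,\tau]$, let $\Lambda(t)=\int_0^t\lambda(u)\,du$, and let $N$ be a Poisson process with intensity $\lambda$: a counting process with $N(0)=0$, nondecreasing right-continuous paths and independent increments, where $N(t)-N(s)$ is Poisson distributed with mean $\Lambda(t)-\Lambda(s)$. Let $\Upsilon_n$ be the time of the $n$-th jump of $N$, $\Upsilon_0=0$. Let $Z_n^j$ ($n\ge1$, $1\le j\le l$) be independent random variables, independent of $N$, where $Z_n^j$ has law $F_j$ with $\int z^2F_j(dz)<\infty$, and let $Z_n=\sum_{j=1}^lZ_n^j\mathbf 1_{\{\Upsilon_n\in\mathfrak D_j\}}$. Let $D$ be a deterministic,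 $\tau$-periodic, continuous function of locally bounded variation on $[0,\infty)$ with $D_0=0$. The driving process is $S_t=D_t+\sum_{n=1}^{N(t)}Z_n$, its quadratic variation is $[S,S]$, and its (local) semi-Lévy measure is $\nu_t(dz)=\lambda(t)F_j(dz)$ for $t\in\mathfrak D_j$. *State process and volatility.* Let $q\ge p\ge1$, $\alpha_0>0$, $\alpha_1,\dots,\alpha_q,\beta_1,\dots,\beta_q\in\mathbb R$, $\alpha_p\ne0$, $\beta_q\ne0$, $\alpha_{p+1}=\cdots=\alpha_q=0$. Let $\mathbf a=(\alpha_1,\dots,\alpha_q)'$, $\mathbf e=(0,\dots,0,1)'\in\mathbb R^q$, and let $B\in\mathbb R^{q\times q}$ be the companion matrix with ones on the superdiagonal, last row $(-\beta_q,\dots,-\beta_1)$ and zeros elsewhere. Let $(Y_t)_{t\ge0}$ be a càdlàg $\mathbb R^q$-valued process, with $Y_0$ independent of $S$, which solves $$dY_t=BY_{t-}\,dt+\mathbf e\,(\alpha_0+\mathbf a'Y_{t-})\,d[S,S]_t ,\qquad t>0,$$ and let $V_0=\alpha_0+\mathbf a'Y_0$, $V_t=\alpha_0+\mathbf a'Y_{t-}$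 for $t>0$. *Coefficients.* With $Q_n=(I+Z_n^2\,\mathbf e\mathbf a')e^{B(\Upsilon_n-\Upsilon_{n-1})}$ and $R_n=\alpha_0Z_n^2\,\mathbf e$, put for $0\le s\le t$ $$J_{s,t}=e^{B(t-\Upsilon_{N(t)})}Q_{N(t)}\cdots Q_{N(s)+2}\,(I+Z_{N(s)+1}^2\mathbf e\mathbf a')\,e^{B(\Upsilon_{N(s)+1}-s)},$$ $$K_{s,t}=e^{B(t-\Upsilon_{N(t)})}\big(R_{N(t)}+Q_{N(t)}R_{N(t)-1}+\cdots+Q_{N(t)}\cdots Q_{N(s)+2}R_{N(s)+1}\big)$$ if $N(t)>N(s)$, and $J_{s,t}=e^{B(t-s)}$, $K_{s,t}=0$ if $N(t)=N(s)$. **Theorem 3.1.** (a) Almost surely, $Y_t=J_{s,t}Y_s+K_{s,t}$ for all $0\le s\le t$. For all $0\le s\le t$ the pairs $(J_{s+k\tau,t+k\tau},K_{s+k\tau,t+k\tau})$, $k=0,1,2,\dots$, are identically distributed, and if $t-s\le\tau$ they are independent, hence i.i.d. (b) Suppose that all eigenvalues of $B$ have strictly negative real part, let $\eta$ be the largest of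 these real parts, and let $P\in\mathbb C^{q\times q}$ be an invertible matrix such that $P^{-1}BP$ is diagonal. Suppose that for some $r\in[1,\infty]$, with $\|\cdot\|_r$ the operator norm on $\mathbb C^{q\times q}$ induced by the $\ell^r$-norm, $$\int_{\mathbb R}\log\big(1+\|P^{-1}\mathbf e\mathbf a'P\|_r\,z^2\big)\,d\nu_t(z)<-\frac{\nu_t(\mathbb R)\,\eta\,\tau}{\Lambda(t+\tau)-\Lambda(t)}\qquad\text{for all }t\in[0,\tau).\tag{3.2}$$ Then for every $t\in[0,\tau)$, $Y_{t+m\tau}$ converges in distribution, as $m\to\infty$, to a finite random vector $U^{(t)}$, whose law is the unique probability law on $\mathbb R^q$ that solves $$U^{(t)}\overset{d}{=}J_{t,t+\tau}U^{(t)}+K_{t,t+\tau},\qquad U^{(t)}\text{ independent of }(J_{t,t+\tau},K_{t,t+\tau}).$$ (c) Suppose that the conditions of (b) hold and that $Y_0\overset{d}{=}U^{(0)}$. Then $(Y_t)_{t\ge0}$ and $(V_t)_{t\ge0}$ are strictly periodically stationary with period $\tau$: for all $n$, all $s_1,\dots,s_n\ge0$, all Borel sets $E_1,\dots,E_n\subseteq\mathbb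 R^q$ and $I_1,\dots,I_n\subseteq\mathbb R$, and all $k\in\mathbb N$, $$\mathbb P(Y_{s_1}\in E_1,\dots,Y_{s_n}\in E_n)=\mathbb P(Y_{s_1+k\tau}\in E_1,\dots,Y_{s_n+k\tau}\in E_n),$$ $$\mathbb P(V_{s_1}\in I_1,\dots,V_{s_n}\in I_n)=\mathbb P(V_{s_1+k\tau}\in I_1,\dots,V_{s_n+k\tau}\in I_n).$$ -/

import Mathlib

open MeasureTheory ProbabilityTheory Filter Topology Set
open scoped NNReal ENNReal Matrix

noncomputable section

namespace SSCogarch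

/-- A simple compound Poisson process with period `τ`: a Poisson process `N` with periodic
intensity `rate`, marks `Z n j` (`n ≥ 1`) with law `F j`, a partition of `[0, ∞)` whose cells repeat
after `l` steps (that is, after time `τ`), and a deterministic periodic drift. Times are real
numbers, and only times `t ≥ 0` matter. Cells are numbered from `0`, so that cell `j` is
`[node j, node (j + 1))`. -/
structure SimpleCompoundPoisson {Ω : Type*} [MeasurableSpace Ω] (μ : Measure Ω) (τ : ℝ) where
  /-- number of cells in a period -/
  l : ℕ
  /-- the partition points -/
  node : ℕ → ℝ
  /-- the intensity function of the Poisson process -/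
  rate : ℝ → ℝ
  /-- the deterministic drift -/
  drift : ℝ → ℝ
  /-- the laws of the marks -/
  F : Fin l → Measure ℝ
  /-- the Poisson process -/
  N : ℝ → Ω → ℕ
  /-- the marks; `Z 0` plays no role -/
  Z : ℕ → Fin l → Ω → ℝ
  period_pos : 0 < τ
  node_zero : node 0 = 0
  node_strictMono : StrictMono node
  node_periodic : ∀ j, node (j + l + 1) - node (j + l) = node (j + 1) - node j
  period_eq : τ = ∑ j ∈ Finset.range l, (node (j + 1) - node j)
  rate_nonneg : ∀ t, 0 ≤ t → 0 ≤ rate t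
  rate_periodic : ∀ t, 0 ≤ t → rate (t + τ) = rate t
  rate_integrable : IntervalIntegrable rate volume 0 τ
  drift_zero : drift 0 = 0
  drift_periodic : ∀ t, 0 ≤ t → drift (t + τ) = drift t
  drift_continuous : ContinuousOn drift (Ici 0)
  drift_variation : LocallyBoundedVariationOn drift (Ici 0)
  measurable_N : ∀ t, 0 ≤ t → Measurable (N t)
  N_zero : ∀ ω, N 0 ω = 0
  N_mono : ∀ ω, MonotoneOn (fun t => N t ω) (Ici 0)
  N_rightCont : ∀ ω t, 0 ≤ t → ContinuousWithinAt (fun u => N u ω) (Ici t) t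
  N_indep : HasIndepIncrements (fun (t : ℝ≥0) ω => N t ω) μ
  N_law : ∀ s t, 0 ≤ s → s ≤ t →
    μ.map (fun ω => N t ω - N s ω) = poissonMeasure (∫ u in s..t, rate u).toNNReal
  measurable_Z : ∀ n j, 1 ≤ n → Measurable (Z n j)
  Z_law : ∀ n j, 1 ≤ n → μ.map (Z n j) = F j
  F_sq_integrable : ∀ j, Integrable (fun z => z ^ 2) (F j)
  Z_indep : iIndepFun (fun (i : ℕ × Fin l) => Z (i.1 + 1) i.2) μ
  Z_indep_N : IndepFun (fun ω (i : ℕ × Fin l) => Z (i.1 + 1) i.2 ω)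
    (fun ω (t : ℝ≥0) => N t ω) μ

namespace SimpleCompoundPoisson

variable {Ω : Type*} [MeasurableSpace Ω] {μ : Measure Ω} {τ : ℝ}

/-- The mean function `Λ(t) = ∫₀ᵗ rate`. -/
def cumRate (X : SimpleCompoundPoisson μ τ) (t : ℝ) : ℝ := ∫ u in (0 : ℝ)..t, X.rate u

/-- The periodic repetition of the `j`-th cell. -/
def cells (X : SimpleCompoundPoisson μ τ) (j : Fin X.l) : Set ℝ :=
  ⋃ k : ℕ, Ico (X.node (j + k * X.l)) (X.node (j + k * X.l + 1))

/-- The time of the `n`-th jump of `N`, for `n ≥ 1`; it is `0` for `n = 0`. -/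
def arrival (X : SimpleCompoundPoisson μ τ) (n : ℕ) (ω : Ω) : ℝ :=
  sInf {t | 0 ≤ t ∧ n ≤ X.N t ω}

open Classical in
/-- The size `Z_n` of the `n`-th jump: the mark that belongs to the cell of the arrival time. -/
def jump (X : SimpleCompoundPoisson μ τ) (n : ℕ) (ω : Ω) : ℝ :=
  ∑ j : Fin X.l, if X.arrival n ω ∈ X.cells j then X.Z n j ω else 0

/-- The process `S_t = D_t + ∑_{n = 1}^{N(t)} Z_n`. -/
def S (X : SimpleCompoundPoisson μ τ) (t : ℝ) (ω : Ω) : ℝ :=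
  X.drift t + ∑ n ∈ Finset.Icc 1 (X.N t ω), X.jump n ω

open Classical in
/-- The (local) semi-Lévy measure `ν_t`, equal to `rate t • F j` when `t` lies in the `j`-th cell
or one of its periodic copies. -/
def levyMeasure (X : SimpleCompoundPoisson μ τ) (t : ℝ) : Measure ℝ :=
  ∑ j : Fin X.l, if t ∈ X.cells j then ENNReal.ofReal (X.rate t) • X.F j else 0

end SimpleCompoundPoisson

/-- `Q` is (a version with nondecreasing right-continuous paths of) the quadratic variation
`[S,S]`: for every `t ≥ 0` and every sequence of finite partitions of `[0,t]` with mesh tending to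
zero, the sums of squared increments of `S` tend to `Q_t` in probability. -/
def IsQuadraticVariation {Ω : Type*} [MeasurableSpace Ω] (μ : Measure Ω) (S : ℝ → Ω → ℝ)
    (Q : Ω → StieltjesFunction ℝ) : Prop :=
  ∀ t : ℝ, 0 ≤ t → ∀ (k : ℕ → ℕ) (part : ℕ → ℕ → ℝ),
    (∀ n, Monotone (part n)) → (∀ n, part n 0 = 0) → (∀ n, part n (k n) = t) →
    (∀ ε > 0, ∀ᶠ n in atTop, ∀ i < k n, part n (i + 1) - part n i < ε) →
    TendstoInMeasure μ
      (fun n ω => ∑ i ∈ Finset.range (k n), (S (part n (i + 1)) ω - S (part n i) ω) ^ 2)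
      atTop (fun ω => Q ω t)

/-- The parameters `α₀, …, α_q`, `β₁, …, β_q` of a COGARCH(p,q) model. -/
structure Params (p q : ℕ) where
  α : ℕ → ℝ
  β : ℕ → ℝ
  one_le_p : 1 ≤ p
  p_le_q : p ≤ q
  α_zero_pos : 0 < α 0
  α_p_ne_zero : α p ≠ 0
  α_eq_zero : ∀ j, p < j → j ≤ q → α j = 0
  β_q_ne_zero : β q ≠ 0

namespace Params

variable {p q : ℕ}

/-- The companion matrix with last row `-β_q, …, -β_1`. -/
def B (θ : Params p q) : Matrix (Fin q) (Fin q) ℝ :=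
  Matrix.of fun i j =>
    if (i : ℕ) + 1 = q then -θ.β (q - j) else if (j : ℕ) = i + 1 then 1 else 0

/-- The vector `(α_1, …, α_q)`. -/
def a (θ : Params p q) : Fin q → ℝ := fun i => θ.α (i + 1)

/-- The last standard basis vector. -/
def e (_θ : Params p q) : Fin q → ℝ := fun i => if (i : ℕ) + 1 = q then 1 else 0

/-- `B` as a complex matrix. -/
def Bc (θ : Params p q) : Matrix (Fin q) (Fin q) ℂ := θ.B.map (algebraMap ℝ ℂ)

/-- The rank-one matrix `e aᵀ`, as a complex matrix. -/
def eac (θ : Params p q) : Matrix (Fin q) (Fin q) ℂ :=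
  (Matrix.vecMulVec θ.e θ.a).map (algebraMap ℝ ℂ)

/-- The largest real part `η` of an eigenvalue of `B`. -/
def eta (θ : Params p q) : ℝ := sSup (Complex.re '' spectrum ℂ θ.Bc)

end Params

/-- The matrix norm on `ℂ^{q×q}` induced by the `ℓ^r` vector norm. -/
def lpMatrixNorm {q : ℕ} (r : ℝ≥0∞) [Fact (1 ≤ r)] (C : Matrix (Fin q) (Fin q) ℂ) : ℝ :=
  ‖LinearMap.toContinuousLinearMap (Matrix.toLpLin r r C)‖

section Model

variable {Ω : Type*} [MeasurableSpace Ω] {μ : Measure Ω} {τ : ℝ} {p q : ℕ}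

/-- `Y` is a càdlàg solution of `dY_t = B Y_{t-} dt + e (α₀ + aᵀ Y_{t-}) d[S,S]_t`, with `Y_0`
independent of the driving process `S`. The integrals are pathwise, the second one a
Lebesgue-Stieltjes integral over `(0,t]`. -/
structure IsStateProcess (θ : Params p q) (X : SimpleCompoundPoisson μ τ)
    (Q : Ω → StieltjesFunction ℝ) (Y : ℝ → Ω → Fin q → ℝ) : Prop where
  measurable : ∀ t, 0 ≤ t → Measurable (Y t)
  indep : IndepFun (Y 0) (fun ω (t : ℝ≥0) => X.S t ω) μ
  rightCont : ∀ᵐ ω ∂μ, ∀ t, 0 ≤ t → ContinuousWithinAt (fun u => Y u ω) (Ici t) t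
  leftLimit : ∀ᵐ ω ∂μ, ∀ t, 0 < t → ∃ y, Tendsto (fun u => Y u ω) (𝓝[<] t) (𝓝 y)
  sde : ∀ᵐ ω ∂μ, ∀ t, 0 ≤ t →
    Y t ω = Y 0 ω + (∫ u in (0 : ℝ)..t, θ.B *ᵥ Function.leftLim (fun v => Y v ω) u)
      + (∫ u in Ioc 0 t, (θ.α 0 + θ.a ⬝ᵥ Function.leftLim (fun v => Y v ω) u) ∂(Q ω).measure) • θ.e

open Classical in
/-- The volatility process: `V_t = α₀ + aᵀ Y_{t-}` for `t > 0` and `V_0 = α₀ + aᵀ Y_0`. -/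
def volatility (θ : Params p q) (Y : ℝ → Ω → Fin q → ℝ) (t : ℝ) (ω : Ω) : ℝ :=
  if t = 0 then θ.α 0 + θ.a ⬝ᵥ Y 0 ω
  else θ.α 0 + θ.a ⬝ᵥ Function.leftLim (fun v => Y v ω) t

/-- One factor of the recurrence started at time `s`: free flow `exp (B ·)` from
`max s Υ_{n-1}` up to the `n`-th arrival time `Υ_n`, followed by the jump
`I + Z_n² e aᵀ`; here `n = m + 1`. -/
def stepMatrix (θ : Params p q) (X : SimpleCompoundPoisson μ τ) (s : ℝ) (m : ℕ) (ω : Ω) :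
    Matrix (Fin q) (Fin q) ℝ :=
  (1 + (X.jump (m + 1) ω) ^ 2 • Matrix.vecMulVec θ.e θ.a) *
    NormedSpace.exp ((X.arrival (m + 1) ω - max s (X.arrival m ω)) • θ.B)

/-- The product of the factors of the first `k` jumps after time `s`, later factors on the left. -/
def jumpsJ (θ : Params p q) (X : SimpleCompoundPoisson μ τ) (s : ℝ) (ω : Ω) :
    ℕ → Matrix (Fin q) (Fin q) ℝ
  | 0 => 1
  | k + 1 => stepMatrix θ X s (X.N s ω + k) ω * jumpsJ θ X s ω k

/-- The inhomogeneous part accumulated over the first `k` jumps after time `s`; the `n`-th jump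
contributes `α₀ Z_n² e`. -/
def jumpsK (θ : Params p q) (X : SimpleCompoundPoisson μ τ) (s : ℝ) (ω : Ω) :
    ℕ → Fin q → ℝ
  | 0 => 0
  | k + 1 => stepMatrix θ X s (X.N s ω + k) ω *ᵥ jumpsK θ X s ω k
      + (θ.α 0 * (X.jump (X.N s ω + k + 1) ω) ^ 2) • θ.e

/-- The random matrix `J_{s,t}`. -/
def J (θ : Params p q) (X : SimpleCompoundPoisson μ τ) (s t : ℝ) (ω : Ω) :
    Matrix (Fin q) (Fin q) ℝ :=
  NormedSpace.exp ((t - max s (X.arrival (X.N t ω) ω)) • θ.B) *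
    jumpsJ θ X s ω (X.N t ω - X.N s ω)

/-- The random vector `K_{s,t}`. -/
def K (θ : Params p q) (X : SimpleCompoundPoisson μ τ) (s t : ℝ) (ω : Ω) : Fin q → ℝ :=
  NormedSpace.exp ((t - max s (X.arrival (X.N t ω) ω)) • θ.B) *ᵥ
    jumpsK θ X s ω (X.N t ω - X.N s ω)

/-- The pair `(J_{s,t}, K_{s,t})`, the matrix being read as the array of its entries. -/
def coeffPair (θ : Params p q) (X : SimpleCompoundPoisson μ τ) (s t : ℝ) (ω : Ω) :
    (Fin q → Fin q → ℝ) × (Fin q → ℝ) :=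
  (fun i j => J θ X s t ω i j, K θ X s t ω)

/-- The log-moment condition, for the diagonalizing matrix `P` and the exponent `r`. -/
def LogMomentCondition (θ : Params p q) (X : SimpleCompoundPoisson μ τ)
    (P : Matrix (Fin q) (Fin q) ℂ) (r : ℝ≥0∞) [Fact (1 ≤ r)] : Prop :=
  ∀ t ∈ Ico 0 τ,
    ∫ z, Real.log (1 + lpMatrixNorm r (P⁻¹ * θ.eac * P) * z ^ 2) ∂(X.levyMeasure t) <
      -(1 / (X.cumRate (t + τ) - X.cumRate t)) * (X.levyMeasure t).real univ * θ.eta * τ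

/-- The law `π` solves `U ≐ J_{t,t+τ} U + K_{t,t+τ}` with `U` independent of
`(J_{t,t+τ}, K_{t,t+τ})`; the independence is realized on the product space. -/
def SolvesRecurrence (θ : Params p q) (X : SimpleCompoundPoisson μ τ) (t : ℝ)
    (π : Measure (Fin q → ℝ)) : Prop :=
  (π.prod μ).map (fun x => J θ X t (t + τ) x.2 *ᵥ x.1 + K θ X t (t + τ) x.2) = π

end Model

/-- Strict periodic stationarity with period `τ` of a process indexed by times `t ≥ 0`. -/
def StrictlyPeriodicallyStationary {Ω E : Type*} [MeasurableSpace Ω] [MeasurableSpace E]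
    (μ : Measure Ω) (τ : ℝ) (W : ℝ → Ω → E) : Prop :=
  ∀ (n : ℕ) (s : Fin n → ℝ) (A : Fin n → Set E), (∀ i, 0 ≤ s i) → (∀ i, MeasurableSet (A i)) →
    ∀ k : ℕ, μ {ω | ∀ i, W (s i) ω ∈ A i} = μ {ω | ∀ i, W (s i + k * τ) ω ∈ A i}

end SSCogarch

end

/-!
The driving process changes by its jumps and by a drift that is continuous and of bounded
variation, so its quadratic variation is almost surely the sum of the squared jumps
(`ae_quadraticVariation_eq`). Between two jumps the state therefore follows the linear flow of
`B`, and at a jump of size `z` it is mapped by an affine map that depends on `z²` only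
(`SolvesStateEquation.eq_kick_flow`). Composing these maps along the jumps in `(s, t]` gives
`Y t = J s t *ᵥ Y s + K s t`.

The pair `(J, K)` over `(s, s + h]` is a fixed measurable function of the path of increments of
the jump part after time `s`: it is the limit of the recursions driven by the increments over the
uniform partitions of `[s, s + h]`, because the jumps are isolated (`coeffPath_block`). Everything
about laws and independence thus reduces to the jump part of the driving process. A Poisson
process has independent increments, and the marks attached to its jumps after time `a` are
independent of all that happens until `a`. Hence the increments after `a` are independent of the
past (`SimpleCompoundPoisson.indepFun_comp_block`), and since the intensity and the cells are
periodic, their law does not change when `a` is increased by a period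
(`SimpleCompoundPoisson.map_block_add_nsmul`). This makes the coefficients over successive periods
i.i.d.

For the stationary law, the norm `‖P⁻¹ v‖_r` on vectors is used. In it the flow of `B` over time
`d` has norm at most `exp (η d)`, and a jump of size `z` has norm at most `1 + c z²` with `c =
‖P⁻¹ e aᵀ P‖_r`. The log-moment condition says that `log (1 + c z²)` has mean less than `-η τ /
Λ(τ)` under each mark law, and a period has `Λ(τ)` jumps on average, so the random affine maps
over a period contract on average. Their backward iterates then converge almost surely, to a limit
whose law is the unique solution of the recurrence and attracts the forward iterates
(`exists_stationary_law`).

If `Y 0` has this law at time `0`, so has `Y (k τ)` for each `k`, and it is independent of the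
increments after `k τ`. The state at later times is a function of `Y (k τ)` and these increments,
the same for all `k`, which gives periodic stationarity. The volatility inherits it because a
fixed time is almost surely not a jump time.
-/

namespace SSCogarch

/-! ### Independence -/

section Independence

variable {Ω : Type*} [MeasurableSpace Ω] {μ : Measure Ω}

/-- A sequence is independent as soon as each term is independent of the preceding ones. -/
lemma iIndepFun_nat_of_indepFun_past [IsProbabilityMeasure μ] {β : Type*} [MeasurableSpace β]
    {X : ℕ → Ω → β} (h : ∀ k, IndepFun (X k) (fun ω (i : Finset.range k) => X i ω) μ) :
    iIndepFun X μ := by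
  rw [iIndepFun_iff_measure_inter_preimage_eq_mul]
  intro S
  induction S using Finset.induction_on_max with
  | empty => intro _ _; simp
  | insert k S hk ih =>
    intro A hA
    have hkS : k ∉ S := fun hmem => lt_irrefl _ (hk k hmem)
    rw [Finset.prod_insert hkS, ← ih fun i hi => hA i (Finset.mem_insert_of_mem hi)]
    have hset : (⋂ i ∈ S, X i ⁻¹' A i) = (fun ω (i : Finset.range k) => X i ω) ⁻¹'
        (⋂ i : Finset.range k, ⋂ _ : (i : ℕ) ∈ S, (fun x => x i) ⁻¹' A i) := by
      ext ω
      simp only [mem_iInter, mem_preimage, Subtype.forall, Finset.mem_range]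
      exact ⟨fun H i _ hi => H i hi, fun H i hi => H i (hk i hi) hi⟩
    rw [Finset.set_biInter_insert, hset]
    refine (indepFun_iff_measure_inter_preimage_eq_mul.1 (h k)) _ _
      (hA k (Finset.mem_insert_self _ _)) ?_
    refine MeasurableSet.iInter fun i => MeasurableSet.iInter fun hi => ?_
    exact measurable_pi_apply i (hA i (Finset.mem_insert_of_mem hi))

lemma _root_.MeasureTheory.Measure.map_prodProdProdComm {α β γ δ : Type*} [MeasurableSpace α]
    [MeasurableSpace β] [MeasurableSpace γ] [MeasurableSpace δ] (a : Measure α) (b : Measure β)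
    (c : Measure γ) (d : Measure δ) [IsProbabilityMeasure a] [IsProbabilityMeasure b]
    [IsProbabilityMeasure c] [IsProbabilityMeasure d] :
    ((a.prod b).prod (c.prod d)).map (fun x => ((x.1.1, x.2.1), (x.1.2, x.2.2))) =
      (a.prod c).prod (b.prod d) := by
  have hm : Measurable fun x : (α × β) × γ × δ => ((x.1.1, x.2.1), (x.1.2, x.2.2)) := by fun_prop
  have : IsProbabilityMeasure
      (((a.prod b).prod (c.prod d)).map (fun x => ((x.1.1, x.2.1), (x.1.2, x.2.2)))) :=
    Measure.isProbabilityMeasure_map hm.aemeasurable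
  refine Measure.ext_of_generateFrom_of_iUnion
    (image2 (· ×ˢ ·) (image2 (· ×ˢ ·) {s : Set α | MeasurableSet s} {t : Set γ | MeasurableSet t})
      (image2 (· ×ˢ ·) {s : Set β | MeasurableSet s} {t : Set δ | MeasurableSet t}))
    (fun _ => univ) ?_ ?_ (iUnion_const _) ?_ (by simp) ?_
  · refine (generateFrom_eq_prod generateFrom_prod generateFrom_prod ?_ ?_).symm
    · exact isCountablySpanning_measurableSet.prod isCountablySpanning_measurableSet
    · exact isCountablySpanning_measurableSet.prod isCountablySpanning_measurableSet
  · exact isPiSystem_prod.prod isPiSystem_prod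
  · intro _
    exact ⟨univ, ⟨univ, .univ, univ, .univ, univ_prod_univ⟩, univ,
      ⟨univ, .univ, univ, .univ, univ_prod_univ⟩, univ_prod_univ⟩
  · rintro _ ⟨_, ⟨s, hs, t, ht, rfl⟩, _, ⟨u, hu, v, hv, rfl⟩, rfl⟩
    simp only [mem_ofPred_eq] at hs ht hu hv
    rw [Measure.map_apply hm ((hs.prod ht).prod (hu.prod hv))]
    have : (fun x : (α × β) × γ × δ => ((x.1.1, x.2.1), (x.1.2, x.2.2))) ⁻¹'
        ((s ×ˢ t) ×ˢ (u ×ˢ v)) = (s ×ˢ u) ×ˢ (t ×ˢ v) := by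
      ext x; simp only [mem_preimage, mem_prod]; tauto
    rw [this]
    simp only [Measure.prod_prod]
    ring

lemma IndepFun.prodMk_prodMk_of_indepFun [IsProbabilityMeasure μ] {α β γ δ : Type*}
    [MeasurableSpace α] [MeasurableSpace β] [MeasurableSpace γ] [MeasurableSpace δ]
    {f : Ω → α} {f' : Ω → β} {g : Ω → γ} {g' : Ω → δ} (hf : Measurable f) (hf' : Measurable f')
    (hg : Measurable g) (hg' : Measurable g') (hff' : IndepFun f f' μ) (hgg' : IndepFun g g' μ)
    (h : IndepFun (fun ω => (f ω, f' ω)) (fun ω => (g ω, g' ω)) μ) :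
    IndepFun (fun ω => (f ω, g ω)) (fun ω => (f' ω, g' ω)) μ := by
  have := Measure.isProbabilityMeasure_map (μ := μ) hf.aemeasurable
  have := Measure.isProbabilityMeasure_map (μ := μ) hf'.aemeasurable
  have := Measure.isProbabilityMeasure_map (μ := μ) hg.aemeasurable
  have := Measure.isProbabilityMeasure_map (μ := μ) hg'.aemeasurable
  rw [indepFun_iff_map_prod_eq_prod_map_map (by fun_prop) (by fun_prop)] at h hff' hgg'
  have hm : Measurable fun x : (α × β) × γ × δ => ((x.1.1, x.2.1), (x.1.2, x.2.2)) := by fun_prop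
  have key : μ.map (fun ω => ((f ω, g ω), (f' ω, g' ω))) =
      ((μ.map f).prod (μ.map g)).prod ((μ.map f').prod (μ.map g')) := by
    rw [← Measure.map_prodProdProdComm, ← hff', ← hgg', ← h,
      Measure.map_map hm (by fun_prop)]
    rfl
  rw [indepFun_iff_map_prod_eq_prod_map_map (by fun_prop) (by fun_prop), key]
  have h1 : μ.map (fun ω => (f ω, g ω)) = (μ.map f).prod (μ.map g) := by
    have := congrArg (Measure.map Prod.fst) key
    rwa [Measure.map_map measurable_fst (by fun_prop), ← Measure.fst, Measure.fst_prod] at this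
  have h2 : μ.map (fun ω => (f' ω, g' ω)) = (μ.map f').prod (μ.map g') := by
    have := congrArg (Measure.map Prod.snd) key
    rwa [Measure.map_map measurable_snd (by fun_prop), ← Measure.snd, Measure.snd_prod] at this
  rw [h1, h2]

/-- If `f` is independent of `(g, g')` and `g` is independent of `g'`, then `(f, g)` is
independent of `g'`. -/
lemma IndepFun.prodMk_left_of_indepFun [IsProbabilityMeasure μ] {α β γ : Type*}
    [MeasurableSpace α] [MeasurableSpace β] [MeasurableSpace γ]
    {f : Ω → α} {g : Ω → β} {g' : Ω → γ} (hf : Measurable f) (hg : Measurable g)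
    (hg' : Measurable g') (h : IndepFun f (fun ω => (g ω, g' ω)) μ) (hgg' : IndepFun g g' μ) :
    IndepFun (fun ω => (f ω, g ω)) g' μ := by
  have := Measure.isProbabilityMeasure_map (μ := μ) hf.aemeasurable
  have := Measure.isProbabilityMeasure_map (μ := μ) hg.aemeasurable
  have := Measure.isProbabilityMeasure_map (μ := μ) hg'.aemeasurable
  have hfg : IndepFun f g μ := h.comp measurable_id measurable_fst
  rw [indepFun_iff_map_prod_eq_prod_map_map (by fun_prop) (by fun_prop)] at h hgg' hfg ⊢
  rw [hfg]
  rw [hgg', ← Measure.prodAssoc_prod] at h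
  have := congrArg (Measure.map MeasurableEquiv.prodAssoc.symm) h
  rw [Measure.map_map (MeasurableEquiv.measurable _) (MeasurableEquiv.measurable _),
    Measure.map_map (MeasurableEquiv.measurable _) (by fun_prop)] at this
  rw [MeasurableEquiv.symm_comp_self, Measure.map_id] at this
  exact this

end Independence

/-! ### Iterated random maps -/

section Iteration

/-- The terms of a sequence with convergent averages are `o(n)`. -/
lemma tendsto_div_of_average {x : ℕ → ℝ} {a δ : ℝ} (hδ : 0 < δ)
    (h : Tendsto (fun n : ℕ => (∑ i ∈ Finset.range n, x i) / n) atTop (𝓝 a)) :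
    ∀ᶠ n : ℕ in atTop, x n ≤ δ * n := by
  have h1 : Tendsto (fun n : ℕ => (∑ i ∈ Finset.range (n + 1), x i) / ((n + 1 : ℕ) : ℝ)) atTop
      (𝓝 a) :=
    h.comp (tendsto_add_atTop_nat 1)
  have h2 : Tendsto (fun n : ℕ => ((n + 1 : ℕ) : ℝ) / n) atTop (𝓝 1) := by
    have := tendsto_const_nhds (x := (1 : ℝ)).add (tendsto_one_div_atTop_nhds_zero_nat (𝕜 := ℝ))
    rw [add_zero] at this
    refine this.congr' ?_
    filter_upwards [eventually_gt_atTop 0] with n hn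
    have : (n : ℝ) ≠ 0 := by positivity
    push_cast
    field_simp
  have h3 := (h1.mul h2).sub h
  rw [mul_one, sub_self] at h3
  filter_upwards [h3.eventually (gt_mem_nhds hδ), eventually_gt_atTop 0] with n hn hn0
  have hn' : (0 : ℝ) < n := by positivity
  have hn1 : ((n + 1 : ℕ) : ℝ) ≠ 0 := by positivity
  rw [Finset.sum_range_succ, div_mul_div_cancel₀ hn1, ← sub_div, add_sub_cancel_left,
    div_lt_iff₀ hn'] at hn
  exact hn.le

/-- If the averages of `log ℓ i` converge to a negative number and `log (1 + b i)` has convergent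
averages, then the products of the `ℓ i` decay geometrically, even when multiplied by `b m`. -/
lemma summable_prod_of_average {ℓ b : ℕ → ℝ} {a a' : ℝ} (hℓ : ∀ i, 0 < ℓ i) (hb : ∀ i, 0 ≤ b i)
    (ha : a < 0)
    (h : Tendsto (fun n : ℕ => (∑ i ∈ Finset.range n, Real.log (ℓ i)) / n) atTop (𝓝 a))
    (h' : Tendsto (fun n : ℕ => (∑ i ∈ Finset.range n, Real.log (1 + b i)) / n) atTop (𝓝 a')) :
    Tendsto (fun m => ∏ i ∈ Finset.range m, ℓ i) atTop (𝓝 0) ∧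
      Summable fun m => (∏ i ∈ Finset.range m, ℓ i) * b m := by
  have hδ : 0 < -a / 4 := by linarith
  have e1 : ∀ᶠ n : ℕ in atTop, ∏ i ∈ Finset.range n, ℓ i ≤ Real.exp (a / 2) ^ n := by
    filter_upwards [h.eventually (gt_mem_nhds (show a < a / 2 by linarith)),
      eventually_gt_atTop 0] with n hn hn0
    have hn' : (0 : ℝ) < n := by positivity
    rw [div_lt_iff₀ hn'] at hn
    rw [← Real.exp_nat_mul, ← Real.exp_log (Finset.prod_pos fun i _ => hℓ i),
      Real.log_prod fun i _ => (hℓ i).ne']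
    exact Real.exp_le_exp.2 (by linarith)
  have e2 : ∀ᶠ n : ℕ in atTop, b n ≤ Real.exp (-a / 4) ^ n := by
    filter_upwards [tendsto_div_of_average hδ h'] with n hn
    have := Real.exp_le_exp.2 hn
    rw [Real.exp_log (by linarith [hb n]), mul_comm, Real.exp_nat_mul] at this
    linarith
  have hpos : ∀ n, 0 ≤ ∏ i ∈ Finset.range n, ℓ i := fun n => Finset.prod_nonneg fun i _ => (hℓ i).le
  constructor
  · refine squeeze_zero' (.of_forall hpos) e1 ?_
    exact tendsto_pow_atTop_nhds_zero_of_lt_one (Real.exp_pos _).le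
      (by rw [Real.exp_lt_one_iff]; linarith)
  · have hs : Summable fun n : ℕ => Real.exp (a / 4) ^ n :=
      summable_geometric_of_lt_one (Real.exp_pos _).le (by rw [Real.exp_lt_one_iff]; linarith)
    refine hs.of_norm_bounded_eventually_nat ?_
    filter_upwards [e1, e2] with n h1 h2
    rw [Real.norm_of_nonneg (mul_nonneg (hpos n) (hb n))]
    refine (mul_le_mul h1 h2 (hb n) (by positivity)).trans_eq ?_
    rw [← mul_pow, ← Real.exp_add]
    congr 2
    ring

variable {C E : Type*}

/-- The iterates `act c_{m-1} ∘ ⋯ ∘ act c_0`. -/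
def forwardIter (act : C → E → E) (c : ℕ → C) : ℕ → E → E
  | 0, x => x
  | m + 1, x => act (c m) (forwardIter act c m x)

/-- The iterates `act c_0 ∘ ⋯ ∘ act c_{m-1}`, in the order in which they converge pathwise. -/
def backwardIter (act : C → E → E) (c : ℕ → C) : ℕ → E → E
  | 0, x => x
  | m + 1, x => backwardIter act c m (act (c m) x)

lemma forwardIter_congr (act : C → E → E) {c c' : ℕ → C} (m : ℕ) (h : ∀ i < m, c i = c' i)
    (x : E) : forwardIter act c m x = forwardIter act c' m x := by
  induction m with
  | zero => rfl
  | succ m ih =>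
    simp only [forwardIter, ih fun i hi => h i (by omega), h m (by omega)]

lemma backwardIter_congr (act : C → E → E) {c c' : ℕ → C} (m : ℕ) (h : ∀ i < m, c i = c' i)
    (x : E) : backwardIter act c m x = backwardIter act c' m x := by
  induction m generalizing x with
  | zero => rfl
  | succ m ih =>
    simp only [backwardIter, ih fun i hi => h i (by omega), h m (by omega)]

section Measurable

variable [MeasurableSpace C] [MeasurableSpace E] {act : C → E → E}

lemma measurable_act {α : Type*} [MeasurableSpace α] (hact : Measurable (Function.uncurry act))
    {f : α → C} {g : α → E} (hf : Measurable f) (hg : Measurable g) :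
    Measurable fun a => act (f a) (g a) :=
  hact.comp (hf.prodMk hg)

lemma measurable_forwardIter (hact : Measurable (Function.uncurry act)) (m : ℕ) :
    Measurable fun p : (ℕ → C) × E => forwardIter act p.1 m p.2 := by
  induction m with
  | zero => exact measurable_snd
  | succ m ih =>
    exact hact.comp (((measurable_pi_apply m).comp measurable_fst).prodMk ih)

lemma measurable_backwardIter (hact : Measurable (Function.uncurry act)) (m : ℕ) :
    Measurable fun p : (ℕ → C) × E => backwardIter act p.1 m p.2 := by
  induction m with
  | zero => exact measurable_snd
  | succ m ih =>
    have h2 : Measurable fun p : (ℕ → C) × E => act (p.1 m) p.2 :=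
      measurable_act hact ((measurable_pi_apply m).comp measurable_fst) measurable_snd
    exact ih.comp (measurable_fst.prodMk h2)

/-- The transition operator `f ↦ ∫ f (act c ·) dν(c)` of the Markov chain of random iterates. -/
noncomputable def transition (act : C → E → E) (ν : Measure C) (f : E → ℝ≥0∞) (x : E) : ℝ≥0∞ :=
  ∫⁻ c, f (act c x) ∂ν

lemma measurable_transition (hact : Measurable (Function.uncurry act)) (ν : Measure C) [SFinite ν]
    {f : E → ℝ≥0∞} (hf : Measurable f) : Measurable (transition act ν f) := by
  have : Measurable (Function.uncurry fun (x : E) (c : C) => f (act c x)) :=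
    hf.comp (hact.comp measurable_swap)
  exact this.lintegral_prod_right

variable {Ω : Type*} [MeasurableSpace Ω] {μ : Measure Ω} [IsProbabilityMeasure μ] {X : ℕ → Ω → C}

lemma lintegral_indep {β γ : Type*} [MeasurableSpace β] [MeasurableSpace γ] {f : Ω → β} {g : Ω → γ}
    (hf : Measurable f) (hg : Measurable g) (h : IndepFun f g μ) {F : β → γ → ℝ≥0∞}
    (hF : Measurable (Function.uncurry F)) :
    ∫⁻ ω, F (f ω) (g ω) ∂μ = ∫⁻ x, ∫⁻ y, F x y ∂(μ.map g) ∂(μ.map f) := by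
  have := Measure.isProbabilityMeasure_map (μ := μ) hf.aemeasurable
  have := Measure.isProbabilityMeasure_map (μ := μ) hg.aemeasurable
  rw [indepFun_iff_map_prod_eq_prod_map_map hf.aemeasurable hg.aemeasurable] at h
  have h2 := lintegral_map (μ := μ) hF (hf.prodMk hg)
  rw [h, lintegral_prod _ hF.aemeasurable] at h2
  exact h2.symm

/-- A function of the first `m` terms of an independent sequence is independent of term `m`. -/
lemma indepFun_of_dependsOn_range {γ : Type*} [MeasurableSpace γ] (hX : ∀ i, Measurable (X i))
    (hi : iIndepFun X μ) (m : ℕ) {g : (ℕ → C) → γ} (hg : Measurable g)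
    (hdep : ∀ c c' : ℕ → C, (∀ i < m, c i = c' i) → g c = g c') :
    IndepFun (fun ω => g fun i => X i ω) (X m) μ := by
  have : Nonempty Ω := nonempty_of_isProbabilityMeasure μ
  let c₀ : C := X 0 (Classical.arbitrary Ω)
  let ext : (Finset.range m → C) → ℕ → C := fun t i =>
    if h : i ∈ Finset.range m then t ⟨i, h⟩ else c₀
  have hext : Measurable ext := by
    refine measurable_pi_lambda _ fun i => ?_
    by_cases h : i ∈ Finset.range m
    · simpa only [ext, h, dite_true] using measurable_pi_apply _
    · simpa only [ext, h, dite_false] using measurable_const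
  have h0 := hi.indepFun_finset (Finset.range m) {m} (by simp) hX
  have h1 := h0.comp (hg.comp hext)
    (measurable_pi_apply (⟨m, Finset.mem_singleton_self m⟩ : ({m} : Finset ℕ)))
  convert! h1 using 1
  funext ω
  refine hdep _ _ fun i him => ?_
  simp [ext, him]

variable (hact : Measurable (Function.uncurry act)) (hX : ∀ i, Measurable (X i))
  (hi : iIndepFun X μ) (hid : ∀ i, μ.map (X i) = μ.map (X 0))

include hact hX hi hid

lemma lintegral_forwardIter (m : ℕ) {f : E → ℝ≥0∞} (hf : Measurable f) (x : E) :
    ∫⁻ ω, f (forwardIter act (fun i => X i ω) m x) ∂μ = (transition act (μ.map (X 0)))^[m] f x := by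
  induction m generalizing f with
  | zero => simp [forwardIter]
  | succ m ih =>
    have hm : Measurable fun c : ℕ → C => forwardIter act c m x :=
      (measurable_forwardIter hact m).comp (measurable_id.prodMk measurable_const)
    have hind := indepFun_of_dependsOn_range hX hi m hm
      (fun c c' h => forwardIter_congr act m h x)
    have := Measure.isProbabilityMeasure_map (μ := μ) (hX 0).aemeasurable
    have hS := measurable_transition hact (μ.map (X 0)) hf
    have hmX : Measurable fun ω => forwardIter act (fun i => X i ω) m x :=
      hm.comp (measurable_pi_lambda _ hX)
    rw [Function.iterate_succ_apply, ← ih hS]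
    have key := lintegral_indep hmX (hX m) hind (F := fun y c => f (act c y))
      (hf.comp (hact.comp measurable_swap))
    rw [hid m] at key
    rw [← lintegral_map hS hmX]
    exact key

lemma lintegral_backwardIter (m : ℕ) {f : E → ℝ≥0∞} (hf : Measurable f) (x : E) :
    ∫⁻ ω, f (backwardIter act (fun i => X i ω) m x) ∂μ = (transition act (μ.map (X 0)))^[m] f x := by
  induction m generalizing x with
  | zero => simp [backwardIter]
  | succ m ih =>
    have hm : Measurable fun p : (ℕ → C) × E => f (backwardIter act p.1 m p.2) :=
      hf.comp (measurable_backwardIter hact m)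
    -- `f (backwardIter c m ·)` only sees the first `m` terms of `c`; the others are frozen
    have hXm : Measurable fun ω (i : ℕ) => X i ω := measurable_pi_lambda _ hX
    have : Nonempty Ω := nonempty_of_isProbabilityMeasure μ
    let c₀ : C := X 0 (Classical.arbitrary Ω)
    let fr : (ℕ → C) → ℕ → C := fun c i => if i < m then c i else c₀
    have hfr : Measurable fr := by
      refine measurable_pi_lambda _ fun i => ?_
      by_cases h : i < m
      · simpa only [fr, h, if_true] using measurable_pi_apply _
      · simpa only [fr, h, if_false] using measurable_const
    have hind := indepFun_of_dependsOn_range hX hi m hfr (fun c c' h => by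
      funext i
      by_cases hi : i < m
      · simp [fr, hi, h i hi]
      · simp [fr, hi])
    have hfrX : ∀ ω y, backwardIter act (fr fun i => X i ω) m y =
        backwardIter act (fun i => X i ω) m y :=
      fun ω y => backwardIter_congr act m (fun i hi => by simp [fr, hi]) y
    have key := lintegral_indep (hX m) (hfr.comp hXm) hind.symm
      (F := fun c d => f (backwardIter act d m (act c x)))
      (hm.comp (measurable_snd.prodMk (hact.comp (measurable_fst.prodMk measurable_const))))
    rw [Function.iterate_succ_apply']
    simp only [Function.comp_apply, hfrX] at key
    refine key.trans ?_
    rw [hid m, transition]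
    refine lintegral_congr fun c => ?_
    have hm' : Measurable fun d : ℕ → C => f (backwardIter act d m (act c x)) :=
      hm.comp (measurable_id.prodMk measurable_const)
    rw [← ih, lintegral_map hm' (hfr.comp hXm)]
    simp only [Function.comp_apply, hfrX]

end Measurable

end Iteration

section Perpetuity

variable {C E : Type*} [NormedAddCommGroup E] {act : C → E → E} {nV : E → ℝ} {ℓ : C → ℝ}

lemma forwardIter_sub_le (hℓ : ∀ c, 0 < ℓ c)
    (hlip : ∀ c x y, nV (act c x - act c y) ≤ ℓ c * nV (x - y)) (c : ℕ → C) (m : ℕ) (x y : E) :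
    nV (forwardIter act c m x - forwardIter act c m y) ≤
      (∏ i ∈ Finset.range m, ℓ (c i)) * nV (x - y) := by
  induction m with
  | zero => simp [forwardIter]
  | succ m ih =>
    rw [Finset.prod_range_succ, mul_comm _ (ℓ (c m)), mul_assoc]
    exact (hlip _ _ _).trans (mul_le_mul_of_nonneg_left ih (hℓ _).le)

lemma backwardIter_sub_le (hℓ : ∀ c, 0 < ℓ c)
    (hlip : ∀ c x y, nV (act c x - act c y) ≤ ℓ c * nV (x - y)) (c : ℕ → C) (m : ℕ) (x y : E) :
    nV (backwardIter act c m x - backwardIter act c m y) ≤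
      (∏ i ∈ Finset.range m, ℓ (c i)) * nV (x - y) := by
  induction m generalizing x y with
  | zero => simp [backwardIter]
  | succ m ih =>
    rw [Finset.prod_range_succ, mul_assoc]
    exact (ih _ _).trans (mul_le_mul_of_nonneg_left (hlip _ _ _)
      (Finset.prod_nonneg fun i _ => (hℓ _).le))

variable {κ : ℝ} [CompleteSpace E]

/-- If the Lipschitz constants multiply to `0` and the increments at `0` are summable, the backward
iterates converge, to a limit that does not depend on the starting point. -/
lemma backwardIter_tendsto (hℓ : ∀ c, 0 < ℓ c) (hκ0 : 0 ≤ κ) (hκ : ∀ v, ‖v‖ ≤ κ * nV v)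
    (hlip : ∀ c x y, nV (act c x - act c y) ≤ ℓ c * nV (x - y)) {c : ℕ → C}
    (h0 : Tendsto (fun m => ∏ i ∈ Finset.range m, ℓ (c i)) atTop (𝓝 0))
    (hs : Summable fun m => (∏ i ∈ Finset.range m, ℓ (c i)) * nV (act (c m) 0)) :
    ∃ r, ∀ x, Tendsto (fun m => backwardIter act c m x) atTop (𝓝 r) := by
  have hcau : CauchySeq fun m => backwardIter act c m 0 := by
    refine cauchySeq_of_summable_dist ?_
    refine (hs.mul_left κ).of_nonneg_of_le (fun _ => dist_nonneg) fun m => ?_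
    rw [dist_comm, dist_eq_norm]
    refine (hκ _).trans (mul_le_mul_of_nonneg_left ?_ hκ0)
    have := backwardIter_sub_le hℓ hlip c m (act (c m) 0) 0
    rwa [sub_zero] at this
  obtain ⟨r, hr⟩ := cauchySeq_tendsto_of_complete hcau
  refine ⟨r, fun x => ?_⟩
  have hd : Tendsto (fun m => backwardIter act c m x - backwardIter act c m 0) atTop (𝓝 0) := by
    refine squeeze_zero_norm (fun m => ?_)
      (show Tendsto (fun m => κ * ((∏ i ∈ Finset.range m, ℓ (c i)) * nV (x - 0))) atTop (𝓝 0) by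
        simpa only [zero_mul, mul_zero] using (h0.mul_const (nV (x - 0))).const_mul κ)
    exact (hκ _).trans (mul_le_mul_of_nonneg_left (backwardIter_sub_le hℓ hlip c m x 0) hκ0)
  simpa using hd.add hr

variable [MeasurableSpace C] [MeasurableSpace E] [BorelSpace E] [SecondCountableTopology E]
  {Ω : Type*} [MeasurableSpace Ω] {μ : Measure Ω} [IsProbabilityMeasure μ] {X : ℕ → Ω → C}

omit [CompleteSpace E] [MeasurableSpace E] [BorelSpace E] [SecondCountableTopology E] in
lemma exists_forall_le_coe (f : BoundedContinuousFunction E ℝ≥0) :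
    ∃ b : ℝ≥0, ∀ x, (f x : ℝ≥0∞) ≤ b := by
  refine ⟨nndist f 0, fun x => ENNReal.coe_le_coe.2 ?_⟩
  have := f.dist_coe_le_dist (g := 0) x
  simpa [NNReal.dist_eq, ← NNReal.coe_le_coe] using this

omit [CompleteSpace E] [SecondCountableTopology E] in
/-- A stationary law of the random recurrence is a fixed point of the adjoint of the transition
operator. -/
lemma map_act_eq_iff (hact : Measurable (Function.uncurry act)) (hX : Measurable (X 0))
    (π : Measure E) [IsProbabilityMeasure π] :
    (π.prod μ).map (fun x => act (X 0 x.2) x.1) = π ↔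
      ∀ f : BoundedContinuousFunction E ℝ≥0,
        ∫⁻ x, transition act (μ.map (X 0)) (fun y => f y) x ∂π = ∫⁻ x, f x ∂π := by
  have hm : Measurable fun x : E × Ω => act (X 0 x.2) x.1 :=
    measurable_act hact (hX.comp measurable_snd) measurable_fst
  have hf (f : BoundedContinuousFunction E ℝ≥0) :
      ∫⁻ x, f x ∂((π.prod μ).map (fun x => act (X 0 x.2) x.1)) =
        ∫⁻ x, transition act (μ.map (X 0)) (fun y => f y) x ∂π := by
    have hfm : Measurable fun y => (f y : ℝ≥0∞) := f.continuous.measurable.coe_nnreal_ennreal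
    rw [lintegral_map hfm hm,
      lintegral_prod (fun a : E × Ω => (f (act (X 0 a.2) a.1) : ℝ≥0∞)) (hfm.comp hm).aemeasurable]
    refine lintegral_congr fun x => ?_
    rw [transition, lintegral_map _ hX]
    exact hfm.comp (measurable_act hact measurable_id measurable_const)
  have := Measure.isProbabilityMeasure_map (μ := π.prod μ) hm.aemeasurable
  constructor
  · intro h f
    rw [← hf, h]
  · intro h
    refine ext_of_forall_lintegral_eq_of_IsFiniteMeasure fun f => ?_
    rw [hf, h]

omit [CompleteSpace E] [SecondCountableTopology E] in
/-- The transition operator preserves bounded continuous functions. -/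
lemma exists_transition_eq (hact : Measurable (Function.uncurry act))
    (hcont : ∀ c, Continuous (act c)) (ν : Measure C) [IsProbabilityMeasure ν]
    (f : BoundedContinuousFunction E ℝ≥0) :
    ∃ g : BoundedContinuousFunction E ℝ≥0,
      transition act ν (fun y => f y) = fun y => (g y : ℝ≥0∞) := by
  obtain ⟨b, hb⟩ := exists_forall_le_coe f
  have hfm : Measurable fun y => (f y : ℝ≥0∞) := f.continuous.measurable.coe_nnreal_ennreal
  have hac (x : E) : Measurable fun c => (f (act c x) : ℝ≥0∞) :=
    hfm.comp (measurable_act hact measurable_id measurable_const)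
  have hle : ∀ x, transition act ν (fun y => f y) x ≤ b := fun x => by
    refine (lintegral_mono (g := fun _ => (b : ℝ≥0∞)) fun c => hb _).trans ?_
    simp
  have hc : Continuous (transition act ν (fun y => f y)) := by
    rw [continuous_iff_seqContinuous]
    intro u x hu
    refine tendsto_lintegral_of_dominated_convergence (fun _ => (b : ℝ≥0∞))
      (fun n => hac (u n)) (fun n => .of_forall fun c => hb _) (by simp)
      (.of_forall fun c => ?_)
    exact ((ENNReal.continuous_coe.comp (f.continuous.comp (hcont c))).tendsto x).comp hu
  have hne : ∀ x, transition act ν (fun y => f y) x ≠ ∞ :=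
    fun x => ((hle x).trans_lt ENNReal.coe_lt_top).ne
  let g : C(E, ℝ≥0) := ⟨fun x => (transition act ν (fun y => f y) x).toNNReal,
    continuous_iff_continuousAt.2 fun x =>
      (ENNReal.tendsto_toNNReal (hne x)).comp (hc.tendsto x)⟩
  refine ⟨.mkOfBound g b fun x y => ?_, ?_⟩
  · have hgb (x) : g x ≤ b := by
      rw [← ENNReal.coe_le_coe]
      exact (ENNReal.coe_toNNReal (hne x)).trans_le (hle x)
    rw [NNReal.dist_eq, abs_le]
    have hx : (g x : ℝ) ≤ b := hgb x
    have hy : (g y : ℝ) ≤ b := hgb y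
    constructor <;> linarith [(g x).2, (g y).2]
  · funext x
    exact (ENNReal.coe_toNNReal (hne x)).symm

/-- **Stationary law of a random recurrence.** If the random maps `act (X i)` are i.i.d., contract
on average in the sense that the logarithm of their Lipschitz factor has negative mean, and satisfy
a log-moment condition at `0`, then the backward iterates converge almost surely. The law of their
limit is the only stationary law, and the forward iterates converge in distribution to it from any
starting point. -/
theorem exists_stationary_law (hact : Measurable (Function.uncurry act))
    (hcont : ∀ c, Continuous (act c)) (hX : ∀ i, Measurable (X i)) (hi : iIndepFun X μ)
    (hid : ∀ i, μ.map (X i) = μ.map (X 0))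
    (hℓ : ∀ c, 0 < ℓ c) (hℓm : Measurable ℓ) (hκ0 : 0 ≤ κ) (hκ : ∀ v, ‖v‖ ≤ κ * nV v)
    (hnV : ∀ v, 0 ≤ nV v) (hnVm : Measurable nV)
    (hlip : ∀ c x y, nV (act c x - act c y) ≤ ℓ c * nV (x - y))
    (hint : Integrable (fun ω => Real.log (ℓ (X 0 ω))) μ)
    (hneg : ∫ ω, Real.log (ℓ (X 0 ω)) ∂μ < 0)
    (hint' : Integrable (fun ω => Real.log (1 + nV (act (X 0 ω) 0))) μ) :
    ∃ π : ProbabilityMeasure E,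
      ((π : Measure E).prod μ).map (fun x => act (X 0 x.2) x.1) = π ∧
      (∀ π' : ProbabilityMeasure E,
        ((π' : Measure E).prod μ).map (fun x => act (X 0 x.2) x.1) = π' → π' = π) ∧
      ∀ Y : Ω → E, Measurable Y →
        TendstoInDistribution (fun m ω => forwardIter act (fun i => X i ω) m (Y ω)) atTop id
          (fun _ => μ) (π : Measure E) := by
  have hXm : Measurable fun ω (i : ℕ) => X i ω := measurable_pi_lambda _ hX
  have hident (i) : IdentDistrib (X i) (X 0) μ μ :=
    ⟨(hX i).aemeasurable, (hX 0).aemeasurable, hid i⟩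
  have hact0 : Measurable fun c => nV (act c 0) :=
    hnVm.comp (measurable_act hact measurable_id measurable_const)
  have hφ : Measurable fun c => Real.log (ℓ c) := Real.measurable_log.comp hℓm
  have hψ : Measurable fun c => Real.log (1 + nV (act c 0)) :=
    Real.measurable_log.comp (measurable_const.add hact0)
  have slln1 := strong_law_ae_real (fun i ω => Real.log (ℓ (X i ω))) hint
    (fun i j hij => (hi.indepFun hij).comp hφ hφ) (fun i => (hident i).comp hφ)
  have slln2 := strong_law_ae_real (fun i ω => Real.log (1 + nV (act (X i ω) 0))) hint'
    (fun i j hij => (hi.indepFun hij).comp hψ hψ) (fun i => (hident i).comp hψ)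
  have hgood : ∀ᵐ ω ∂μ, Tendsto (fun m => ∏ i ∈ Finset.range m, ℓ (X i ω)) atTop (𝓝 0) ∧
      ∃ r, ∀ x, Tendsto (fun m => backwardIter act (fun i => X i ω) m x) atTop (𝓝 r) := by
    filter_upwards [slln1, slln2] with ω h1 h2
    obtain ⟨h3, h4⟩ := summable_prod_of_average (fun i => hℓ (X i ω))
      (fun i => hnV (act (X i ω) 0)) hneg h1 h2
    exact ⟨h3, backwardIter_tendsto hℓ hκ0 hκ hlip h3 h4⟩
  have hbm (m) (x : E) : Measurable fun ω => backwardIter act (fun i => X i ω) m x :=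
    (measurable_backwardIter hact m).comp (hXm.prodMk measurable_const)
  have hfm (m) {Y : Ω → E} (hY : Measurable Y) :
      Measurable fun ω => forwardIter act (fun i => X i ω) m (Y ω) :=
    (measurable_forwardIter hact m).comp (hXm.prodMk hY)
  obtain ⟨R, hRm, hR⟩ : ∃ R : Ω → E, Measurable R ∧
      ∀ᵐ ω ∂μ, ∀ x, Tendsto (fun m => backwardIter act (fun i => X i ω) m x) atTop (𝓝 (R ω)) := by
    have h0 : ∀ᵐ ω ∂μ, ∃ r, Tendsto (fun m => backwardIter act (fun i => X i ω) m 0) atTop (𝓝 r) := by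
      filter_upwards [hgood] with ω ⟨_, r, hr⟩ using ⟨r, hr 0⟩
    obtain ⟨R, hRm, hR⟩ := measurable_limit_of_tendsto_metrizable_ae
      (fun m => (hbm m 0).aemeasurable) h0
    refine ⟨R, hRm, ?_⟩
    filter_upwards [hgood, hR] with ω ⟨_, r, hr⟩ hω
    rwa [← tendsto_nhds_unique (hr 0) hω]
  have hν := Measure.isProbabilityMeasure_map (μ := μ) (hX 0).aemeasurable
  -- the iterated transition operator converges to integration against the law of `R`
  have hlim (f : BoundedContinuousFunction E ℝ≥0) (x : E) :
      Tendsto (fun m => (transition act (μ.map (X 0)))^[m] (fun y => (f y : ℝ≥0∞)) x) atTop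
        (𝓝 (∫⁻ ω, f (R ω) ∂μ)) := by
    have hfc : Continuous fun y => (f y : ℝ≥0∞) := ENNReal.continuous_coe.comp f.continuous
    simp_rw [← lintegral_backwardIter hact hX hi hid _ hfc.measurable]
    obtain ⟨b, hb⟩ := exists_forall_le_coe f
    refine tendsto_lintegral_of_dominated_convergence (fun _ => (b : ℝ≥0∞))
      (fun m => hfc.measurable.comp (hbm m x)) (fun m => .of_forall fun ω => hb _) (by simp) ?_
    filter_upwards [hR] with ω hω
    exact (hfc.tendsto _).comp (hω x)
  have hπ := Measure.isProbabilityMeasure_map (μ := μ) hRm.aemeasurable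
  let π : ProbabilityMeasure E := ⟨μ.map R, hπ⟩
  have hintR (f : BoundedContinuousFunction E ℝ≥0) : ∫⁻ x, f x ∂(μ.map R) = ∫⁻ ω, f (R ω) ∂μ :=
    lintegral_map f.continuous.measurable.coe_nnreal_ennreal hRm
  refine ⟨π, ?_, fun π' h' => ?_, fun Y hY => ?_⟩
  · refine (map_act_eq_iff hact (hX 0) (μ.map R)).2 fun f => ?_
    obtain ⟨g, hg⟩ := exists_transition_eq hact hcont (μ.map (X 0)) f
    rw [hg, hintR, hintR]
    refine tendsto_nhds_unique (hlim g 0) ?_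
    have := (hlim f 0).comp (tendsto_add_atTop_nat 1)
    refine this.congr fun m => ?_
    rw [Function.comp_apply, Function.iterate_succ_apply, hg]
  · have h1 := (map_act_eq_iff hact (hX 0) (π' : Measure E)).1 h'
    refine Subtype.ext (ext_of_forall_lintegral_eq_of_IsFiniteMeasure (μ := (π' : Measure E))
      fun f => ?_)
    have h2 : ∀ m (f : BoundedContinuousFunction E ℝ≥0),
        ∫⁻ x, (transition act (μ.map (X 0)))^[m] (fun y => f y) x ∂(π' : Measure E) =
          ∫⁻ x, f x ∂(π' : Measure E) := by
      intro m
      induction m with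
      | zero => intro f; rfl
      | succ m ih =>
        intro f
        obtain ⟨g, hg⟩ := exists_transition_eq hact hcont (μ.map (X 0)) f
        rw [← h1 f, Function.iterate_succ_apply, hg, ih g]
    have h3 : Tendsto (fun m => ∫⁻ x, (transition act (μ.map (X 0)))^[m] (fun y => f y) x
        ∂(π' : Measure E)) atTop (𝓝 (∫⁻ _, ∫⁻ ω, f (R ω) ∂μ ∂(π' : Measure E))) := by
      have hfmm : Measurable fun y => (f y : ℝ≥0∞) := f.continuous.measurable.coe_nnreal_ennreal
      obtain ⟨b, hb⟩ := exists_forall_le_coe f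
      refine tendsto_lintegral_of_dominated_convergence (fun _ => (b : ℝ≥0∞))
        (fun m => ?_) (fun m => .of_forall fun x => ?_) (by simp) (.of_forall fun x => hlim f x)
      · induction m with
        | zero => exact hfmm
        | succ m ih =>
          rw [Function.iterate_succ']
          exact measurable_transition hact _ ih
      · simp_rw [← lintegral_backwardIter hact hX hi hid _ hfmm]
        exact (lintegral_mono (g := fun _ => (b : ℝ≥0∞)) fun ω => hb _).trans (by simp)
    simp_rw [h2] at h3
    have h4 := tendsto_nhds_unique h3 tendsto_const_nhds
    refine (h4.symm.trans ?_).trans (hintR f).symm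
    simp
  · have hlaw (m) : μ.map (fun ω => forwardIter act (fun i => X i ω) m 0) =
        μ.map (fun ω => backwardIter act (fun i => X i ω) m 0) := by
      have := Measure.isProbabilityMeasure_map (μ := μ)
        (hfm m (Y := fun _ => 0) measurable_const).aemeasurable
      refine ext_of_forall_lintegral_eq_of_IsFiniteMeasure fun f => ?_
      have hfmm : Measurable fun y => (f y : ℝ≥0∞) := f.continuous.measurable.coe_nnreal_ennreal
      rw [lintegral_map hfmm (hbm m 0), lintegral_map hfmm (hfm m measurable_const),
        lintegral_backwardIter hact hX hi hid _ hfmm, lintegral_forwardIter hact hX hi hid _ hfmm]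
    have hb : TendstoInDistribution (fun m ω => backwardIter act (fun i => X i ω) m 0) atTop R
        (fun _ => μ) μ :=
      tendstoInDistribution_of_ae_tendsto (fun m => (hbm m 0).aemeasurable) hRm.aemeasurable
        (hR.mono fun ω h => h 0)
    have hf : TendstoInDistribution (fun m ω => forwardIter act (fun i => X i ω) m 0) atTop id
        (fun _ => μ) (π : Measure E) := by
      refine ⟨fun m => (hfm m measurable_const).aemeasurable, aemeasurable_id, ?_⟩
      have h1 := hb.tendsto
      simp_rw [← hlaw] at h1
      convert h1 using 2
      exact congrArg 𝓝 (Subtype.ext (Measure.map_id (μ := μ.map R)))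
    have hd : TendstoInMeasure μ (fun m ω => forwardIter act (fun i => X i ω) m (Y ω) -
        forwardIter act (fun i => X i ω) m 0) atTop (fun _ => (0 : E)) := by
      refine tendstoInMeasure_of_tendsto_ae
        (fun m => ((hfm m hY).sub (hfm m measurable_const)).aestronglyMeasurable) ?_
      filter_upwards [hgood] with ω ⟨h0, _⟩
      refine squeeze_zero_norm (fun m => ?_)
        (show Tendsto (fun m => κ * ((∏ i ∈ Finset.range m, ℓ (X i ω)) * nV (Y ω - 0))) atTop (𝓝 0) by
          simpa only [zero_mul, mul_zero] using (h0.mul_const (nV (Y ω - 0))).const_mul κ)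
      exact (hκ _).trans (mul_le_mul_of_nonneg_left (forwardIter_sub_le hℓ hlip _ m _ 0) hκ0)
    have := hf.add_of_tendstoInMeasure_const hd
      (fun m => ((hfm m hY).sub (hfm m measurable_const)).aemeasurable)
    convert this using 1
    · funext m ω
      simp
    · funext x
      simp

end Perpetuity

namespace SimpleCompoundPoisson

variable {Ω : Type*} [MeasurableSpace Ω] {μ : Measure Ω} {τ : ℝ} (X : SimpleCompoundPoisson μ τ)

/-! ### The periodic partition and the mean function -/

lemma l_pos : 0 < X.l := by
  rcases Nat.eq_zero_or_pos X.l with h | h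
  · have h1 := X.period_eq
    rw [h, Finset.sum_range_zero] at h1
    exact absurd X.period_pos (by simp [h1])
  · exact h

lemma node_nonneg (i : ℕ) : 0 ≤ X.node i := by
  rw [← X.node_zero]; exact X.node_strictMono.monotone (Nat.zero_le _)

lemma node_l : X.node X.l = τ := by
  have h := X.period_eq
  rw [Finset.sum_range_sub, X.node_zero, sub_zero] at h
  exact h.symm

lemma node_add_l (i : ℕ) : X.node (i + X.l) = X.node i + τ := by
  induction i with
  | zero => rw [zero_add, X.node_l, X.node_zero, zero_add]
  | succ i ih =>
    have := X.node_periodic i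
    rw [show i + 1 + X.l = i + X.l + 1 by ring]
    linarith

lemma eq_of_mem_Ico_node {i i' : ℕ} {t : ℝ} (h : t ∈ Ico (X.node i) (X.node (i + 1)))
    (h' : t ∈ Ico (X.node i') (X.node (i' + 1))) : i = i' := by
  have h1 := X.node_strictMono.lt_iff_lt.1 (h.1.trans_lt h'.2)
  have h2 := X.node_strictMono.lt_iff_lt.1 (h'.1.trans_lt h.2)
  omega

lemma cells_disjoint {j j' : Fin X.l} {t : ℝ} (h : t ∈ X.cells j) (h' : t ∈ X.cells j') :
    j = j' := by
  obtain ⟨k, hk⟩ := mem_iUnion.1 h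
  obtain ⟨k', hk'⟩ := mem_iUnion.1 h'
  have h1 := congrArg (· % X.l) (X.eq_of_mem_Ico_node hk hk')
  simp only [Nat.add_mul_mod_self_right, Nat.mod_eq_of_lt j.2, Nat.mod_eq_of_lt j'.2] at h1
  exact Fin.ext h1

lemma measurableSet_cells (j : Fin X.l) : MeasurableSet (X.cells j) :=
  MeasurableSet.iUnion fun _ => measurableSet_Ico

lemma mem_cells_add_period {t : ℝ} (ht : 0 ≤ t) (j : Fin X.l) :
    t + τ ∈ X.cells j ↔ t ∈ X.cells j := by
  have hs (k : ℕ) : t + τ ∈ Ico (X.node (j + (k + 1) * X.l)) (X.node (j + (k + 1) * X.l + 1)) ↔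
      t ∈ Ico (X.node (j + k * X.l)) (X.node (j + k * X.l + 1)) := by
    rw [show (j : ℕ) + (k + 1) * X.l = j + k * X.l + X.l by ring,
      show (j : ℕ) + k * X.l + X.l + 1 = j + k * X.l + 1 + X.l by ring, X.node_add_l,
      X.node_add_l]
    simp
  constructor
  · intro h
    obtain ⟨k, hk⟩ := mem_iUnion.1 h
    cases k with
    | zero =>
      have h1 : X.node (j + 0 * X.l + 1) ≤ X.node X.l :=
        X.node_strictMono.monotone (by have := j.2; omega)
      rw [X.node_l] at h1
      linarith [hk.2]
    | succ k => exact mem_iUnion.2 ⟨k, (hs k).1 hk⟩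
  · intro h
    obtain ⟨k, hk⟩ := mem_iUnion.1 h
    exact mem_iUnion.2 ⟨k + 1, (hs k).2 hk⟩

lemma rate_intervalIntegrable_zero_mul (n : ℕ) :
    IntervalIntegrable X.rate volume 0 (n * τ) := by
  induction n with
  | zero => simp
  | succ n ih =>
    have hτ := X.period_pos
    refine ih.trans ?_
    have h1 := X.rate_integrable
    have h2 (n : ℕ) : ∀ u, 0 ≤ u → X.rate (u + n * τ) = X.rate u := by
      induction n with
      | zero => simp
      | succ n ih =>
        intro u hu
        rw [← ih u hu, ← X.rate_periodic (u + n * τ) (by positivity)]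
        congr 1; push_cast; ring
    have h3 := (h1.comp_sub_right (n * τ))
    rw [zero_add, show τ + n * τ = ((n + 1 : ℕ) : ℝ) * τ by push_cast; ring] at h3
    refine h3.congr fun u hu => ?_
    rw [uIoc_of_le (by push_cast; nlinarith)] at hu
    have := h2 n (u - n * τ) (by linarith [hu.1])
    rw [sub_add_cancel] at this
    exact this.symm

lemma rate_intervalIntegrable {s t : ℝ} (hs : 0 ≤ s) (ht : 0 ≤ t) :
    IntervalIntegrable X.rate volume s t := by
  have h0 : ∀ t, 0 ≤ t → IntervalIntegrable X.rate volume 0 t := by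
    intro t ht
    obtain ⟨n, hn⟩ := exists_nat_ge (t / τ)
    rw [div_le_iff₀ X.period_pos] at hn
    refine (X.rate_intervalIntegrable_zero_mul n).mono_set ?_
    rw [uIcc_of_le ht, uIcc_of_le (ht.trans hn)]
    exact Icc_subset_Icc_right hn
  exact (h0 s hs).symm.trans (h0 t ht)

lemma cumRate_sub {s t : ℝ} (hs : 0 ≤ s) (ht : 0 ≤ t) :
    X.cumRate t - X.cumRate s = ∫ u in s..t, X.rate u :=
  intervalIntegral.integral_interval_sub_left (X.rate_intervalIntegrable le_rfl ht)
    (X.rate_intervalIntegrable le_rfl hs)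

lemma cumRate_mono {s t : ℝ} (hs : 0 ≤ s) (hst : s ≤ t) : X.cumRate s ≤ X.cumRate t := by
  rw [← sub_nonneg, X.cumRate_sub hs (hs.trans hst)]
  exact intervalIntegral.integral_nonneg hst fun u hu => X.rate_nonneg u (hs.trans hu.1)

lemma cumRate_add_period_sub {s t : ℝ} (hs : 0 ≤ s) (hst : s ≤ t) :
    X.cumRate (t + τ) - X.cumRate (s + τ) = X.cumRate t - X.cumRate s := by
  have hτ := X.period_pos
  rw [X.cumRate_sub (by linarith) (by linarith), X.cumRate_sub hs (by linarith),
    ← intervalIntegral.integral_comp_add_right]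
  refine intervalIntegral.integral_congr fun u hu => ?_
  rw [uIcc_of_le hst] at hu
  exact X.rate_periodic u (hs.trans hu.1)

lemma cumRate_add_period {t : ℝ} (ht : 0 ≤ t) :
    X.cumRate (t + τ) - X.cumRate t = X.cumRate τ := by
  have h := X.cumRate_add_period_sub le_rfl ht
  have h0 : X.cumRate 0 = 0 := by simp [cumRate]
  rw [zero_add, h0, sub_zero] at h
  linarith

lemma continuousOn_cumRate (T : ℝ) : ContinuousOn X.cumRate (Icc 0 T) := by
  rcases lt_or_ge T 0 with h | h
  · rw [Icc_eq_empty (by linarith)]; exact continuousOn_empty _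
  · have := intervalIntegral.continuousOn_primitive_interval (μ := volume) (f := X.rate) (a := 0)
      (b := T) (by
        have := X.rate_intervalIntegrable le_rfl h
        rwa [uIcc_of_le h, integrableOn_Icc_iff_integrableOn_Ioc,
          ← intervalIntegrable_iff_integrableOn_Ioc_of_le h])
    rwa [uIcc_of_le h] at this

/-! ### Arrival times -/

lemma N_le {s t : ℝ} (hs : 0 ≤ s) (hst : s ≤ t) (ω : Ω) : X.N s ω ≤ X.N t ω :=
  X.N_mono ω hs (hs.trans hst : (0 : ℝ) ≤ t) hst

lemma arrival_nonneg (n : ℕ) (ω : Ω) : 0 ≤ X.arrival n ω :=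
  Real.sInf_nonneg fun _ h => h.1

lemma arrival_le {n : ℕ} {ω : Ω} {t : ℝ} (ht : 0 ≤ t) (h : n ≤ X.N t ω) : X.arrival n ω ≤ t :=
  csInf_le ⟨0, fun _ h => h.1⟩ ⟨ht, h⟩

lemma le_N_arrival {n : ℕ} {ω : Ω} {u : ℝ} (hu : 0 ≤ u) (h : n ≤ X.N u ω) :
    n ≤ X.N (X.arrival n ω) ω := by
  by_contra! hlt
  have hc := X.N_rightCont ω _ (X.arrival_nonneg n ω)
  -- `N` is integer valued and right continuous, hence constant shortly after each time
  have hev : ∀ᶠ v in 𝓝[≥] (X.arrival n ω), X.N v ω = X.N (X.arrival n ω) ω :=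
    hc (mem_nhds_discrete.2 rfl : {X.N (X.arrival n ω) ω} ∈ 𝓝 (X.N (X.arrival n ω) ω))
  obtain ⟨v, hv, hsub⟩ := (mem_nhdsGE_iff_exists_Ico_subset).1 hev
  obtain ⟨w, hw, hwv⟩ := exists_lt_of_csInf_lt
    (show {t | 0 ≤ t ∧ n ≤ X.N t ω}.Nonempty from ⟨u, hu, h⟩) (hv : X.arrival n ω < v)
  have hw' : X.N w ω = X.N (X.arrival n ω) ω := hsub ⟨X.arrival_le hw.1 hw.2, hwv⟩
  have := hw.2
  omega

lemma arrival_le_iff {n : ℕ} {ω : Ω} {u t : ℝ} (hu : 0 ≤ u) (h : n ≤ X.N u ω) (ht : 0 ≤ t) :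
    X.arrival n ω ≤ t ↔ n ≤ X.N t ω :=
  ⟨fun h' => (X.le_N_arrival hu h).trans (X.N_le (X.arrival_nonneg n ω) h' ω), X.arrival_le ht⟩

lemma arrival_mono {m n : ℕ} {ω : Ω} {u : ℝ} (hu : 0 ≤ u) (h : n ≤ X.N u ω) (hmn : m ≤ n) :
    X.arrival m ω ≤ X.arrival n ω :=
  X.arrival_le (X.arrival_nonneg n ω) (hmn.trans (X.le_N_arrival hu h))

end SimpleCompoundPoisson

/-- The first time at which the counting path `w` reaches level `n`. Taking the infimum over a
countable dense set of times makes it a measurable functional of the path. -/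
noncomputable def firstTime (n : ℕ) (w : ℝ≥0 → ℕ) : ℝ :=
  (⨅ k : ℕ, if n ≤ w (TopologicalSpace.denseSeq ℝ≥0 k) then
    (TopologicalSpace.denseSeq ℝ≥0 k : ℝ≥0∞) else ∞).toReal

lemma firstTime_nonneg (n : ℕ) (w : ℝ≥0 → ℕ) : 0 ≤ firstTime n w := ENNReal.toReal_nonneg

lemma measurable_firstTime (n : ℕ) : Measurable (firstTime n) := by
  refine ENNReal.measurable_toReal.comp (Measurable.iInf fun k => ?_)
  refine Measurable.ite ?_ measurable_const measurable_const
  exact measurableSet_le measurable_const (measurable_pi_apply _)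

lemma firstTime_eq {n : ℕ} {w : ℝ≥0 → ℕ} {t₀ : ℝ≥0} (h : ∀ t, n ≤ w t ↔ t₀ ≤ t) :
    firstTime n w = t₀ := by
  have : (⨅ k : ℕ, if n ≤ w (TopologicalSpace.denseSeq ℝ≥0 k) then
    (TopologicalSpace.denseSeq ℝ≥0 k : ℝ≥0∞) else ∞) = (t₀ : ℝ≥0∞) := by
    refine le_antisymm (ENNReal.le_of_forall_pos_le_add fun ε hε _ => ?_) (le_iInf fun k => ?_)
    · obtain ⟨_, hk, k, rfl⟩ := (TopologicalSpace.denseRange_denseSeq ℝ≥0).inter_open_nonempty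
        _ (isOpen_Ioo (a := t₀) (b := t₀ + ε)) (nonempty_Ioo.2 (by simpa using hε))
      refine (iInf_le _ k).trans ?_
      rw [if_pos ((h _).2 hk.1.le)]
      exact_mod_cast hk.2.le
    · split_ifs with hk
      · exact_mod_cast (h _).1 hk
      · exact le_top
  rw [firstTime, this, ENNReal.coe_toReal]

/-- A finite set of times lies on a nondecreasing sequence of times that starts at `0`. This reduces
statements on finitely many values of a process to its increments over consecutive intervals. -/
lemma exists_monotone_enumeration (F : Finset ℝ≥0) :
    ∃ (t : ℕ → ℝ≥0) (M : ℕ), Monotone t ∧ t 0 = 0 ∧ (∀ u ∈ F, ∃ i ≤ M, t i = u) ∧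
      ∀ i, t i = 0 ∨ t i ∈ F := by
  induction F using Finset.induction_on_max with
  | empty => exact ⟨fun _ => 0, 0, monotone_const, rfl, by simp, by simp⟩
  | insert x F hx ih =>
    obtain ⟨t, M, hm, h0, hF, hr⟩ := ih
    have hle (i : ℕ) : t i ≤ x := by
      rcases hr i with h | h
      · rw [h]; exact zero_le
      · exact (hx _ h).le
    refine ⟨fun i => if i ≤ M then t i else x, M + 1, ?_, by simp [h0], ?_, ?_⟩
    · intro i i' hii'
      dsimp only
      split_ifs with h1 h2 h2
      · exact hm hii'
      · exact hle i
      · omega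
      · exact le_rfl
    · intro u hu
      rcases Finset.mem_insert.1 hu with rfl | hu
      · exact ⟨M + 1, le_rfl, by simp⟩
      · obtain ⟨i, hi, rfl⟩ := hF u hu
        exact ⟨i, by omega, by simp [hi]⟩
    · intro i
      dsimp only
      split_ifs with h1
      · exact (hr i).imp_right (Finset.mem_insert_of_mem)
      · exact .inr (Finset.mem_insert_self _ _)

namespace SimpleCompoundPoisson

variable {Ω : Type*} [MeasurableSpace Ω] {μ : Measure Ω} {τ : ℝ} (X : SimpleCompoundPoisson μ τ)

/-! ### Past and future of the marked point process -/

/-- The period `τ` as a nonnegative real number. -/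
def period (_X : SimpleCompoundPoisson μ τ) : ℝ≥0 := τ.toNNReal

lemma coe_period : (X.period : ℝ) = τ := Real.coe_toNNReal _ X.period_pos.le

/-- The path of `N` stopped at time `a`. -/
def pastN (a : ℝ≥0) (ω : Ω) : ℝ≥0 → ℕ := fun u => X.N (min u a : ℝ≥0) ω

/-- The path of `N` restarted at time `a`. -/
def futureN (a : ℝ≥0) (ω : Ω) : ℝ≥0 → ℕ := fun u => X.N (a + u : ℝ≥0) ω - X.N a ω

lemma measurable_N' (t : ℝ≥0) : Measurable (X.N t) := X.measurable_N t t.2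

lemma measurable_pastN (a : ℝ≥0) : Measurable (X.pastN a) :=
  measurable_pi_lambda _ fun u => X.measurable_N' (min u a)

lemma measurable_futureN (a : ℝ≥0) : Measurable (X.futureN a) :=
  measurable_pi_lambda _ fun u => (X.measurable_N' (a + u)).sub (X.measurable_N' a)

lemma sum_increments (t : ℕ → ℝ≥0) (ht : Monotone t) (k : ℕ) (ω : Ω) :
    ∑ i ∈ Finset.range k, (X.N (t (i + 1)) ω - X.N (t i) ω) = X.N (t k) ω - X.N (t 0) ω :=
  Finset.sum_range_tsub (fun _ _ h => X.N_le (t _).2 (NNReal.coe_le_coe.2 (ht h)) ω) k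

lemma indepFun_pastN_futureN [IsProbabilityMeasure μ] (a : ℝ≥0) :
    IndepFun (X.pastN a) (X.futureN a) μ := by
  refine IndepFun.process_indepFun_process
    (fun u => X.measurable_N' (min u a)) (fun u => (X.measurable_N' (a + u)).sub (X.measurable_N' a))
    fun I J => ?_
  obtain ⟨t₁, M₁, hm₁, h0₁, hI, hr₁⟩ := exists_monotone_enumeration (I.image fun u => min u a)
  obtain ⟨t₂, M₂, hm₂, h0₂, hJ, -⟩ := exists_monotone_enumeration J
  have hle (i) : t₁ i ≤ a := by
    rcases hr₁ i with h | h
    · rw [h]; exact zero_le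
    · obtain ⟨u, -, hu⟩ := Finset.mem_image.1 h
      rw [← hu]; exact min_le_right _ _
  -- a partition which lists the times before `a` and then the times after `a`
  let t : ℕ → ℝ≥0 := fun i => if i ≤ M₁ then t₁ i else a + t₂ (i - (M₁ + 1))
  have hmt : Monotone t := by
    intro i i' hii'
    simp only [t]
    split_ifs with h1 h2 h2
    · exact hm₁ hii'
    · exact (hle i).trans le_self_add
    · omega
    · gcongr
      exact hm₂ (by omega)
  have hind := X.N_indep.nat hmt
  have hmeas (i : ℕ) : Measurable fun ω => X.N (t (i + 1)) ω - X.N (t i) ω :=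
    (X.measurable_N' _).sub (X.measurable_N' _)
  have hind2 := hind.indepFun_finset (Finset.range M₁) (Finset.Ico (M₁ + 1) (M₁ + 1 + M₂))
    (Finset.disjoint_left.2 fun i h1 h2 => by
      have := Finset.mem_range.1 h1; have := Finset.mem_Ico.1 h2; omega) hmeas
  choose i hiM hi using fun u : I => hI _ (Finset.mem_image_of_mem _ u.2)
  choose j hjM hj using fun u : J => hJ _ u.2
  let F : (Finset.range M₁ → ℕ) → I → ℕ := fun d u =>
    ∑ k : Finset.range M₁, if (k : ℕ) < i u then d k else 0
  let G : (Finset.Ico (M₁ + 1) (M₁ + 1 + M₂) → ℕ) → J → ℕ := fun d u =>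
    ∑ k : Finset.Ico (M₁ + 1) (M₁ + 1 + M₂), if (k : ℕ) < M₁ + 1 + j u then d k else 0
  have hF : Measurable F := measurable_of_countable F
  have hG : Measurable G := measurable_of_countable G
  have hcomp := hind2.comp hF hG
  convert hcomp using 1
  · funext ω u
    have h1 : (fun k : ℕ => if k < i u then X.N (t (k + 1)) ω - X.N (t k) ω else 0) =
      fun k => if k < i u then X.N (t₁ (k + 1)) ω - X.N (t₁ k) ω else 0 := by
        funext k
        split_ifs with hk
        · have := hiM u
          simp only [t]
          rw [if_pos (by omega), if_pos (by omega)]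
        · rfl
    have h2 := Finset.sum_coe_sort (Finset.range M₁)
      (fun k : ℕ => if k < i u then X.N (t (k + 1)) ω - X.N (t k) ω else 0)
    refine Eq.trans ?_ h2.symm
    rw [h1, ← Finset.sum_filter]
    have h3 : (Finset.range M₁).filter (· < i u) = Finset.range (i u) := by
      ext k; simp only [Finset.mem_filter, Finset.mem_range]; have := hiM u; omega
    rw [h3, X.sum_increments t₁ hm₁, hi, h0₁, NNReal.coe_zero, X.N_zero, Nat.sub_zero]
    rfl
  · funext ω u
    have h2 := Finset.sum_coe_sort (Finset.Ico (M₁ + 1) (M₁ + 1 + M₂))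
      (fun k : ℕ => if k < M₁ + 1 + j u then X.N (t (k + 1)) ω - X.N (t k) ω else 0)
    refine Eq.trans ?_ h2.symm
    rw [← Finset.sum_filter]
    have h3 : (Finset.Ico (M₁ + 1) (M₁ + 1 + M₂)).filter (· < M₁ + 1 + j u) =
        Finset.Ico (M₁ + 1) (M₁ + 1 + j u) := by
      ext k; simp only [Finset.mem_filter, Finset.mem_Ico]; have := hjM u; omega
    rw [h3, Finset.sum_Ico_eq_sum_range]
    have h4 : ∀ k, t (M₁ + 1 + k) = a + t₂ k := fun k => by
      simp only [t]
      rw [if_neg (by omega), Nat.add_sub_cancel_left]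
    have h5 := X.sum_increments (fun k => a + t₂ k) (fun _ _ h => by
      have := hm₂ h; dsimp only; gcongr) (j u) ω
    simp only [h0₂, add_zero, hj] at h5
    rw [show M₁ + 1 + j u - (M₁ + 1) = j u by omega]
    refine h5.symm.trans ?_
    refine Finset.sum_congr rfl fun k _ => ?_
    rw [h4, add_assoc (M₁ + 1), h4]

lemma map_futureN_add_period [IsProbabilityMeasure μ] (a : ℝ≥0) :
    μ.map (X.futureN (a + X.period)) = μ.map (X.futureN a) := by
  refine (map_eq_iff_forall_finset_map_restrict_eq
    (X := fun u ω => X.futureN (a + X.period) ω u) (Y := fun u ω => X.futureN a ω u)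
    (X.measurable_futureN _).aemeasurable (X.measurable_futureN _).aemeasurable).2 fun J => ?_
  obtain ⟨t, M, hm, h0, hJ, -⟩ := exists_monotone_enumeration J
  choose j hjM hj using fun u : J => hJ _ u.2
  have hma (b : ℝ≥0) : Monotone fun k => b + t k := fun _ _ h => by
    have := hm h; dsimp only; gcongr
  let G : (ℕ → ℕ) → J → ℕ := fun d u => ∑ k ∈ Finset.range (j u), d k
  have hG : Measurable G := measurable_pi_lambda _ fun u =>
    Finset.measurable_fun_sum _ fun k _ => measurable_pi_apply k
  have hmeas (b : ℝ≥0) (k : ℕ) :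
      Measurable fun ω => X.N (b + t (k + 1) : ℝ≥0) ω - X.N (b + t k : ℝ≥0) ω :=
    (X.measurable_N' _).sub (X.measurable_N' _)
  have key (b : ℝ≥0) : μ.map (fun ω => J.restrict fun u => X.futureN b ω u) =
      (Measure.infinitePi fun k : ℕ =>
        μ.map fun ω => X.N (b + t (k + 1) : ℝ≥0) ω - X.N (b + t k : ℝ≥0) ω).map G := by
    rw [← (X.N_indep.nat (hma b)).map_fun_eq_infinitePi_map (hmeas b),
      Measure.map_map hG (measurable_pi_lambda _ (hmeas b))]
    congr 1
    funext ω u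
    have h5 := X.sum_increments _ (hma b) (j u) ω
    simp only [h0, add_zero, hj] at h5
    exact h5.symm
  rw [key, key]
  congr 2
  funext k
  have hlaw (b : ℝ≥0) : μ.map (fun ω => X.N (b + t (k + 1) : ℝ≥0) ω - X.N (b + t k : ℝ≥0) ω) =
      poissonMeasure (X.cumRate (b + t (k + 1) : ℝ≥0) - X.cumRate (b + t k : ℝ≥0)).toNNReal := by
    rw [X.cumRate_sub (NNReal.coe_nonneg _) (NNReal.coe_nonneg _)]
    exact X.N_law _ _ (NNReal.coe_nonneg _) (NNReal.coe_le_coe.2 (hma b (Nat.le_succ k)))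
  rw [hlaw, hlaw]
  congr 2
  have h := X.cumRate_add_period_sub (NNReal.coe_nonneg (a + t k))
    (NNReal.coe_le_coe.2 (hma a (Nat.le_succ k)))
  rw [← h]
  congr 2 <;> push_cast <;> rw [X.coe_period] <;> ring

/-- All marks, numbered from `0`. -/
def marks (ω : Ω) : ℕ × Fin X.l → ℝ := fun i => X.Z (i.1 + 1) i.2 ω

lemma measurable_marks : Measurable X.marks :=
  measurable_pi_lambda _ fun i => X.measurable_Z (i.1 + 1) i.2 (by omega)

/-- The marks with numbers below `k`, the others being replaced by `0`. -/
def truncMarks {l : ℕ} (k : ℕ) (z : ℕ × Fin l → ℝ) : ℕ × Fin l → ℝ :=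
  fun i => if i.1 < k then z i else 0

/-- The marks from number `k` on, renumbered from `0`. -/
def shiftMarks {l : ℕ} (k : ℕ) (z : ℕ × Fin l → ℝ) : ℕ × Fin l → ℝ := fun i => z (i.1 + k, i.2)

lemma measurable_truncMarks {l : ℕ} (k : ℕ) : Measurable (truncMarks (l := l) k) := by
  refine measurable_pi_lambda _ fun i => ?_
  by_cases h : i.1 < k
  · simpa only [truncMarks, h, if_true] using measurable_pi_apply i
  · simpa only [truncMarks, h, if_false] using measurable_const

lemma measurable_shiftMarks {l : ℕ} (k : ℕ) : Measurable (shiftMarks (l := l) k) :=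
  measurable_pi_lambda _ fun _ => measurable_pi_apply _

lemma indepFun_trunc_shift [IsProbabilityMeasure μ] (k : ℕ) :
    IndepFun (fun ω => truncMarks k (X.marks ω)) (fun ω => shiftMarks k (X.marks ω)) μ := by
  have hZ : ∀ i : ℕ × Fin X.l, Measurable (X.Z (i.1 + 1) i.2) :=
    fun i => X.measurable_Z _ _ (by omega)
  refine IndepFun.process_indepFun_process
    (X := fun i ω => truncMarks k (X.marks ω) i) (Y := fun i ω => shiftMarks k (X.marks ω) i)
    (fun i => (measurable_pi_apply i).comp ((measurable_truncMarks k).comp X.measurable_marks))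
    (fun i => hZ _) fun I J => ?_
  classical
  have h := X.Z_indep.indepFun_finset (I.filter fun i => i.1 < k)
    (J.image fun i => (i.1 + k, i.2)) (Finset.disjoint_left.2 fun i h1 h2 => by
      obtain ⟨j, -, rfl⟩ := Finset.mem_image.1 h2
      have := (Finset.mem_filter.1 h1).2
      dsimp only at this; omega) hZ
  let F : ((I.filter fun i => i.1 < k) → ℝ) → I → ℝ := fun z i =>
    if h : i.1.1 < k then z ⟨i.1, Finset.mem_filter.2 ⟨i.2, h⟩⟩ else 0
  let G : ((J.image fun i => (i.1 + k, i.2)) → ℝ) → J → ℝ := fun z i =>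
    z ⟨(i.1.1 + k, i.1.2), Finset.mem_image_of_mem (fun i => (i.1 + k, i.2)) i.2⟩
  have hF : Measurable F := by
    refine measurable_pi_lambda _ fun i => ?_
    by_cases h : i.1.1 < k
    · simpa only [F, h, dite_true] using measurable_pi_apply _
    · simpa only [F, h, dite_false] using measurable_const
  have hG : Measurable G := measurable_pi_lambda _ fun i => measurable_pi_apply _
  refine (h.comp hF hG).congr (.of_eq ?_) (.of_eq rfl)
  funext ω i
  simp only [truncMarks, marks, F, Function.comp_apply, dite_eq_ite]

lemma map_shiftMarks [IsProbabilityMeasure μ] (k : ℕ) :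
    μ.map (fun ω => shiftMarks k (X.marks ω)) = μ.map X.marks := by
  have hZ : ∀ i : ℕ × Fin X.l, Measurable (X.Z (i.1 + 1) i.2) :=
    fun i => X.measurable_Z _ _ (by omega)
  have hinj : Function.Injective fun i : ℕ × Fin X.l => (i.1 + k, i.2) := by
    rintro ⟨i, j⟩ ⟨i', j'⟩ h
    simp only [Prod.mk.injEq] at h ⊢
    exact ⟨by omega, h.2⟩
  have h1 := (X.Z_indep.precomp hinj).map_fun_eq_infinitePi_map (fun i => hZ _)
  have h2 := X.Z_indep.map_fun_eq_infinitePi_map hZ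
  refine h1.trans (Eq.trans ?_ h2.symm)
  congr 1
  funext i
  rw [X.Z_law _ _ (by omega), X.Z_law _ _ (by omega)]

/-- The marked point process up to time `a`. -/
def past (a : ℝ≥0) (ω : Ω) : (ℝ≥0 → ℕ) × (ℕ × Fin X.l → ℝ) :=
  (X.pastN a ω, truncMarks (X.N a ω) (X.marks ω))

/-- The marked point process after time `a`. -/
def future (a : ℝ≥0) (ω : Ω) : (ℝ≥0 → ℕ) × (ℕ × Fin X.l → ℝ) :=
  (X.futureN a ω, shiftMarks (X.N a ω) (X.marks ω))

lemma measurable_past (a : ℝ≥0) : Measurable (X.past a) := by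
  refine (X.measurable_pastN a).prodMk ?_
  have : Measurable fun p : ℕ × (ℕ × Fin X.l → ℝ) => truncMarks p.1 p.2 :=
    measurable_from_prod_countable_right fun k => measurable_truncMarks k
  exact this.comp ((X.measurable_N' a).prodMk X.measurable_marks)

lemma measurable_future (a : ℝ≥0) : Measurable (X.future a) := by
  refine (X.measurable_futureN a).prodMk ?_
  have : Measurable fun p : ℕ × (ℕ × Fin X.l → ℝ) => shiftMarks p.1 p.2 :=
    measurable_from_prod_countable_right fun k => measurable_shiftMarks k
  exact this.comp ((X.measurable_N' a).prodMk X.measurable_marks)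

/-- The marked point process after time `a` is independent of the one before, and its counts and
marks have a product law. Conditionally on `N a = k`, the past only involves the first `k` marks, and the
remaining ones have the same law as the whole family. -/
lemma measure_past_future [IsProbabilityMeasure μ] (a : ℝ≥0)
    {A B : Set ((ℝ≥0 → ℕ) × (ℕ × Fin X.l → ℝ))} (hA : MeasurableSet A) (hB : MeasurableSet B) :
    μ (X.past a ⁻¹' A ∩ X.future a ⁻¹' B) =
      μ (X.past a ⁻¹' A) * ((μ.map (X.futureN a)).prod (μ.map X.marks)) B := by
  set P : ℕ → Ω → (ℝ≥0 → ℕ) × (ℕ × Fin X.l → ℝ) :=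
    fun k ω => (X.pastN a ω, truncMarks k (X.marks ω))
  set F : ℕ → Ω → (ℝ≥0 → ℕ) × (ℕ × Fin X.l → ℝ) :=
    fun k ω => (X.futureN a ω, shiftMarks k (X.marks ω))
  have hT (k) : Measurable fun ω => truncMarks k (X.marks ω) :=
    (measurable_truncMarks k).comp X.measurable_marks
  have hS (k) : Measurable fun ω => shiftMarks k (X.marks ω) :=
    (measurable_shiftMarks k).comp X.measurable_marks
  have hNZ : IndepFun (fun ω (t : ℝ≥0) => X.N t ω) X.marks μ := X.Z_indep_N.symm
  have hpf : Measurable fun w : ℝ≥0 → ℕ =>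
      ((fun u => w (min u a) : ℝ≥0 → ℕ), (fun u => w (a + u) - w a : ℝ≥0 → ℕ)) :=
    (measurable_pi_lambda _ fun _ => measurable_pi_apply _).prodMk
      (measurable_pi_lambda _ fun _ => (measurable_pi_apply _).sub (measurable_pi_apply _))
  have hind (k) : IndepFun (P k) (F k) μ := by
    refine IndepFun.prodMk_prodMk_of_indepFun (X.measurable_pastN a) (X.measurable_futureN a)
      (hT k) (hS k) (X.indepFun_pastN_futureN a) (X.indepFun_trunc_shift k) ?_
    exact hNZ.comp hpf ((measurable_truncMarks k).prodMk (measurable_shiftMarks k))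
  have hlaw (k) : μ.map (F k) = (μ.map (X.futureN a)).prod (μ.map X.marks) := by
    have h := hNZ.comp (measurable_snd.comp hpf) (measurable_shiftMarks (l := X.l) k)
    have h' := (indepFun_iff_map_prod_eq_prod_map_map (X.measurable_futureN a).aemeasurable
      (hS k).aemeasurable).1 h
    rw [X.map_shiftMarks] at h'
    exact h'
  have hFm (k) : Measurable (F k) := (X.measurable_futureN a).prodMk (hS k)
  have hPm (k) : Measurable (P k) := (X.measurable_pastN a).prodMk (hT k)
  -- on the event `N a = k` the number of marks used up is `k`
  have hNa (k : ℕ) : MeasurableSet {p : (ℝ≥0 → ℕ) × (ℕ × Fin X.l → ℝ) | p.1 a = k} :=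
    measurableSet_eq_fun ((measurable_pi_apply a).comp measurable_fst) measurable_const
  have hsplit (s : Set Ω) (hs : MeasurableSet s) :
      μ s = ∑' k : ℕ, μ (X.N a ⁻¹' {k} ∩ s) := by
    rw [← measure_iUnion]
    · congr 1
      ext ω; simp
    · intro k k' hkk'
      refine Set.disjoint_left.2 fun ω h h' => hkk' ?_
      rw [← h.1, ← h'.1]
    · exact fun k => ((X.measurable_N' a) (measurableSet_singleton k)).inter hs
  rw [hsplit _ ((X.measurable_past a hA).inter (X.measurable_future a hB)),
    hsplit _ (X.measurable_past a hA), ← ENNReal.tsum_mul_right]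
  refine tsum_congr fun k => ?_
  have h1 : X.N a ⁻¹' {k} ∩ (X.past a ⁻¹' A ∩ X.future a ⁻¹' B) =
      P k ⁻¹' ({p | p.1 a = k} ∩ A) ∩ F k ⁻¹' B := by
    ext ω
    simp only [mem_inter_iff, mem_preimage, mem_singleton_iff, P, F, past, future, pastN,
      mem_ofPred_eq, min_self]
    constructor
    · rintro ⟨rfl, h⟩; exact ⟨⟨rfl, h.1⟩, h.2⟩
    · rintro ⟨⟨rfl, h⟩, h'⟩; exact ⟨rfl, h, h'⟩
  have h2 : X.N a ⁻¹' {k} ∩ X.past a ⁻¹' A = P k ⁻¹' ({p | p.1 a = k} ∩ A) := by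
    ext ω
    simp only [mem_inter_iff, mem_preimage, mem_singleton_iff, P, past, pastN,
      mem_ofPred_eq, min_self]
    constructor
    · rintro ⟨rfl, h⟩; exact ⟨rfl, h⟩
    · rintro ⟨rfl, h⟩; exact ⟨rfl, h⟩
  rw [h1, h2, indepFun_iff_measure_inter_preimage_eq_mul.1 (hind k) _ _ ((hNa k).inter hA) hB,
    ← hlaw k, Measure.map_apply (hFm k) hB]

/-- The marked point process after time `a` consists of a restarted path of `N` and an independent
fresh copy of the marks. -/
lemma map_future [IsProbabilityMeasure μ] (a : ℝ≥0) :
    μ.map (X.future a) = (μ.map (X.futureN a)).prod (μ.map X.marks) := by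
  refine Measure.ext fun B hB => ?_
  have := X.measure_past_future a .univ hB
  rwa [preimage_univ, univ_inter, measure_univ, one_mul,
    ← Measure.map_apply (X.measurable_future a) hB] at this

/-- The Markov property of the marked point process at the deterministic time `a`. -/
lemma indepFun_past_future [IsProbabilityMeasure μ] (a : ℝ≥0) :
    IndepFun (X.past a) (X.future a) μ := by
  rw [indepFun_iff_measure_inter_preimage_eq_mul]
  intro A B hA hB
  rw [X.measure_past_future a hA hB, ← X.map_future, Measure.map_apply (X.measurable_future a) hB]

lemma map_future_add_period [IsProbabilityMeasure μ] (a : ℝ≥0) :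
    μ.map (X.future (a + X.period)) = μ.map (X.future a) := by
  rw [X.map_future, X.map_future, X.map_futureN_add_period]

end SimpleCompoundPoisson

namespace SimpleCompoundPoisson

variable {Ω : Type*} [MeasurableSpace Ω] {μ : Measure Ω} {τ : ℝ} (X : SimpleCompoundPoisson μ τ)

/-! ### The compound process -/

/-- The pure jump part `∑_{n = 1}^{N(t)} Z_n` of the driving process. -/
noncomputable def comp (t : ℝ) (ω : Ω) : ℝ := ∑ n ∈ Finset.range (X.N t ω), X.jump (n + 1) ω

/-- The increments of the jump part after time `a`. -/
noncomputable def block (a : ℝ≥0) (ω : Ω) : ℝ≥0 → ℝ := fun u => X.comp (a + u : ℝ≥0) ω - X.comp a ω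

lemma S_eq (t : ℝ) (ω : Ω) : X.S t ω = X.drift t + X.comp t ω := by
  rw [S, comp, Finset.range_eq_Ico, Finset.sum_Ico_add' (fun n => X.jump n ω) 0 (X.N t ω) 1]
  rfl

lemma comp_zero (ω : Ω) : X.comp 0 ω = 0 := by simp [comp, X.N_zero]

lemma comp_sub {s t : ℝ} (hs : 0 ≤ s) (hst : s ≤ t) (ω : Ω) :
    X.comp t ω - X.comp s ω =
      ∑ n ∈ Finset.range (X.N t ω - X.N s ω), X.jump (X.N s ω + n + 1) ω := by
  rw [comp, comp, ← Finset.sum_range_add_sum_Ico _ (X.N_le hs hst ω), add_sub_cancel_left,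
    Finset.sum_Ico_eq_sum_range]

open Classical in
/-- The size of jump number `n + 1` of a marked counting path `p` which starts at time `a`. -/
noncomputable def pathJump (a : ℝ≥0) (n : ℕ) (p : (ℝ≥0 → ℕ) × (ℕ × Fin X.l → ℝ)) : ℝ :=
  ∑ j : Fin X.l, if a + firstTime (n + 1) p.1 ∈ X.cells j then p.2 (n, j) else 0

/-- The sum of the jumps of a marked counting path which starts at time `a`. -/
noncomputable def pathSum (a : ℝ≥0) (p : (ℝ≥0 → ℕ) × (ℕ × Fin X.l → ℝ)) : ℝ≥0 → ℝ :=
  fun u => ∑ n ∈ Finset.range (p.1 u), X.pathJump a n p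

lemma measurable_pathJump (a : ℝ≥0) (n : ℕ) : Measurable (X.pathJump a n) := by
  classical
  refine Finset.measurable_fun_sum _ fun j _ => Measurable.ite ?_ ?_ measurable_const
  · exact (((measurable_firstTime _).comp measurable_fst).const_add _) (X.measurableSet_cells j)
  · exact (measurable_pi_apply _).comp measurable_snd

omit X in
lemma measurable_sum_range_path {l : ℕ} {β : Type*} [AddCommMonoid β] [MeasurableSpace β]
    [MeasurableAdd₂ β] {f : ℕ → (ℝ≥0 → ℕ) × (ℕ × Fin l → ℝ) → β}
    (hf : ∀ n, Measurable (f n)) (u : ℝ≥0) :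
    Measurable fun p : (ℝ≥0 → ℕ) × (ℕ × Fin l → ℝ) => ∑ n ∈ Finset.range (p.1 u), f n p := by
  have h : Measurable fun q : ℕ × ((ℝ≥0 → ℕ) × (ℕ × Fin l → ℝ)) =>
      ∑ n ∈ Finset.range q.1, f n q.2 :=
    measurable_from_prod_countable_right fun k =>
      Finset.measurable_fun_sum (Finset.range k) fun n _ => hf n
  have h2 : Measurable fun p : (ℝ≥0 → ℕ) × (ℕ × Fin l → ℝ) => (p.1 u, p) :=
    ((measurable_pi_apply u).comp measurable_fst).prodMk measurable_id
  exact h.comp h2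

lemma measurable_pathSum (a : ℝ≥0) : Measurable (X.pathSum a) :=
  measurable_pi_lambda _ fun u => measurable_sum_range_path (X.measurable_pathJump a) u

lemma pathSum_add_period (a : ℝ≥0) : X.pathSum (a + X.period) = X.pathSum a := by
  funext p u
  refine Finset.sum_congr rfl fun n _ => Finset.sum_congr rfl fun j _ => ?_
  have h : ((a + X.period : ℝ≥0) : ℝ) + firstTime (n + 1) p.1 = a + firstTime (n + 1) p.1 + τ := by
    rw [NNReal.coe_add, X.coe_period]; ring
  have hn : 0 ≤ (a : ℝ) + firstTime (n + 1) p.1 := add_nonneg a.coe_nonneg (firstTime_nonneg _ _)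
  rw [h]
  classical
  exact if_congr (X.mem_cells_add_period hn j) rfl rfl

lemma jump_eq_pathJump_future {a : ℝ≥0} {ω : Ω} {n : ℕ} {v : ℝ} (hv : 0 ≤ v)
    (h : X.N a ω + n + 1 ≤ X.N v ω) :
    X.jump (X.N a ω + n + 1) ω = X.pathJump a n (X.future a ω) := by
  have ha : (a : ℝ) ≤ X.arrival (X.N a ω + n + 1) ω := by
    by_contra! hlt
    have := (X.arrival_le_iff hv h a.coe_nonneg).1 hlt.le
    omega
  have hT := X.arrival_nonneg (X.N a ω + n + 1) ω
  have hft : firstTime (n + 1) (X.futureN a ω) =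
      ((X.arrival (X.N a ω + n + 1) ω - a).toNNReal : ℝ≥0) := by
    refine firstTime_eq fun t => ?_
    have h1 := X.arrival_le_iff hv h (t := (a + t : ℝ≥0)) (NNReal.coe_nonneg _)
    have h2 : n + 1 ≤ X.futureN a ω t ↔ X.N a ω + n + 1 ≤ X.N (a + t : ℝ≥0) ω := by
      rw [futureN]; omega
    rw [h2, ← h1, Real.toNNReal_le_iff_le_coe, NNReal.coe_add, sub_le_iff_le_add']
  rw [Real.coe_toNNReal _ (by linarith)] at hft
  refine Finset.sum_congr rfl fun j _ => ?_
  rw [show (X.future a ω).1 = X.futureN a ω from rfl, hft, add_sub_cancel]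
  simp only [future, shiftMarks, marks, add_comm n]

lemma jump_eq_pathJump_past {a : ℝ≥0} {ω : Ω} {n : ℕ} (h : n + 1 ≤ X.N a ω) :
    X.jump (n + 1) ω = X.pathJump 0 n (X.past a ω) := by
  have hT := X.arrival_nonneg (n + 1) ω
  have hft : firstTime (n + 1) (X.pastN a ω) = ((X.arrival (n + 1) ω).toNNReal : ℝ≥0) := by
    refine firstTime_eq fun t => ?_
    have h1 := X.arrival_le_iff a.coe_nonneg h (t := (min t a : ℝ≥0)) (NNReal.coe_nonneg _)
    have h2 := X.arrival_le a.coe_nonneg h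
    rw [pastN, ← h1, Real.toNNReal_le_iff_le_coe, NNReal.coe_min]
    exact ⟨fun h => h.trans (min_le_left _ _), fun h => le_min h h2⟩
  rw [Real.coe_toNNReal _ hT] at hft
  refine Finset.sum_congr rfl fun j _ => ?_
  rw [show (X.past a ω).1 = X.pastN a ω from rfl, hft, NNReal.coe_zero, zero_add]
  simp only [past, truncMarks, marks, if_pos (show n < X.N a ω from h)]

lemma block_eq (a : ℝ≥0) (ω : Ω) : X.block a ω = X.pathSum a (X.future a ω) := by
  funext u
  rw [block, X.comp_sub a.coe_nonneg (NNReal.coe_le_coe.2 le_self_add)]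
  refine Finset.sum_congr rfl fun n hn => X.jump_eq_pathJump_future (NNReal.coe_nonneg (a + u)) ?_
  have : n < X.N (a + u : ℝ≥0) ω - X.N a ω := Finset.mem_range.1 hn
  omega

lemma comp_eq_pathSum_past {a u : ℝ≥0} (hu : u ≤ a) (ω : Ω) :
    X.comp u ω = X.pathSum 0 (X.past a ω) u := by
  have h1 : (X.past a ω).1 u = X.N u ω := by simp only [past, pastN, min_eq_left hu]
  rw [comp, pathSum, h1]
  refine Finset.sum_congr rfl fun n hn => X.jump_eq_pathJump_past ?_
  have := Finset.mem_range.1 hn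
  have := X.N_le u.coe_nonneg (NNReal.coe_le_coe.2 hu) ω
  omega

lemma measurable_block (a : ℝ≥0) : Measurable (X.block a) := by
  rw [show X.block a = fun ω => X.pathSum a (X.future a ω) from funext (X.block_eq a)]
  exact (X.measurable_pathSum a).comp (X.measurable_future a)

lemma measurable_comp (t : ℝ≥0) : Measurable (X.comp t) := by
  rw [show X.comp t = fun ω => X.pathSum 0 (X.past t ω) t from
    funext (X.comp_eq_pathSum_past le_rfl)]
  exact (measurable_pi_apply t).comp ((X.measurable_pathSum 0).comp (X.measurable_past t))

lemma measurable_jump (n : ℕ) : Measurable (X.jump (n + 1)) := by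
  classical
  refine Finset.measurable_fun_sum _ fun j _ =>
    Measurable.ite ?_ (X.measurable_Z _ j (by omega)) measurable_const
  suffices h : Measurable (X.arrival (n + 1)) from h (X.measurableSet_cells j)
  refine measurable_of_Iic fun t => ?_
  rcases lt_or_ge t 0 with ht | ht
  · convert MeasurableSet.empty
    ext ω
    simp only [mem_preimage, mem_Iic, mem_empty_iff_false, iff_false, not_le]
    exact ht.trans_le (X.arrival_nonneg _ ω)
  -- the arrival time is `0` by convention if the level is never reached
  have : X.arrival (n + 1) ⁻¹' Iic t = {ω | n + 1 ≤ X.N t ω} ∪ ⋂ k : ℕ, {ω | X.N k ω < n + 1} := by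
    ext ω
    simp only [mem_preimage, mem_Iic, mem_union, mem_ofPred_eq, mem_iInter]
    by_cases hex : ∃ k : ℕ, n + 1 ≤ X.N k ω
    · obtain ⟨k, hk⟩ := hex
      rw [X.arrival_le_iff k.cast_nonneg hk ht]
      refine (or_iff_left fun h => ?_).symm
      have := h k
      omega
    · push Not at hex
      have : {t | 0 ≤ t ∧ n + 1 ≤ X.N t ω} = ∅ := by
        refine eq_empty_of_forall_notMem fun u hu => ?_
        obtain ⟨k, hk⟩ := exists_nat_ge u
        have := X.N_le hu.1 hk ω
        have := hex k
        have := hu.2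
        omega
      rw [arrival, this, Real.sInf_empty]
      exact ⟨fun _ => .inr hex, fun _ => ht⟩
  rw [this]
  exact (measurableSet_le measurable_const (X.measurable_N t ht)).union
    (MeasurableSet.iInter fun k =>
      measurableSet_lt (X.measurable_N k k.cast_nonneg) measurable_const)

variable [IsProbabilityMeasure μ]

lemma map_block_add_period (a : ℝ≥0) : μ.map (X.block (a + X.period)) = μ.map (X.block a) := by
  have h (b : ℝ≥0) : μ.map (X.block b) = (μ.map (X.future b)).map (X.pathSum b) := by
    rw [Measure.map_map (X.measurable_pathSum b) (X.measurable_future b)]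
    congr 1
    exact funext (X.block_eq b)
  rw [h, h, X.map_future_add_period, X.pathSum_add_period]

lemma map_block_add_nsmul (a : ℝ≥0) (k : ℕ) :
    μ.map (X.block (a + k * X.period)) = μ.map (X.block a) := by
  induction k with
  | zero => simp
  | succ k ih =>
    rw [← ih, ← X.map_block_add_period (a + k * X.period)]
    congr 2
    push_cast; ring

/-- The increments of the compound process after `a` are independent of its path up to `a`. -/
lemma indepFun_comp_block (a : ℝ≥0) :
    IndepFun (fun ω (u : ℝ≥0) => X.comp (min u a : ℝ≥0) ω) (X.block a) μ := by
  have hG : Measurable fun p : (ℝ≥0 → ℕ) × (ℕ × Fin X.l → ℝ) =>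
      (fun u => X.pathSum 0 p (min u a) : ℝ≥0 → ℝ) :=
    measurable_pi_lambda _ fun u => (measurable_pi_apply _).comp (X.measurable_pathSum 0)
  refine ((X.indepFun_past_future a).comp hG (X.measurable_pathSum a)).congr
    (.of_eq ?_) (.of_eq ?_)
  · funext ω u
    exact (X.comp_eq_pathSum_past (min_le_right u a) ω).symm
  · exact (funext (X.block_eq a)).symm

/-- The increments over successive periods are independent. -/
lemma iIndepFun_block (a : ℝ≥0) {h : ℝ≥0} (hh : h ≤ X.period) :
    iIndepFun (fun (k : ℕ) ω (u : ℝ≥0) => X.block (a + k * X.period) ω (min u h)) μ := by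
  refine iIndepFun_nat_of_indepFun_past fun k => ?_
  let G : (ℝ≥0 → ℝ) → Finset.range k → ℝ≥0 → ℝ := fun w i u =>
    w (a + (i : ℕ) * X.period + min u h) - w (a + (i : ℕ) * X.period)
  have hG : Measurable G := measurable_pi_lambda _ fun i => measurable_pi_lambda _ fun u =>
    (measurable_pi_apply _).sub (measurable_pi_apply _)
  have hH : Measurable fun (w : ℝ≥0 → ℝ) (u : ℝ≥0) => w (min u h) :=
    measurable_pi_lambda _ fun u => measurable_pi_apply _
  refine ((X.indepFun_comp_block (a + k * X.period)).comp hG hH).symm.congr (.of_eq rfl) (.of_eq ?_)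
  funext ω i u
  have hi : ((i : ℕ) : ℝ≥0) + 1 ≤ k := by exact_mod_cast Finset.mem_range.1 i.2
  have h1 : a + (i : ℕ) * X.period + min u h ≤ a + k * X.period := by
    calc a + (i : ℕ) * X.period + min u h ≤ a + (i : ℕ) * X.period + X.period := by
          gcongr; exact (min_le_right u h).trans hh
      _ = a + ((i : ℕ) + 1) * X.period := by ring
      _ ≤ a + k * X.period := by gcongr
  have h2 : a + (i : ℕ) * X.period ≤ a + k * X.period := le_self_add.trans h1
  simp only [Function.comp_apply, G, min_eq_left h1, min_eq_left h2, block]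

/-! ### Moments -/

lemma lintegral_cast_poissonMeasure (r : ℝ≥0) : ∫⁻ n : ℕ, (n : ℝ≥0∞) ∂(poissonMeasure r) = r := by
  have h (f : ℕ → ℝ≥0∞) : ∫⁻ n : ℕ, f n ∂(poissonMeasure r) =
      ∑' n : ℕ, ENNReal.ofReal (Real.exp (-r) * r ^ n / n.factorial) * f n := by
    rw [poissonMeasure, lintegral_sum_measure]
    simp
  have h1 := h fun _ => 1
  simp only [lintegral_const, measure_univ, mul_one] at h1
  rw [h, tsum_eq_zero_add' ENNReal.summable, Nat.cast_zero, mul_zero, zero_add]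
  have hterm (n : ℕ) : ENNReal.ofReal (Real.exp (-r) * r ^ (n + 1) / (n + 1).factorial) *
      ((n + 1 : ℕ) : ℝ≥0∞) = r * ENNReal.ofReal (Real.exp (-r) * r ^ n / n.factorial) := by
    rw [← ENNReal.ofReal_natCast, ← ENNReal.ofReal_mul (by positivity), ← ENNReal.ofReal_coe_nnreal,
      ← ENNReal.ofReal_mul (by positivity), Nat.factorial_succ]
    congr 1
    push_cast
    field_simp
    ring
  simp_rw [hterm]
  rw [ENNReal.tsum_mul_left, ← h1, mul_one]

omit [IsProbabilityMeasure μ] in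
lemma lintegral_N_sub {s t : ℝ} (hs : 0 ≤ s) (hst : s ≤ t) :
    ∫⁻ ω, ((X.N t ω - X.N s ω : ℕ) : ℝ≥0∞) ∂μ = ENNReal.ofReal (X.cumRate t - X.cumRate s) := by
  have hm : Measurable fun ω => X.N t ω - X.N s ω :=
    (X.measurable_N t (hs.trans hst)).sub (X.measurable_N s hs)
  rw [← lintegral_map (f := fun n : ℕ => (n : ℝ≥0∞)) (measurable_of_countable _) hm,
    X.N_law s t hs hst, lintegral_cast_poissonMeasure, X.cumRate_sub hs (hs.trans hst)]
  rfl

omit [IsProbabilityMeasure μ] in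
lemma lintegral_pathJump_le {g : ℝ → ℝ≥0∞} (hg : Measurable g) (hg0 : g 0 = 0) {M : ℝ≥0∞}
    (hM : ∀ j, ∫⁻ z, g z ∂(X.F j) ≤ M) (a : ℝ≥0) (n : ℕ) (w : ℝ≥0 → ℕ) :
    ∫⁻ z, g (X.pathJump a n (w, z)) ∂(μ.map X.marks) ≤ M := by
  classical
  by_cases hex : ∃ j, a + firstTime (n + 1) w ∈ X.cells j
  · obtain ⟨j, hj⟩ := hex
    have h1 (z : ℕ × Fin X.l → ℝ) : X.pathJump a n (w, z) = z (n, j) := by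
      rw [pathJump, Finset.sum_eq_single j, if_pos hj]
      · exact fun j' _ hne => if_neg fun hj' => hne (X.cells_disjoint hj' hj)
      · exact fun h => absurd (Finset.mem_univ j) h
    simp_rw [h1]
    refine le_of_eq_of_le ?_ (hM j)
    rw [← X.Z_law (n + 1) j (by omega), lintegral_map hg (X.measurable_Z _ _ (by omega)),
      lintegral_map (f := fun z : ℕ × Fin X.l → ℝ => g (z (n, j)))
        (hg.comp (measurable_pi_apply (n, j))) X.measurable_marks]
    rfl
  · push Not at hex
    have h1 (z : ℕ × Fin X.l → ℝ) : X.pathJump a n (w, z) = 0 :=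
      Finset.sum_eq_zero fun j _ => if_neg (hex j)
    simp [h1, hg0]

/-- A bound for the mean of a sum over the jumps in `(s, t]`, which holds since the marks are
independent of `N`. -/
lemma lintegral_sum_jump_le {g : ℝ → ℝ≥0∞} (hg : Measurable g) (hg0 : g 0 = 0) {M : ℝ≥0∞}
    (hM : ∀ j, ∫⁻ z, g z ∂(X.F j) ≤ M) {s t : ℝ} (hs : 0 ≤ s) (hst : s ≤ t) :
    ∫⁻ ω, ∑ n ∈ Finset.range (X.N t ω - X.N s ω), g (X.jump (X.N s ω + n + 1) ω) ∂μ ≤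
      M * ENNReal.ofReal (X.cumRate t - X.cumRate s) := by
  lift s to ℝ≥0 using hs
  obtain ⟨u, rfl⟩ : ∃ u : ℝ≥0, t = (s + u : ℝ≥0) :=
    ⟨(t - s).toNNReal, by rw [NNReal.coe_add, Real.coe_toNNReal _ (by linarith)]; ring⟩
  let Ψ : (ℝ≥0 → ℕ) × (ℕ × Fin X.l → ℝ) → ℝ≥0∞ := fun p =>
    ∑ n ∈ Finset.range (p.1 u), g (X.pathJump s n p)
  have hΨ : Measurable Ψ :=
    measurable_sum_range_path (fun n => hg.comp (X.measurable_pathJump s n)) u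
  have hP1 := Measure.isProbabilityMeasure_map (μ := μ) (X.measurable_futureN s).aemeasurable
  have hP2 := Measure.isProbabilityMeasure_map (μ := μ) X.measurable_marks.aemeasurable
  calc ∫⁻ ω, ∑ n ∈ Finset.range (X.N (s + u : ℝ≥0) ω - X.N s ω), g (X.jump (X.N s ω + n + 1) ω) ∂μ
      = ∫⁻ ω, Ψ (X.future s ω) ∂μ := by
        refine lintegral_congr fun ω => ?_
        have hΨω : Ψ (X.future s ω) = ∑ n ∈ Finset.range (X.N (s + u : ℝ≥0) ω - X.N s ω),
          g (X.pathJump s n (X.future s ω)) := rfl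
        rw [hΨω]
        refine Finset.sum_congr rfl fun n hn => ?_
        rw [X.jump_eq_pathJump_future (NNReal.coe_nonneg (s + u))]
        have : n < X.N (s + u : ℝ≥0) ω - X.N s ω := Finset.mem_range.1 hn
        omega
    _ = ∫⁻ w, ∫⁻ z, Ψ (w, z) ∂(μ.map X.marks) ∂(μ.map (X.futureN s)) := by
        rw [← lintegral_map hΨ (X.measurable_future s), X.map_future,
          lintegral_prod _ hΨ.aemeasurable]
    _ ≤ ∫⁻ w : ℝ≥0 → ℕ, M * (w u : ℝ≥0∞) ∂(μ.map (X.futureN s)) := by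
        refine lintegral_mono fun w => ?_
        have hm (n : ℕ) : Measurable fun z => g (X.pathJump s n (w, z)) :=
          hg.comp ((X.measurable_pathJump s n).comp (measurable_const.prodMk measurable_id))
        have hΨw : ∀ z, Ψ (w, z) = ∑ n ∈ Finset.range (w u), g (X.pathJump s n (w, z)) :=
          fun _ => rfl
        simp_rw [hΨw]
        rw [lintegral_finsetSum _ fun n _ => hm n]
        refine (Finset.sum_le_sum fun n _ => X.lintegral_pathJump_le hg hg0 hM s n w).trans ?_
        rw [Finset.sum_const, Finset.card_range, nsmul_eq_mul, mul_comm]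
    _ = M * ENNReal.ofReal (X.cumRate (s + u : ℝ≥0) - X.cumRate s) := by
        have hev : Measurable fun w : ℝ≥0 → ℕ => (w u : ℝ≥0∞) :=
          (measurable_of_countable (fun n : ℕ => (n : ℝ≥0∞))).comp (measurable_pi_apply u)
        rw [lintegral_const_mul _ hev, lintegral_map hev (X.measurable_futureN s)]
        exact congrArg _ (X.lintegral_N_sub s.coe_nonneg (NNReal.coe_le_coe.2 le_self_add))

end SimpleCompoundPoisson

/-! ### Almost sure properties of the jump times -/

lemma poissonMeasure_one_le (r : ℝ≥0) : poissonMeasure r {n | 1 ≤ n} ≤ ENNReal.ofReal r := by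
  have h : {n : ℕ | 1 ≤ n} = {0}ᶜ := by ext n; simp [Nat.one_le_iff_ne_zero]
  rw [← ofReal_measureReal, h, measureReal_compl (measurableSet_singleton _), probReal_univ,
    poissonMeasure_real_singleton]
  refine ENNReal.ofReal_le_ofReal ?_
  have := Real.add_one_le_exp (-(r : ℝ))
  simp only [pow_zero, Nat.factorial_zero, Nat.cast_one, mul_one, div_one]
  linarith

lemma poissonMeasure_two_le (r : ℝ≥0) :
    poissonMeasure r {n | 2 ≤ n} ≤ ENNReal.ofReal ((r : ℝ) ^ 2) := by
  have h : {n : ℕ | 2 ≤ n} = ({0} ∪ {1})ᶜ := by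
    ext n; simp only [mem_ofPred_eq, mem_compl_iff, mem_union, mem_singleton_iff]; omega
  rw [← ofReal_measureReal, h, measureReal_compl (by measurability), probReal_univ,
    measureReal_union (by simp) (measurableSet_singleton _), poissonMeasure_real_singleton,
    poissonMeasure_real_singleton]
  refine ENNReal.ofReal_le_ofReal ?_
  have := Real.add_one_le_exp (-(r : ℝ))
  have := r.coe_nonneg
  simp only [pow_zero, pow_one, Nat.factorial_zero, Nat.factorial_one, Nat.cast_one, mul_one,
    div_one]
  nlinarith

namespace SimpleCompoundPoisson

variable {Ω : Type*} [MeasurableSpace Ω] {μ : Measure Ω} {τ : ℝ} (X : SimpleCompoundPoisson μ τ)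

/-- The path of `N` has only unit jumps: on each bounded interval, `N` increases by at most one over
sufficiently short time spans. -/
def UnitJumps (ω : Ω) : Prop :=
  ∀ T : ℕ, ∃ δ > (0 : ℝ), ∀ s t : ℝ, 0 ≤ s → s ≤ t → t ≤ T → t - s < δ → X.N t ω ≤ X.N s ω + 1

lemma measure_N_sub_ge {s t : ℝ} (hs : 0 ≤ s) (hst : s ≤ t) (k : ℕ) :
    μ {ω | X.N s ω + k ≤ X.N t ω} =
      poissonMeasure (X.cumRate t - X.cumRate s).toNNReal {n | k ≤ n} := by
  rw [X.cumRate_sub hs (hs.trans hst), ← X.N_law s t hs hst,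
    Measure.map_apply (f := fun ω => X.N t ω - X.N s ω)
      ((X.measurable_N t (hs.trans hst)).sub (X.measurable_N s hs)) .of_discrete]
  congr 1
  ext ω
  have := X.N_le hs hst ω
  simp only [mem_ofPred_eq, mem_preimage]
  omega

/-- Two jumps occur in a short interval with a probability of the order of the squared mean number
of jumps there; summed over a fine partition this tends to `0`, since the mean function is
continuous. -/
lemma ae_unitJumps : ∀ᵐ ω ∂μ, X.UnitJumps ω := by
  unfold UnitJumps
  rw [ae_all_iff]
  intro T
  rw [ae_iff]
  set bad := {ω | ¬∃ δ > (0 : ℝ), ∀ s t : ℝ, 0 ≤ s → s ≤ t → t ≤ T → t - s < δ →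
    X.N t ω ≤ X.N s ω + 1}
  set L := X.cumRate (T + 2)
  have hmon {s t : ℝ} (hs : 0 ≤ s) (hst : s ≤ t) := X.cumRate_mono hs hst
  have h0 : X.cumRate 0 = 0 := by simp [cumRate]
  have hL : 0 ≤ L := h0 ▸ hmon le_rfl (by positivity)
  have key : ∀ ε : ℝ, 0 < ε → μ bad ≤ ENNReal.ofReal (ε * (2 * L)) := by
    intro ε hε
    have huc := isCompact_Icc.uniformContinuousOn_of_continuous (X.continuousOn_cumRate (T + 2))
    obtain ⟨δ, hδ, huc⟩ := Metric.uniformContinuousOn_iff.1 huc ε hε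
    obtain ⟨m, hm⟩ := exists_nat_gt (2 / δ + 2)
    have h2δ : 0 < 2 / δ := by positivity
    have hm2 : (2 : ℝ) ≤ m := by linarith
    have hm0 : (0 : ℝ) < m := by linarith
    have hmδ : 2 / (m : ℝ) < δ := by
      rw [div_lt_iff₀ hm0, mul_comm, ← div_lt_iff₀ hδ]; linarith
    let g : ℕ → ℝ := fun i => i / m
    have hg0 (i) : 0 ≤ g i := by positivity
    have hg (i) : g i ≤ g (i + 1) := by simp only [g]; gcongr; linarith
    have hgT (i) (hi : i < T * m) : g (i + 2) ≤ T + 2 := by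
      have : (i : ℝ) ≤ T * m := by exact_mod_cast hi.le
      simp only [g]
      rw [div_le_iff₀ hm0]
      push_cast
      nlinarith
    have hcover : bad ⊆ ⋃ i ∈ Finset.range (T * m), {ω | X.N (g i) ω + 2 ≤ X.N (g (i + 2)) ω} := by
      intro ω hω
      by_contra hnot
      refine hω ⟨1 / m, by positivity, fun s t hs hst ht hlt => ?_⟩
      simp only [mem_iUnion, not_exists, Finset.mem_range, mem_ofPred_eq, not_le] at hnot
      rcases eq_or_lt_of_le (hst.trans ht) with hsT | hsT
      · rw [le_antisymm hst (ht.trans hsT.ge)]; omega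
      · have hsm : 0 ≤ s * m := by positivity
        set i := ⌊s * m⌋₊
        have hi1 : (i : ℝ) ≤ s * m := Nat.floor_le hsm
        have hi2 : s * m < i + 1 := Nat.lt_floor_add_one _
        have hi : i < T * m := by
          have : (i : ℝ) < T * m := hi1.trans_lt (by nlinarith)
          exact_mod_cast this
        have h1 : g i ≤ s := by simp only [g]; rwa [div_le_iff₀ hm0]
        have h2 : t ≤ g (i + 2) := by
          simp only [g]
          rw [le_div_iff₀ hm0]
          rw [lt_div_iff₀ hm0] at hlt
          push_cast
          nlinarith
        have := hnot i hi
        have := X.N_le (hg0 i) h1 ω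
        have := X.N_le (hs.trans hst) h2 ω
        omega
    refine (measure_mono hcover).trans ((measure_biUnion_finset_le _ _).trans ?_)
    have hterm (i) (hi : i ∈ Finset.range (T * m)) :
        μ {ω | X.N (g i) ω + 2 ≤ X.N (g (i + 2)) ω} ≤
          ENNReal.ofReal (ε * (X.cumRate (g (i + 2)) - X.cumRate (g i))) := by
      rw [X.measure_N_sub_ge (hg0 i) ((hg i).trans (hg _))]
      refine (poissonMeasure_two_le _).trans (ENNReal.ofReal_le_ofReal ?_)
      have hle := hmon (hg0 i) ((hg i).trans (hg _))
      rw [Real.coe_toNNReal _ (by linarith), sq]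
      refine mul_le_mul_of_nonneg_right ?_ (by linarith)
      have hi' := hgT i (Finset.mem_range.1 hi)
      have hd := huc (g (i + 2)) ⟨hg0 _, hi'⟩ (g i) ⟨hg0 _, ((hg i).trans (hg _)).trans hi'⟩ (by
        rw [Real.dist_eq, abs_of_nonneg (by linarith [hg i, hg (i + 1)])]
        refine lt_of_eq_of_lt ?_ hmδ
        simp only [g]; push_cast; field_simp; ring)
      rw [Real.dist_eq, abs_of_nonneg (by linarith)] at hd
      exact hd.le
    refine (Finset.sum_le_sum hterm).trans ?_
    rw [← ENNReal.ofReal_sum_of_nonneg fun i _ => mul_nonneg hε.le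
      (sub_nonneg.2 (hmon (hg0 i) ((hg i).trans (hg _)))), ← Finset.mul_sum]
    refine ENNReal.ofReal_le_ofReal (mul_le_mul_of_nonneg_left ?_ hε.le)
    have hsplit (i) : X.cumRate (g (i + 2)) - X.cumRate (g i) =
        (X.cumRate (g (i + 1 + 1)) - X.cumRate (g (i + 1))) +
          (X.cumRate (g (i + 1)) - X.cumRate (g i)) := by ring
    simp_rw [hsplit]
    rw [Finset.sum_add_distrib, Finset.sum_range_sub (fun i => X.cumRate (g i)),
      Finset.sum_range_sub (fun i => X.cumRate (g (i + 1)))]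
    have e1 := hmon le_rfl (hg0 0)
    have e2 := hmon le_rfl (hg0 (0 + 1))
    have hTm : g (T * m + 1) ≤ T + 2 := by
      simp only [g]
      rw [div_le_iff₀ hm0]; push_cast; nlinarith
    have e3 := hmon (hg0 _) hTm
    have e4 := hmon (hg0 _) ((hg (T * m)).trans hTm)
    change X.cumRate (g (T * m + 1)) ≤ L at e3
    change X.cumRate (g (T * m)) ≤ L at e4
    linarith
  have hlim : Tendsto (fun ε : ℝ => ENNReal.ofReal (ε * (2 * L))) (𝓝[>] 0) (𝓝 0) := by
    have : Tendsto (fun ε : ℝ => ENNReal.ofReal (ε * (2 * L))) (𝓝 0)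
        (𝓝 (ENNReal.ofReal (0 * (2 * L)))) :=
      ENNReal.tendsto_ofReal (tendsto_id.mul_const _)
    rw [zero_mul, ENNReal.ofReal_zero] at this
    exact this.mono_left nhdsWithin_le_nhds
  exact le_antisymm (ge_of_tendsto hlim (by
    filter_upwards [self_mem_nhdsWithin] with ε hε using key ε hε)) bot_le

/-- A fixed time is almost surely not a jump time. -/
lemma ae_exists_N_eq {t : ℝ} (ht : 0 < t) : ∀ᵐ ω ∂μ, ∃ s, 0 ≤ s ∧ s < t ∧ X.N s ω = X.N t ω := by
  rw [ae_iff]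
  set bad := {ω | ¬∃ s, 0 ≤ s ∧ s < t ∧ X.N s ω = X.N t ω}
  have key : ∀ s ∈ Ico 0 t, μ bad ≤ ENNReal.ofReal (X.cumRate t - X.cumRate s) := by
    intro s hs
    refine (measure_mono fun ω hω => ?_).trans
      ((X.measure_N_sub_ge hs.1 hs.2.le 1).trans_le ((poissonMeasure_one_le _).trans_eq ?_))
    · have := X.N_le hs.1 hs.2.le ω
      have h2 : X.N s ω ≠ X.N t ω := fun h => hω ⟨s, hs.1, hs.2, h⟩
      simp only [mem_ofPred_eq]
      omega
    · rw [Real.coe_toNNReal _ (sub_nonneg.2 (X.cumRate_mono hs.1 hs.2.le))]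
  have hlim : Tendsto (fun s => ENNReal.ofReal (X.cumRate t - X.cumRate s)) (𝓝[Ico 0 t] t) (𝓝 0) := by
    have h1 : Tendsto X.cumRate (𝓝[Ico 0 t] t) (𝓝 (X.cumRate t)) :=
      (X.continuousOn_cumRate t t ⟨ht.le, le_rfl⟩).mono_left (nhdsWithin_mono _ Ico_subset_Icc_self)
    have := ENNReal.tendsto_ofReal (tendsto_const_nhds (x := X.cumRate t) |>.sub h1)
    rwa [sub_self, ENNReal.ofReal_zero] at this
  have : (𝓝[Ico 0 t] t).NeBot := by
    rw [← mem_closure_iff_nhdsWithin_neBot, closure_Ico ht.ne]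
    exact ⟨ht.le, le_rfl⟩
  exact le_antisymm (ge_of_tendsto hlim (by
    filter_upwards [self_mem_nhdsWithin] with s hs using key s hs)) bot_le

variable {X}

lemma UnitJumps.N_arrival {ω : Ω} (h : X.UnitJumps ω) {n : ℕ} {u : ℝ} (hu : 0 ≤ u)
    (hn : n ≤ X.N u ω) : X.N (X.arrival n ω) ω = n := by
  refine le_antisymm ?_ (X.le_N_arrival hu hn)
  set T := X.arrival n ω with hT
  have hT0 := X.arrival_nonneg n ω
  rcases eq_or_lt_of_le hT0 with h0 | h0
  · rw [hT, ← h0, X.N_zero]; omega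
  obtain ⟨k, hk⟩ := exists_nat_ge T
  obtain ⟨δ, hδ, hjump⟩ := h k
  -- just before the arrival time the level `n` has not been reached
  set s := max 0 (T - δ / 2)
  have hsT : s < T := max_lt h0 (by linarith)
  have h1 := hjump s T (le_max_left _ _) hsT.le hk (by
    have := le_max_right 0 (T - δ / 2); linarith)
  have h2 : ¬ n ≤ X.N s ω := fun h' => hsT.not_ge (X.arrival_le (le_max_left _ _) h')
  omega

end SimpleCompoundPoisson

/-! ### The affine recursion along a path -/

section Recursion

variable {p q : ℕ} (θ : Params p q)

/-- The free flow `x ↦ exp (d B) x`. -/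
noncomputable def flow (d : ℝ) (x : Fin q → ℝ) : Fin q → ℝ := NormedSpace.exp (d • θ.B) *ᵥ x

/-- The effect `x ↦ (I + z² e aᵀ) x + α₀ z² e` of a jump of size `z` on the state. -/
noncomputable def kick (z : ℝ) (x : Fin q → ℝ) : Fin q → ℝ :=
  (1 + z ^ 2 • Matrix.vecMulVec θ.e θ.a) *ᵥ x + (θ.α 0 * z ^ 2) • θ.e

/-- The state after `k` jumps of sizes `z 0, z 1, …` at times `u 1, u 2, …`, when it starts from `x`
at time `u 0`. -/
noncomputable def traj (u z : ℕ → ℝ) (x : Fin q → ℝ) : ℕ → Fin q → ℝ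
  | 0 => x
  | k + 1 => kick θ (z k) (flow θ (u (k + 1) - u k) (traj u z x k))

lemma flow_zero (x : Fin q → ℝ) : flow θ 0 x = x := by
  rw [flow, zero_smul, NormedSpace.exp_zero, Matrix.one_mulVec]

lemma flow_add (d d' : ℝ) (x : Fin q → ℝ) : flow θ (d + d') x = flow θ d (flow θ d' x) := by
  rw [flow, flow, flow, Matrix.mulVec_mulVec, add_smul, Matrix.exp_add_of_commute]
  exact (Commute.refl _).smul_left _ |>.smul_right _

lemma kick_zero (x : Fin q → ℝ) : kick θ 0 x = x := by simp [kick]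

lemma kick_eq (z : ℝ) (x : Fin q → ℝ) :
    kick θ z x = x + ((θ.α 0 + θ.a ⬝ᵥ x) * z ^ 2) • θ.e := by
  rw [kick, Matrix.add_mulVec, Matrix.one_mulVec, Matrix.smul_mulVec, Matrix.vecMulVec_mulVec]
  ext i
  simp
  ring

section

attribute [local instance] Matrix.linftyOpNormedRing Matrix.linftyOpNormedAlgebra

lemma continuous_exp_smul (B : Matrix (Fin q) (Fin q) ℝ) :
    Continuous fun d : ℝ => NormedSpace.exp (d • B) :=
  NormedSpace.exp_continuous.comp (continuous_id.smul continuous_const)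

lemma hasDerivAt_exp_smul (B : Matrix (Fin q) (Fin q) ℝ) (t : ℝ) :
    HasDerivAt (fun d : ℝ => NormedSpace.exp (d • B)) (NormedSpace.exp (t • B) * B) t :=
  hasDerivAt_exp_smul_const B t

end

lemma continuous_flow : Continuous fun y : ℝ × (Fin q → ℝ) => flow θ y.1 y.2 :=
  ((continuous_exp_smul θ.B).comp continuous_fst).matrix_mulVec continuous_snd

lemma continuous_kick : Continuous fun y : ℝ × (Fin q → ℝ) => kick θ y.1 y.2 := by
  simp only [kick_eq]
  have : Continuous fun y : ℝ × (Fin q → ℝ) => θ.a ⬝ᵥ y.2 :=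
    continuous_const.dotProduct continuous_snd
  fun_prop

lemma tendsto_flow {α : Type*} {l : Filter α} {f : α → ℝ} {g : α → Fin q → ℝ} {a : ℝ}
    {b : Fin q → ℝ} (hf : Tendsto f l (𝓝 a)) (hg : Tendsto g l (𝓝 b)) :
    Tendsto (fun i => flow θ (f i) (g i)) l (𝓝 (flow θ a b)) := by
  have h : Tendsto (fun y : ℝ × (Fin q → ℝ) => flow θ y.1 y.2) (𝓝 (a, b)) (𝓝 (flow θ a b)) :=
    (continuous_flow θ).tendsto (a, b)
  exact Tendsto.comp (g := fun y : ℝ × (Fin q → ℝ) => flow θ y.1 y.2) (f := fun i => (f i, g i))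
    h (hf.prodMk_nhds hg)

lemma tendsto_kick {α : Type*} {l : Filter α} {f : α → ℝ} {g : α → Fin q → ℝ} {a : ℝ}
    {b : Fin q → ℝ} (hf : Tendsto f l (𝓝 a)) (hg : Tendsto g l (𝓝 b)) :
    Tendsto (fun i => kick θ (f i) (g i)) l (𝓝 (kick θ a b)) := by
  have h : Tendsto (fun y : ℝ × (Fin q → ℝ) => kick θ y.1 y.2) (𝓝 (a, b)) (𝓝 (kick θ a b)) :=
    (continuous_kick θ).tendsto (a, b)
  exact Tendsto.comp (g := fun y : ℝ × (Fin q → ℝ) => kick θ y.1 y.2) (f := fun i => (f i, g i))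
    h (hf.prodMk_nhds hg)

lemma measurable_flow {α : Type*} [MeasurableSpace α] {f : α → ℝ} {g : α → Fin q → ℝ}
    (hf : Measurable f) (hg : Measurable g) : Measurable fun i => flow θ (f i) (g i) := by
  have h := (continuous_flow θ).measurable
  exact Measurable.comp (g := fun y : ℝ × (Fin q → ℝ) => flow θ y.1 y.2) (f := fun i => (f i, g i))
    h (hf.prodMk hg)

lemma measurable_kick {α : Type*} [MeasurableSpace α] {f : α → ℝ} {g : α → Fin q → ℝ}
    (hf : Measurable f) (hg : Measurable g) : Measurable fun i => kick θ (f i) (g i) := by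
  have h := (continuous_kick θ).measurable
  exact Measurable.comp (g := fun y : ℝ × (Fin q → ℝ) => kick θ y.1 y.2) (f := fun i => (f i, g i))
    h (hf.prodMk hg)

lemma tendsto_traj {r : ℕ → ℕ → ℝ} {u : ℕ → ℝ} (z : ℕ → ℝ) (x : Fin q → ℝ) (K : ℕ)
    (h : ∀ k ≤ K, Tendsto (fun m => r m k) atTop (𝓝 (u k))) :
    Tendsto (fun m => traj θ (r m) z x K) atTop (𝓝 (traj θ u z x K)) := by
  induction K with
  | zero => exact tendsto_const_nhds
  | succ K ih =>
    simp only [traj]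
    exact tendsto_kick θ tendsto_const_nhds
      (tendsto_flow θ ((h (K + 1) le_rfl).sub (h K (by omega))) (ih fun k hk => h k (by omega)))

/-- Point number `i` of the partition of `[0, h]` into `m` equal parts. -/
noncomputable def grid (h : ℝ≥0) (m i : ℕ) : ℝ≥0 := i * (h / m)

/-- The recursion driven by the increments of the path `w` over the partition of `[0, h]` into `m`
equal parts. -/
noncomputable def discrete (h : ℝ≥0) (m : ℕ) (w : ℝ≥0 → ℝ) (x : Fin q → ℝ) : ℕ → Fin q → ℝ
  | 0 => x
  | i + 1 => kick θ (w (grid h m (i + 1)) - w (grid h m i)) (flow θ (h / m) (discrete h m w x i))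

lemma measurable_discrete (h : ℝ≥0) (m : ℕ) (x : Fin q → ℝ) (i : ℕ) :
    Measurable fun w => discrete θ h m w x i := by
  induction i with
  | zero => exact measurable_const
  | succ i ih =>
    simp only [discrete]
    exact measurable_kick θ ((measurable_pi_apply _).sub (measurable_pi_apply _))
      (measurable_flow θ measurable_const ih)

lemma grid_le {h : ℝ≥0} {m i : ℕ} (hi : i ≤ m) : grid h m i ≤ h := by
  rcases Nat.eq_zero_or_pos m with rfl | hm
  · simp [grid]
  · have hm' : (0 : ℝ≥0) < m := by exact_mod_cast hm
    calc grid h m i ≤ m * (h / m) := by unfold grid; gcongr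
      _ = h := by field_simp

/-- The recursion over `[0, h]` only sees the path up to time `h`. -/
lemma discrete_min (h : ℝ≥0) (m : ℕ) (w : ℝ≥0 → ℝ) (x : Fin q → ℝ) {i : ℕ} (hi : i ≤ m) :
    discrete θ h m (fun u => w (min u h)) x i = discrete θ h m w x i := by
  induction i with
  | zero => rfl
  | succ i ih =>
    rw [discrete, discrete, ih (by omega), min_eq_left (grid_le hi),
      min_eq_left (grid_le (by omega))]

/-- The limit of the discretized recursions, as a pair of a matrix and a vector: an affine map is
recovered from its values at `0` and at the basis vectors. -/
noncomputable def coeffPath (h : ℝ≥0) (w : ℝ≥0 → ℝ) : (Fin q → Fin q → ℝ) × (Fin q → ℝ) :=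
  (fun i j => limUnder atTop fun m : ℕ =>
      discrete θ h m w (Pi.single j 1) m i - discrete θ h m w 0 m i,
    fun i => limUnder atTop fun m : ℕ => discrete θ h m w 0 m i)

lemma measurable_coeffPath (h : ℝ≥0) : Measurable (coeffPath θ h) := by
  have hd (m : ℕ) (x : Fin q → ℝ) (i : Fin q) : Measurable fun w => discrete θ h m w x m i :=
    (measurable_pi_apply i).comp (measurable_discrete θ h m x m)
  refine Measurable.prodMk (measurable_pi_lambda _ fun i => measurable_pi_lambda _ fun j => ?_)
    (measurable_pi_lambda _ fun i => ?_)
  · exact (StronglyMeasurable.limUnder fun m =>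
      ((hd m _ i).sub (hd m _ i)).stronglyMeasurable).measurable
  · exact (StronglyMeasurable.limUnder fun m => (hd m _ i).stronglyMeasurable).measurable

lemma coeffPath_min (h : ℝ≥0) (w : ℝ≥0 → ℝ) :
    coeffPath θ h (fun u => w (min u h)) = coeffPath θ h w := by
  simp only [coeffPath, discrete_min θ h _ w _ le_rfl]

end Recursion

section Path

variable {Ω : Type*} [MeasurableSpace Ω] {μ : Measure Ω} {τ : ℝ} {p q : ℕ} (θ : Params p q)
  (X : SimpleCompoundPoisson μ τ)

/-- The times at which the recursion is updated: the starting time `s` and the arrival times after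
`s`. -/
noncomputable def updateTime (s : ℝ) (ω : Ω) (k : ℕ) : ℝ := max s (X.arrival (X.N s ω + k) ω)

/-- The sizes of the jumps after time `s`. -/
noncomputable def jumpAfter (s : ℝ) (ω : Ω) (k : ℕ) : ℝ := X.jump (X.N s ω + k + 1) ω

variable {X} {s t : ℝ} {ω : Ω}

lemma updateTime_zero (hs : 0 ≤ s) : updateTime X s ω 0 = s :=
  max_eq_left (X.arrival_le hs le_rfl)

lemma updateTime_succ (hs : 0 ≤ s) (hst : s ≤ t) {k : ℕ} (hk : k + 1 ≤ X.N t ω - X.N s ω) :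
    updateTime X s ω (k + 1) = X.arrival (X.N s ω + k + 1) ω ∧
      s < X.arrival (X.N s ω + k + 1) ω := by
  have h : s < X.arrival (X.N s ω + k + 1) ω := by
    by_contra! hle
    have := (X.arrival_le_iff (u := t) (hs.trans hst) (by omega) hs).1 hle
    omega
  exact ⟨max_eq_right h.le, h⟩

lemma updateTime_le (hs : 0 ≤ s) (hst : s ≤ t) {k : ℕ} (hk : k ≤ X.N t ω - X.N s ω) :
    updateTime X s ω k ≤ t :=
  max_le hst (X.arrival_le (hs.trans hst) (by have := X.N_le hs hst ω; omega))

lemma updateTime_mono (hs : 0 ≤ s) (hst : s ≤ t) {k : ℕ} (hk : k + 1 ≤ X.N t ω - X.N s ω) :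
    updateTime X s ω k ≤ updateTime X s ω (k + 1) :=
  max_le_max le_rfl (X.arrival_mono (u := t) (hs.trans hst) (by omega) (by omega))

lemma jumpsJ_mulVec_add (hs : 0 ≤ s) (hst : s ≤ t) (x : Fin q → ℝ) {k : ℕ}
    (hk : k ≤ X.N t ω - X.N s ω) :
    jumpsJ θ X s ω k *ᵥ x + jumpsK θ X s ω k =
      traj θ (updateTime X s ω) (jumpAfter X s ω) x k := by
  induction k with
  | zero => simp [jumpsJ, jumpsK, traj]
  | succ k ih =>
    rw [traj, ← ih (by omega), (updateTime_succ hs hst hk).1, jumpsJ, jumpsK, kick, flow,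
      ← Matrix.mulVec_mulVec, ← add_assoc, ← Matrix.mulVec_add, stepMatrix, Matrix.mulVec_mulVec]
    rfl

lemma J_mulVec_add_K (hs : 0 ≤ s) (hst : s ≤ t) (x : Fin q → ℝ) :
    J θ X s t ω *ᵥ x + K θ X s t ω =
      flow θ (t - updateTime X s ω (X.N t ω - X.N s ω))
        (traj θ (updateTime X s ω) (jumpAfter X s ω) x (X.N t ω - X.N s ω)) := by
  rw [J, K, ← Matrix.mulVec_mulVec, ← Matrix.mulVec_add, jumpsJ_mulVec_add θ hs hst x le_rfl,
    updateTime, Nat.add_sub_cancel' (X.N_le hs hst ω)]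
  rfl

/-- If no cell of the partition contains two jumps, the discretized recursion is the recursion along
the path, each jump time being delayed to the next point of the partition. -/
lemma discrete_block_eq {s h : ℝ≥0} {m : ℕ} (hm : 0 < m)
    (hcell : ∀ i < m, X.N (s + grid h m (i + 1) : ℝ≥0) ω ≤ X.N (s + grid h m i : ℝ≥0) ω + 1)
    (x : Fin q → ℝ) {i : ℕ} (hi : i ≤ m) :
    discrete θ h m (X.block s ω) x i =
      flow θ (grid h m i - ⌈(updateTime X s ω (X.N (s + grid h m i : ℝ≥0) ω - X.N s ω) - s) * m / h⌉₊ *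
          (h / m))
        (traj θ (fun k => ⌈(updateTime X s ω k - s) * m / h⌉₊ * (h / m)) (jumpAfter X s ω) x
          (X.N (s + grid h m i : ℝ≥0) ω - X.N s ω)) := by
  have hs := s.coe_nonneg
  have hm' : (0 : ℝ) < m := by exact_mod_cast hm
  induction i with
  | zero =>
    simp [discrete, grid, updateTime_zero, traj, flow_zero]
  | succ i ih =>
    have hmono : s + grid h m i ≤ s + grid h m (i + 1) := by
      unfold grid; gcongr; omega
    have hN := X.N_le (NNReal.coe_nonneg _) (NNReal.coe_le_coe.2 hmono) ω
    have hN0 := X.N_le hs (NNReal.coe_le_coe.2 (le_self_add : s ≤ s + grid h m i)) ω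
    have hg : ((grid h m (i + 1) : ℝ≥0) : ℝ) = h / m + grid h m i := by
      simp only [grid]; push_cast; ring
    have hblock : X.block s ω (grid h m (i + 1)) - X.block s ω (grid h m i) =
        ∑ n ∈ Finset.range (X.N (s + grid h m (i + 1) : ℝ≥0) ω - X.N (s + grid h m i : ℝ≥0) ω),
          X.jump (X.N (s + grid h m i : ℝ≥0) ω + n + 1) ω := by
      rw [← X.comp_sub (NNReal.coe_nonneg _) (NNReal.coe_le_coe.2 hmono)]
      simp only [SimpleCompoundPoisson.block]
      ring
    rw [discrete, ih (by omega), hblock]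
    have hc := hcell i (by omega)
    rcases Nat.eq_or_lt_of_le hN with heq | hlt
    · rw [← heq, Nat.sub_self, Finset.sum_range_zero, kick_zero, hg, add_sub_assoc, flow_add]
    · have h1 : X.N (s + grid h m (i + 1) : ℝ≥0) ω = X.N (s + grid h m i : ℝ≥0) ω + 1 := by omega
      set k := X.N (s + grid h m i : ℝ≥0) ω - X.N s ω with hk
      have h2 : X.N (s + grid h m (i + 1) : ℝ≥0) ω - X.N s ω = k + 1 := by omega
      have h3 : X.N (s + grid h m i : ℝ≥0) ω = X.N s ω + k := by omega
      have hst : (s : ℝ) ≤ (s + grid h m (i + 1) : ℝ≥0) := NNReal.coe_le_coe.2 le_self_add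
      have hu := (updateTime_succ (ω := ω) (k := k) hs hst h2.ge).1
      have hTle : updateTime X s ω (k + 1) ≤ (s + grid h m (i + 1) : ℝ≥0) :=
        updateTime_le hs hst h2.ge
      have hTgt : ((s + grid h m i : ℝ≥0) : ℝ) < updateTime X s ω (k + 1) := by
        rw [hu]
        by_contra! hle
        have := (X.arrival_le_iff (u := (s + grid h m (i + 1) : ℝ≥0)) (NNReal.coe_nonneg _)
          (by omega) (NNReal.coe_nonneg _)).1 hle
        omega
      -- the arrival time lies in cell number `i`, hence is delayed to its right end point
      have hpos : (0 : ℝ) < h := by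
        have : ((s + grid h m i : ℝ≥0) : ℝ) < (s + grid h m (i + 1) : ℝ≥0) := hTgt.trans_le hTle
        by_contra! h0
        have h0' : h = 0 := le_antisymm (by exact_mod_cast h0) bot_le
        simp [grid, h0'] at this
      have hceil : ⌈(updateTime X s ω (k + 1) - s) * m / h⌉₊ = i + 1 := by
        rw [Nat.ceil_eq_iff (by omega), lt_div_iff₀ hpos, div_le_iff₀ hpos]
        simp only [grid, NNReal.coe_add, NNReal.coe_mul, NNReal.coe_div, NNReal.coe_natCast] at hTle hTgt
        rw [Nat.add_sub_cancel]
        have e1 : (i : ℝ) * (h / m) * m = i * h := by field_simp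
        have e2 : ((i + 1 : ℕ) : ℝ) * (h / m) * m = (i + 1 : ℕ) * h := by field_simp
        rw [← e1, ← e2]
        constructor
        · exact mul_lt_mul_of_pos_right (by linarith) hm'
        · exact mul_le_mul_of_nonneg_right (by linarith) hm'.le
      have hgi : ((grid h m (i + 1) : ℝ≥0) : ℝ) = (i + 1 : ℕ) * (h / m) := by simp [grid]
      rw [h2, h1, Nat.add_sub_cancel_left, Finset.sum_range_one, traj, hceil, hgi, sub_self, flow_zero,
        ← flow_add, h3]
      congr 2
      have : ((i + 1 : ℕ) : ℝ) * (h / m) = h / m + grid h m i := by rw [← hgi, hg]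
      rw [this]
      ring

/-- For isolated jumps the discretized recursion is, up to the rounding of the jump times to the
grid, the exact one, and the rounding error vanishes by continuity of the flow. -/
theorem tendsto_discrete (hω : X.UnitJumps ω) (s h : ℝ≥0) (x : Fin q → ℝ) :
    Tendsto (fun m : ℕ => discrete θ h m (X.block s ω) x m) atTop
      (𝓝 (J θ X s (s + h : ℝ≥0) ω *ᵥ x + K θ X s (s + h : ℝ≥0) ω)) := by
  have hs := s.coe_nonneg
  have hst : (s : ℝ) ≤ (s + h : ℝ≥0) := NNReal.coe_le_coe.2 le_self_add
  rw [J_mulVec_add_K θ hs hst]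
  set M := X.N (s + h : ℝ≥0) ω - X.N s ω with hM
  set r : ℕ → ℕ → ℝ := fun m k => ⌈(updateTime X s ω k - s) * m / h⌉₊ * (h / m)
  have hhm : Tendsto (fun m : ℕ => (h : ℝ) / m) atTop (𝓝 0) := tendsto_const_div_atTop_nhds_zero_nat _
  have hr : ∀ k ≤ M, Tendsto (fun m => r m k) atTop (𝓝 (updateTime X s ω k - s)) := by
    intro k hk
    have h0 : 0 ≤ updateTime X s ω k - s := sub_nonneg.2 (le_max_left _ _)
    rcases eq_or_lt_of_le h.coe_nonneg with hz | hpos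
    · have hz' : h = 0 := by exact_mod_cast hz.symm
      have hM0 : M = 0 := by rw [hM, hz', add_zero, Nat.sub_self]
      rw [show k = 0 by omega, updateTime_zero hs]
      simp [r, updateTime_zero hs]
    · refine tendsto_of_tendsto_of_tendsto_of_le_of_le' tendsto_const_nhds
        (by simpa using hhm.const_add (updateTime X s ω k - s)) ?_ ?_
      · filter_upwards [eventually_gt_atTop 0] with m hm
        have hm' : (0 : ℝ) < m := by exact_mod_cast hm
        have := mul_le_mul_of_nonneg_right (Nat.le_ceil ((updateTime X s ω k - s) * m / h))
          (show 0 ≤ (h : ℝ) / m by positivity)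
        refine le_trans (le_of_eq ?_) this
        field_simp
      · filter_upwards [eventually_gt_atTop 0] with m hm
        have hm' : (0 : ℝ) < m := by exact_mod_cast hm
        have := mul_le_mul_of_nonneg_right
          (Nat.ceil_lt_add_one (a := (updateTime X s ω k - s) * m / h) (by positivity)).le
          (show 0 ≤ (h : ℝ) / m by positivity)
        refine this.trans (le_of_eq ?_)
        field_simp
  have htraj : Tendsto (fun m => traj θ (r m) (jumpAfter X s ω) x M) atTop
      (𝓝 (traj θ (updateTime X s ω) (jumpAfter X s ω) x M)) := by
    have h1 := tendsto_traj θ (u := fun k => updateTime X s ω k - s) (jumpAfter X s ω) x M hr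
    have h2 : ∀ k, traj θ (fun k => updateTime X s ω k - s) (jumpAfter X s ω) x k =
        traj θ (updateTime X s ω) (jumpAfter X s ω) x k := by
      intro k
      induction k with
      | zero => rfl
      | succ k ih => rw [traj, traj, ih, sub_sub_sub_cancel_right]
    rwa [h2] at h1
  have hlim : Tendsto (fun m => flow θ (h - r m M) (traj θ (r m) (jumpAfter X s ω) x M)) atTop
      (𝓝 (flow θ (h - (updateTime X s ω M - s)) (traj θ (updateTime X s ω) (jumpAfter X s ω) x M))) :=
    tendsto_flow θ (tendsto_const_nhds.sub (hr M le_rfl)) htraj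
  rw [show ((s + h : ℝ≥0) : ℝ) - updateTime X s ω M = h - (updateTime X s ω M - s) by
    push_cast; ring]
  refine hlim.congr' ?_
  obtain ⟨T, hT⟩ := exists_nat_ge ((s + h : ℝ≥0) : ℝ)
  obtain ⟨δ, hδ, hjump⟩ := hω T
  filter_upwards [hhm.eventually (gt_mem_nhds hδ), eventually_gt_atTop 0] with m hmδ hm
  have hgm : grid h m m = h := by
    have hm' : (m : ℝ≥0) ≠ 0 := by exact_mod_cast hm.ne'
    unfold grid
    field_simp
  have hcell : ∀ i < m, X.N (s + grid h m (i + 1) : ℝ≥0) ω ≤ X.N (s + grid h m i : ℝ≥0) ω + 1 := by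
    intro i hi
    refine hjump _ _ (NNReal.coe_nonneg _) ?_ ?_ ?_
    · exact NNReal.coe_le_coe.2 (by unfold grid; gcongr; omega)
    · exact (NNReal.coe_le_coe.2 (by gcongr; exact grid_le hi)).trans hT
    · refine lt_of_eq_of_lt ?_ hmδ
      simp only [grid]; push_cast; ring
  rw [discrete_block_eq θ hm hcell x le_rfl, hgm]

/-- The pair `(J, K)` over `(s, s + h]` is a functional of the increments after `s`, and the
functional does not depend on `s`. -/
theorem coeffPath_block (hω : X.UnitJumps ω) (s h : ℝ≥0) :
    coeffPath θ h (X.block s ω) = coeffPair θ X s (s + h : ℝ≥0) ω := by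
  have h0 (i) := ((continuous_apply i).tendsto _).comp (tendsto_discrete θ hω s h 0)
  have h1 (i j) := ((continuous_apply i).tendsto _).comp (tendsto_discrete θ hω s h (Pi.single j 1))
  simp only [coeffPath, coeffPair, Prod.mk.injEq]
  constructor
  · funext i j
    refine ((h1 i j).sub (h0 i)).limUnder_eq.trans ?_
    simp
  · funext i
    refine (h0 i).limUnder_eq.trans ?_
    simp

end Path

/-! ### The quadratic variation of the driving process -/

namespace SimpleCompoundPoisson

variable {Ω : Type*} [MeasurableSpace Ω] {μ : Measure Ω} {τ : ℝ} (X : SimpleCompoundPoisson μ τ)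

/-- The sum of the squares of the jumps up to time `t`. -/
noncomputable def sqSum (t : ℝ) (ω : Ω) : ℝ := ∑ n ∈ Finset.range (X.N t ω), X.jump (n + 1) ω ^ 2

lemma sq_comp_sub {s t : ℝ} (hs : 0 ≤ s) (hst : s ≤ t) {ω : Ω} (h : X.N t ω ≤ X.N s ω + 1) :
    (X.comp t ω - X.comp s ω) ^ 2 = X.sqSum t ω - X.sqSum s ω := by
  have hN := X.N_le hs hst ω
  rcases Nat.eq_or_lt_of_le hN with heq | hlt
  · simp [comp, sqSum, heq]
  · have h1 : X.N t ω = X.N s ω + 1 := by omega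
    simp [comp, sqSum, h1, Finset.sum_range_succ]

lemma abs_comp_sub_le {s t : ℝ} (hs : 0 ≤ s) (hst : s ≤ t) (ω : Ω) :
    |X.comp t ω - X.comp s ω| ≤ ∑ n ∈ Finset.range (X.N t ω), |X.jump (n + 1) ω| -
      ∑ n ∈ Finset.range (X.N s ω), |X.jump (n + 1) ω| := by
  have hN := X.N_le hs hst ω
  rw [comp, comp, Finset.sum_range_sub_sum_range hN, Finset.sum_range_sub_sum_range hN]
  exact Finset.abs_sum_le_sum_abs _ _

/-- Point number `i` of the partition of `[0, t]` into `n + 1` equal parts, continued by `t`. -/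
noncomputable def uniformPart (t : ℝ) (n i : ℕ) : ℝ := (min i (n + 1) : ℕ) * (t / (n + 1))

lemma uniformPart_mono {t : ℝ} (ht : 0 ≤ t) (n : ℕ) : Monotone (uniformPart t n) := by
  intro i j hij
  unfold uniformPart
  gcongr

lemma uniformPart_zero (t : ℝ) (n : ℕ) : uniformPart t n 0 = 0 := by simp [uniformPart]

lemma uniformPart_last (t : ℝ) (n : ℕ) : uniformPart t n (n + 1) = t := by
  have : (n + 1 : ℝ) ≠ 0 := by positivity
  simp only [uniformPart, min_self]
  push_cast
  field_simp

lemma uniformPart_mem {t : ℝ} (ht : 0 ≤ t) (n i : ℕ) : uniformPart t n i ∈ Icc 0 t := by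
  constructor
  · rw [← uniformPart_zero t n]; exact uniformPart_mono ht n (Nat.zero_le i)
  · have : uniformPart t n i = uniformPart t n (min i (n + 1)) := by simp [uniformPart]
    rw [this]
    conv_rhs => rw [← uniformPart_last t n]
    exact uniformPart_mono ht n (min_le_right _ _)

lemma eventually_uniformPart_sub_lt {t : ℝ} (ht : 0 ≤ t) {ε : ℝ} (hε : 0 < ε) :
    ∀ᶠ n in atTop, ∀ i, uniformPart t n (i + 1) - uniformPart t n i < ε := by
  have h := (tendsto_const_div_atTop_nhds_zero_nat t).comp (tendsto_add_atTop_nat 1)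
  filter_upwards [h.eventually (gt_mem_nhds hε)] with n hn i
  refine lt_of_le_of_lt ?_ hn
  simp only [uniformPart, Function.comp_apply, ← sub_mul]
  push_cast
  have h0 : 0 ≤ t / ((n : ℝ) + 1) := by positivity
  have h1 : min ((i : ℝ) + 1) (n + 1) - min (i : ℝ) (n + 1) ≤ 1 := by
    rcases le_total (i : ℝ) (n + 1) with h | h
    · rw [min_eq_left h]; linarith [min_le_left ((i : ℝ) + 1) (n + 1)]
    · rw [min_eq_right h]; linarith [min_le_right ((i : ℝ) + 1) (n + 1)]
  calc _ ≤ 1 * (t / ((n : ℝ) + 1)) := by gcongr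
    _ = _ := one_mul _

/-- The drift, continuous and of bounded variation, does not contribute to the sums of squared
increments in the limit, and each jump is eventually isolated in its cell. -/
theorem tendsto_sum_sq_increments {ω : Ω} (hω : X.UnitJumps ω) {t : ℝ} (ht : 0 ≤ t) :
    Tendsto (fun n => ∑ i ∈ Finset.range (n + 1),
      (X.S (uniformPart t n (i + 1)) ω - X.S (uniformPart t n i) ω) ^ 2) atTop
      (𝓝 (X.sqSum t ω)) := by
  set A := ∑ n ∈ Finset.range (X.N t ω), |X.jump (n + 1) ω| with hA
  set V := (eVariationOn X.drift (Icc 0 t)).toReal with hV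
  have hVfin : eVariationOn X.drift (Icc 0 t) ≠ ∞ := by
    have := X.drift_variation 0 t self_mem_Ici (mem_Ici.2 ht)
    rwa [inter_eq_right.2 Icc_subset_Ici_self] at this
  have hA0 : 0 ≤ A := Finset.sum_nonneg fun _ _ => abs_nonneg _
  have hV0 : 0 ≤ V := ENNReal.toReal_nonneg
  rw [Metric.tendsto_atTop']
  intro ε hε
  set ε' := ε / (V + 2 * A + 1) with hε'
  have hε'0 : 0 < ε' := by positivity
  have hu : UniformContinuousOn X.drift (Icc 0 t) :=
    isCompact_Icc.uniformContinuousOn_of_continuous (X.drift_continuous.mono Icc_subset_Ici_self)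
  obtain ⟨δ₁, hδ₁, hD⟩ := Metric.uniformContinuousOn_iff.1 hu ε' hε'0
  obtain ⟨T, hT⟩ := exists_nat_ge t
  obtain ⟨δ₂, hδ₂, hjump⟩ := hω T
  obtain ⟨n₀, hn₀⟩ := eventually_atTop.1 ((eventually_uniformPart_sub_lt ht hδ₁).and
    (eventually_uniformPart_sub_lt ht hδ₂))
  refine ⟨n₀, fun n hn => ?_⟩
  obtain ⟨hn1, hn2⟩ := hn₀ n hn.le
  set u := uniformPart t n with hu'
  have hmono : Monotone u := uniformPart_mono ht n
  have hmem : ∀ i, u i ∈ Icc 0 t := uniformPart_mem ht n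
  have hstep (i : ℕ) : u i ≤ u (i + 1) := hmono (Nat.le_succ i)
  have hDi (i : ℕ) : |X.drift (u (i + 1)) - X.drift (u i)| ≤ ε' := by
    rw [← Real.dist_eq]
    refine (hD _ (hmem _) _ (hmem _) ?_).le
    rw [Real.dist_eq, abs_of_nonneg (sub_nonneg.2 (hstep i))]
    exact hn1 i
  have hsumD : ∑ i ∈ Finset.range (n + 1), |X.drift (u (i + 1)) - X.drift (u i)| ≤ V := by
    have h := eVariationOn.sum_le (f := X.drift) (n := n + 1) hmono hmem
    simp only [edist_dist, Real.dist_eq] at h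
    rw [← ENNReal.ofReal_sum_of_nonneg fun _ _ => abs_nonneg _] at h
    exact (ENNReal.ofReal_le_iff_le_toReal hVfin).1 h
  have hN0 : X.N (u 0) ω = 0 := by rw [hu', uniformPart_zero, X.N_zero]
  have hsumC : ∑ i ∈ Finset.range (n + 1), |X.comp (u (i + 1)) ω - X.comp (u i) ω| ≤ A := by
    refine (Finset.sum_le_sum fun i _ => X.abs_comp_sub_le (hmem i).1 (hstep i) ω).trans ?_
    rw [Finset.sum_range_sub (fun i => ∑ k ∈ Finset.range (X.N (u i) ω), |X.jump (k + 1) ω|),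
      hN0, hu', uniformPart_last]
    simp [hA]
  have hsumC2 : ∑ i ∈ Finset.range (n + 1), (X.comp (u (i + 1)) ω - X.comp (u i) ω) ^ 2 =
      X.sqSum t ω := by
    rw [Finset.sum_congr rfl fun i _ => X.sq_comp_sub (hmem i).1 (hstep i)
      (hjump _ _ (hmem i).1 (hstep i) ((hmem _).2.trans hT) (hn2 i)),
      Finset.sum_range_sub (fun i => X.sqSum (u i) ω), hu', uniformPart_last]
    rw [hu'] at hN0
    simp [sqSum, hN0]
  rw [Real.dist_eq, ← hsumC2, ← Finset.sum_sub_distrib]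
  have hterm (i : ℕ) : |(X.S (u (i + 1)) ω - X.S (u i) ω) ^ 2 -
      (X.comp (u (i + 1)) ω - X.comp (u i) ω) ^ 2| ≤
      ε' * |X.drift (u (i + 1)) - X.drift (u i)| +
        2 * ε' * |X.comp (u (i + 1)) ω - X.comp (u i) ω| := by
    rw [X.S_eq, X.S_eq]
    set d := X.drift (u (i + 1)) - X.drift (u i) with hd
    set c := X.comp (u (i + 1)) ω - X.comp (u i) ω with hc
    have hde : |d| ≤ ε' := hDi i
    have : (X.drift (u (i + 1)) + X.comp (u (i + 1)) ω - (X.drift (u i) + X.comp (u i) ω)) ^ 2 -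
        c ^ 2 = d * d + 2 * d * c := by rw [hd, hc]; ring
    rw [this]
    refine (abs_add_le _ _).trans ?_
    rw [abs_mul, abs_mul, abs_mul, abs_two]
    gcongr
  refine (Finset.abs_sum_le_sum_abs _ _).trans_lt
    ((Finset.sum_le_sum fun i _ => hterm i).trans_lt ?_)
  rw [Finset.sum_add_distrib, ← Finset.mul_sum, ← Finset.mul_sum]
  calc _ ≤ ε' * V + 2 * ε' * A := by gcongr
    _ = ε' * (V + 2 * A) := by ring
    _ < ε' * (V + 2 * A + 1) := mul_lt_mul_of_pos_left (lt_add_one _) hε'0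
    _ = ε := by rw [hε']; field_simp

lemma eventually_N_eq (ω : Ω) {t : ℝ} (ht : 0 ≤ t) : ∀ᶠ u in 𝓝[≥] t, X.N u ω = X.N t ω := by
  have h := X.N_rightCont ω t ht
  exact h (by simp : ({X.N t ω} : Set ℕ) ∈ 𝓝 (X.N t ω))

/-- Almost surely, the quadratic variation is the sum of the squared jumps at all times. -/
theorem ae_quadraticVariation_eq {Q : Ω → StieltjesFunction ℝ}
    (hQ : IsQuadraticVariation μ X.S Q) : ∀ᵐ ω ∂μ, ∀ t, 0 ≤ t → Q ω t = X.sqSum t ω := by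
  have hfix (t : ℝ) (ht : 0 ≤ t) : ∀ᵐ ω ∂μ, Q ω t = X.sqSum t ω := by
    obtain ⟨ns, hns, hlim⟩ := (hQ t ht (fun n => n + 1) (uniformPart t) (uniformPart_mono ht)
      (uniformPart_zero t) (uniformPart_last t) (fun ε hε => by
        filter_upwards [eventually_uniformPart_sub_lt ht hε] with n hn i _
        exact hn i)).exists_seq_tendsto_ae
    filter_upwards [hlim, X.ae_unitJumps] with ω h1 h2
    exact tendsto_nhds_unique h1 ((X.tendsto_sum_sq_increments h2 ht).comp hns.tendsto_atTop)
  have hrat : ∀ᵐ ω ∂μ, ∀ r : ℚ, (0 : ℝ) ≤ r → Q ω r = X.sqSum r ω := by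
    rw [ae_all_iff]
    intro r
    by_cases hr : (0 : ℝ) ≤ r
    · filter_upwards [hfix r hr] with ω h _ using h
    · exact Eventually.of_forall fun ω h => absurd h hr
  filter_upwards [hrat] with ω hω t ht
  -- both sides are right continuous
  have h1 : Tendsto (Q ω) (𝓝[>] t) (𝓝 (Q ω t)) :=
    ((Q ω).right_continuous t).tendsto.mono_left (nhdsWithin_mono _ Ioi_subset_Ici_self)
  have h2 : ∀ᶠ u in 𝓝[>] t, X.N u ω = X.N t ω :=
    (X.eventually_N_eq ω ht).filter_mono (nhdsWithin_mono _ Ioi_subset_Ici_self)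
  obtain ⟨c, hc, hcN⟩ := mem_nhdsGT_iff_exists_Ioo_subset.1 h2
  have h3 : ∃ᶠ u in 𝓝[>] t, Q ω u = X.sqSum t ω := by
    rw [frequently_iff]
    intro U hU
    obtain ⟨d, hd, hdU⟩ := mem_nhdsGT_iff_exists_Ioo_subset.1 hU
    obtain ⟨r, hr1, hr2⟩ := exists_rat_btwn (lt_min (mem_Ioi.1 hc) (mem_Ioi.1 hd))
    rw [lt_min_iff] at hr2
    refine ⟨r, hdU ⟨hr1, hr2.2⟩, ?_⟩
    have : X.N r ω = X.N t ω := hcN ⟨hr1, hr2.1⟩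
    rw [hω r (ht.trans hr1.le), sqSum, sqSum, this]
  by_contra hne
  exact h3 (h1.eventually_ne hne)

end SimpleCompoundPoisson

/-! ### The state equation between two jumps -/

section Cadlag

variable {E : Type*} [NormedAddCommGroup E] {y : ℝ → E}

/-- A càdlàg path is bounded on compact intervals. -/
lemma exists_norm_le_of_cadlag (hr : ∀ t, 0 ≤ t → ContinuousWithinAt y (Ici t) t)
    (hl : ∀ t, 0 < t → ∃ z, Tendsto y (𝓝[<] t) (𝓝 z)) (T : ℝ) :
    ∃ C, ∀ t ∈ Icc 0 T, ‖y t‖ ≤ C := by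
  refine isCompact_Icc.induction_on (p := fun s => ∃ C, ∀ t ∈ s, ‖y t‖ ≤ C) ⟨0, by simp⟩
    (fun s t hst ⟨C, h⟩ => ⟨C, fun u hu => h u (hst hu)⟩)
    (fun s t ⟨C, h⟩ ⟨C', h'⟩ => ⟨max C C', fun u hu => hu.elim
      (fun hu => (h u hu).trans (le_max_left _ _)) fun hu => (h' u hu).trans (le_max_right _ _)⟩) ?_
  intro t ht
  have key {l : Filter ℝ} {z : E} (h : Tendsto y l (𝓝 z)) :
      {u | ‖y u‖ ≤ ‖z‖ + 1} ∈ l :=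
    (h.norm.eventually (gt_mem_nhds (lt_add_one ‖z‖))).mono fun _ h => h.le
  have h1 := key (hr t ht.1).tendsto
  rcases eq_or_lt_of_le ht.1 with h0 | h0
  · exact ⟨_, nhdsWithin_mono t (fun u hu => by rw [← h0]; exact hu.1) h1, ‖y t‖ + 1, fun u hu => hu⟩
  · obtain ⟨z, hz⟩ := hl t h0
    refine ⟨{u | ‖y u‖ ≤ ‖y t‖ + 1} ∪ {u | ‖y u‖ ≤ ‖z‖ + 1}, mem_nhdsWithin_of_mem_nhds ?_,
      max (‖y t‖ + 1) (‖z‖ + 1), fun u hu => hu.elim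
        (fun hu => le_trans hu (le_max_left _ _)) fun hu => le_trans hu (le_max_right _ _)⟩
    rw [← nhdsLT_sup_nhdsGE]
    exact ⟨mem_of_superset (key hz) subset_union_right, mem_of_superset h1 subset_union_left⟩

lemma tendsto_leftLim_of_cadlag (hl : ∀ t, 0 < t → ∃ z, Tendsto y (𝓝[<] t) (𝓝 z)) {t : ℝ}
    (ht : 0 < t) : Tendsto y (𝓝[<] t) (𝓝 (Function.leftLim y t)) :=
  tendsto_leftLim_of_tendsto (hl t ht)

lemma aestronglyMeasurable_leftLim [SecondCountableTopology E] [MeasurableSpace E] [BorelSpace E]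
    (hl : ∀ t, 0 < t → ∃ z, Tendsto y (𝓝[<] t) (𝓝 z)) (ν : Measure ℝ) {s t : ℝ} (hs : 0 ≤ s) :
    AEStronglyMeasurable (Function.leftLim y) (ν.restrict (Ioc s t)) := by
  -- on `(0, ∞)` the left limit is a limit of functions of `⌈n u⌉`
  set g : ℕ → ℝ → E := fun n u => y ((⌈(n + 1 : ℝ) * u⌉ - 1) / (n + 1))
  have hg (n : ℕ) : Measurable (g n) := by
    have h1 : Measurable fun k : ℤ => y ((k - 1) / (n + 1)) := measurable_from_top
    exact h1.comp (Int.measurable_ceil.comp (measurable_const.mul measurable_id))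
  refine aestronglyMeasurable_of_tendsto_ae (f := g) atTop
    (fun n => (hg n).aestronglyMeasurable) ?_
  filter_upwards [ae_restrict_mem measurableSet_Ioc] with u hu
  have hu0 : 0 < u := hs.trans_lt hu.1
  refine (tendsto_leftLim_of_cadlag hl hu0).comp ?_
  refine tendsto_nhdsWithin_iff.2 ⟨?_, Eventually.of_forall fun n => ?_⟩
  · have h0 : Tendsto (fun n : ℕ => u - 1 / ((n : ℝ) + 1)) atTop (𝓝 u) := by
      simpa using tendsto_one_div_add_atTop_nhds_zero_nat.const_sub u
    refine tendsto_of_tendsto_of_tendsto_of_le_of_le h0 tendsto_const_nhds (fun n => ?_) fun n => ?_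
    · have hn : (0 : ℝ) < n + 1 := by positivity
      show u - 1 / ((n : ℝ) + 1) ≤ _
      rw [le_div_iff₀ hn, sub_mul, one_div_mul_cancel hn.ne', mul_comm]
      linarith [Int.le_ceil ((n + 1 : ℝ) * u)]
    · have hn : (0 : ℝ) < n + 1 := by positivity
      show _ / _ ≤ u
      rw [div_le_iff₀ hn]
      linarith [Int.ceil_lt_add_one ((n + 1 : ℝ) * u), mul_comm u (n + 1 : ℝ)]
  · have hn : (0 : ℝ) < n + 1 := by positivity
    show _ / _ < u
    rw [div_lt_iff₀ hn]
    linarith [Int.ceil_lt_add_one ((n + 1 : ℝ) * u), mul_comm u (n + 1 : ℝ)]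

lemma norm_leftLim_le (hl : ∀ t, 0 < t → ∃ z, Tendsto y (𝓝[<] t) (𝓝 z)) {T C : ℝ}
    (hC : ∀ t ∈ Icc 0 T, ‖y t‖ ≤ C) {t : ℝ} (ht : 0 < t) (htT : t ≤ T) :
    ‖Function.leftLim y t‖ ≤ C := by
  refine le_of_tendsto (tendsto_leftLim_of_cadlag hl ht).norm ?_
  filter_upwards [Ioo_mem_nhdsLT ht] with u hu
  exact hC u ⟨hu.1.le, hu.2.le.trans htT⟩

lemma integrableOn_leftLim [SecondCountableTopology E] [MeasurableSpace E] [BorelSpace E]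
    (hr : ∀ t, 0 ≤ t → ContinuousWithinAt y (Ici t) t)
    (hl : ∀ t, 0 < t → ∃ z, Tendsto y (𝓝[<] t) (𝓝 z)) (ν : Measure ℝ)
    [IsLocallyFiniteMeasure ν] {s t : ℝ} (hs : 0 ≤ s) :
    IntegrableOn (Function.leftLim y) (Ioc s t) ν := by
  obtain ⟨C, hC⟩ := exists_norm_le_of_cadlag hr hl t
  have : IsFiniteMeasure (ν.restrict (Ioc s t)) := ⟨by simpa using measure_Ioc_lt_top⟩
  refine Integrable.of_bound (aestronglyMeasurable_leftLim hl ν hs) C ?_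
  filter_upwards [ae_restrict_mem measurableSet_Ioc] with u hu
  exact norm_leftLim_le hl hC (hs.trans_lt hu.1) hu.2

end Cadlag

section Equation

attribute [local instance] Matrix.linftyOpNormedRing Matrix.linftyOpNormedAlgebra

variable {p q : ℕ} {θ : Params p q} {Q : StieltjesFunction ℝ} {y : ℝ → Fin q → ℝ}

lemma hasDerivAt_flow (x : Fin q → ℝ) (t : ℝ) :
    HasDerivAt (fun d => flow θ d x) (θ.B *ᵥ flow θ t x) t := by
  let L : Matrix (Fin q) (Fin q) ℝ →ₗ[ℝ] (Fin q → ℝ) :=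
    { toFun := fun M => M *ᵥ x
      map_add' := fun M M' => Matrix.add_mulVec M M' x
      map_smul' := fun c M => Matrix.smul_mulVec c M x }
  have h := (LinearMap.toContinuousLinearMap L).hasFDerivAt.comp_hasDerivAt t
    (hasDerivAt_exp_smul θ.B t)
  have hcomm : NormedSpace.exp (t • θ.B) * θ.B = θ.B * NormedSpace.exp (t • θ.B) :=
    (((Commute.refl θ.B).smul_left t).exp_left).eq
  rw [hcomm] at h
  have h2 : L (θ.B * NormedSpace.exp (t • θ.B)) = θ.B *ᵥ flow θ t x := by
    show (θ.B * NormedSpace.exp (t • θ.B)) *ᵥ x = θ.B *ᵥ (NormedSpace.exp (t • θ.B) *ᵥ x)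
    rw [Matrix.mulVec_mulVec]
  rw [← h2]
  exact h

lemma continuous_flow_left (x : Fin q → ℝ) : Continuous fun d => flow θ d x :=
  continuous_iff_continuousAt.2 fun t => (hasDerivAt_flow x t).continuousAt

lemma integral_flow (x : Fin q → ℝ) (a b : ℝ) :
    ∫ u in a..b, θ.B *ᵥ flow θ u x = flow θ b x - flow θ a x :=
  intervalIntegral.integral_eq_sub_of_hasDerivAt (fun u _ => hasDerivAt_flow x u)
    ((continuous_const.matrix_mulVec (continuous_flow_left x)).intervalIntegrable _ _)

/-- The path `y` solves the state equation driven by the nondecreasing function `Q`. -/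
structure SolvesStateEquation (θ : Params p q) (Q : StieltjesFunction ℝ) (y : ℝ → Fin q → ℝ) :
    Prop where
  rightCont : ∀ t, 0 ≤ t → ContinuousWithinAt y (Ici t) t
  leftLimit : ∀ t, 0 < t → ∃ z, Tendsto y (𝓝[<] t) (𝓝 z)
  eq : ∀ t, 0 ≤ t → y t = y 0 + (∫ u in (0 : ℝ)..t, θ.B *ᵥ Function.leftLim y u)
      + (∫ u in Ioc 0 t, (θ.α 0 + θ.a ⬝ᵥ Function.leftLim y u) ∂Q.measure) • θ.e

namespace SolvesStateEquation

lemma integrableOn_drift (h : SolvesStateEquation θ Q y) {s t : ℝ} (hs : 0 ≤ s) :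
    IntegrableOn (fun u => θ.B *ᵥ Function.leftLim y u) (Ioc s t) volume :=
  (LinearMap.toContinuousLinearMap (Matrix.mulVecLin θ.B)).integrable_comp
    (integrableOn_leftLim h.rightCont h.leftLimit volume hs)

lemma intervalIntegrable_drift (h : SolvesStateEquation θ Q y) {s t : ℝ} (hs : 0 ≤ s)
    (hst : s ≤ t) : IntervalIntegrable (fun u => θ.B *ᵥ Function.leftLim y u) volume s t :=
  (intervalIntegrable_iff_integrableOn_Ioc_of_le hst).2 (h.integrableOn_drift hs)

lemma integrableOn_noise (h : SolvesStateEquation θ Q y) {s t : ℝ} (hs : 0 ≤ s) :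
    IntegrableOn (fun u => θ.α 0 + θ.a ⬝ᵥ Function.leftLim y u) (Ioc s t) Q.measure := by
  refine Integrable.add (integrableOn_const measure_Ioc_lt_top.ne) ?_
  exact (LinearMap.toContinuousLinearMap (dotProductBilin ℝ ℝ θ.a)).integrable_comp
    (integrableOn_leftLim h.rightCont h.leftLimit Q.measure hs)

lemma eq_add (h : SolvesStateEquation θ Q y) {s t : ℝ} (hs : 0 ≤ s) (hst : s ≤ t) :
    y t = y s + (∫ u in s..t, θ.B *ᵥ Function.leftLim y u)
      + (∫ u in Ioc s t, (θ.α 0 + θ.a ⬝ᵥ Function.leftLim y u) ∂Q.measure) • θ.e := by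
  rw [h.eq t (hs.trans hst), h.eq s hs,
    ← intervalIntegral.integral_add_adjacent_intervals (h.intervalIntegrable_drift le_rfl hs)
      (h.intervalIntegrable_drift hs hst), ← Ioc_union_Ioc_eq_Ioc hs hst,
    setIntegral_union (Ioc_disjoint_Ioc_of_le le_rfl) measurableSet_Ioc
      (h.integrableOn_noise le_rfl) (h.integrableOn_noise hs), add_smul]
  abel

/-- As long as `Q` is constant, the solution follows the free flow. -/
lemma eq_flow (h : SolvesStateEquation θ Q y) {s t : ℝ} (hs : 0 ≤ s)
    (hQ : ∀ u ∈ Ico s t, Q u = Q s) {u : ℝ} (hu : u ∈ Ico s t) : y u = flow θ (u - s) (y s) := by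
  have hint : ∀ v ∈ Ico s t, y v = y s + ∫ u in s..v, θ.B *ᵥ Function.leftLim y u := by
    intro v hv
    rw [h.eq_add hs hv.1, Measure.restrict_eq_zero.2, integral_zero_measure, zero_smul, add_zero]
    rw [Q.measure_Ioc, hQ v hv, sub_self, ENNReal.ofReal_zero]
  have hcont : ContinuousOn y (Icc s u) := by
    have h1 : ContinuousOn (fun v => y s + ∫ u in s..v, θ.B *ᵥ Function.leftLim y u) (Icc s u) := by
      refine continuousOn_const.add ?_
      have := intervalIntegral.continuousOn_primitive_interval'
        (h.intervalIntegrable_drift hs hu.1) (left_mem_uIcc (a := s) (b := u))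
      rwa [uIcc_of_le hu.1] at this
    exact h1.congr fun v hv => hint v ⟨hv.1, hv.2.trans_lt hu.2⟩
  have hleft : ∀ v ∈ Ioc s u, Function.leftLim y v = y v := by
    intro v hv
    refine ContinuousWithinAt.leftLim_eq ?_
    have := (hcont v ⟨hv.1.le, hv.2⟩)
    refine this.mono_of_mem_nhdsWithin ?_
    filter_upwards [Ioc_mem_nhdsLE hv.1] with w hw using ⟨hw.1.le, hw.2.trans hv.2⟩
  have hint' : ∀ v ∈ Icc s u, y v = y s + ∫ u in s..v, θ.B *ᵥ y u := by
    intro v hv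
    rw [hint v ⟨hv.1, hv.2.trans_lt hu.2⟩]
    congr 1
    refine intervalIntegral.integral_congr_ae (Eventually.of_forall fun w hw => ?_)
    rw [uIoc_of_le hv.1] at hw
    rw [hleft w ⟨hw.1, hw.2.trans hv.2⟩]
  have hBcont : ContinuousOn (fun v => θ.B *ᵥ y v) (Icc s u) :=
    (LinearMap.toContinuousLinearMap (Matrix.mulVecLin θ.B)).continuous.comp_continuousOn hcont
  have hderiv : ∀ v ∈ Ico s u, HasDerivWithinAt y (θ.B *ᵥ y v) (Ici v) v := by
    intro v hv
    have hsub : Icc v u ⊆ Icc s u := Icc_subset_Icc_left hv.1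
    have h1 : HasDerivWithinAt (fun w => ∫ u in s..w, θ.B *ᵥ y u) (θ.B *ᵥ y v) (Ici v) v := by
      refine intervalIntegral.integral_hasDerivWithinAt_right ?_ (t := Ioi v) ?_ ?_
      · exact (hBcont.mono (Icc_subset_Icc_right hv.2.le)).intervalIntegrable_of_Icc hv.1
      · refine ⟨Ioo v u, Ioo_mem_nhdsGT hv.2, ?_⟩
        exact (hBcont.mono (Ioo_subset_Icc_self.trans hsub)).aestronglyMeasurable measurableSet_Ioo
      · refine ((hBcont v ⟨hv.1, hv.2.le⟩).mono_of_mem_nhdsWithin ?_)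
        filter_upwards [Ioo_mem_nhdsGT hv.2] with w hw using ⟨hv.1.trans hw.1.le, hw.2.le⟩
    refine (h1.const_add (y s)).congr_of_eventuallyEq ?_ (hint' v ⟨hv.1, hv.2.le⟩)
    filter_upwards [Ico_mem_nhdsGE hv.2] with w hw using hint' w ⟨hv.1.trans hw.1, hw.2.le⟩
  set L := LinearMap.toContinuousLinearMap (Matrix.mulVecLin θ.B)
  refine ODE_solution_unique (v := fun _ x => θ.B *ᵥ x) (fun _ => L.lipschitz) hcont hderiv
    (f := y) (g := fun v => flow θ (v - s) (y s)) (a := s) (b := u)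
    ((continuous_flow_left (y s)).comp (continuous_id.sub continuous_const)).continuousOn
    (fun v _ => ?_) (by simp [flow_zero]) (right_mem_Icc.2 hu.1)
  have := (hasDerivAt_flow (θ := θ) (y s) (v - s)).comp_sub_const v s
  exact this.hasDerivWithinAt

/-- If `Q` is constant on `[s, t)` and grows by `z²` at time `t`, the solution follows the free flow
until `t`, and then jumps. -/
theorem eq_kick_flow (h : SolvesStateEquation θ Q y) {s t z : ℝ} (hs : 0 ≤ s) (hst : s < t)
    (hQ : ∀ u ∈ Ico s t, Q u = Q s) (hz : Q t - Q s = z ^ 2) :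
    y t = kick θ z (flow θ (t - s) (y s)) := by
  have hflow : Continuous fun v => flow θ (v - s) (y s) :=
    (continuous_flow_left (y s)).comp (continuous_id.sub continuous_const)
  have hleft : ∀ v ∈ Ioc s t, Function.leftLim y v = flow θ (v - s) (y s) := by
    intro v hv
    refine tendsto_nhds_unique (tendsto_leftLim_of_cadlag h.leftLimit (hs.trans_lt hv.1)) ?_
    refine (hflow.tendsto v |>.mono_left nhdsWithin_le_nhds).congr' ?_
    filter_upwards [Ioo_mem_nhdsLT hv.1] with w hw
    exact (h.eq_flow hs hQ ⟨hw.1.le, hw.2.trans_le hv.2⟩).symm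
  have hdrift : ∫ u in s..t, θ.B *ᵥ Function.leftLim y u = flow θ (t - s) (y s) - y s := by
    have h1 : ∫ u in s..t, θ.B *ᵥ Function.leftLim y u =
        ∫ u in s..t, θ.B *ᵥ flow θ (u - s) (y s) := by
      refine intervalIntegral.integral_congr_ae (Eventually.of_forall fun w hw => ?_)
      rw [uIoc_of_le hst.le] at hw
      rw [hleft w hw]
    rw [h1, intervalIntegral.integral_comp_sub_right (fun u => θ.B *ᵥ flow θ u (y s)),
      integral_flow, sub_self, flow_zero]
  have hQleft : Function.leftLim Q t = Q s := by
    refine tendsto_nhds_unique (Q.mono.tendsto_leftLim t) (tendsto_const_nhds.congr' ?_)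
    filter_upwards [Ioo_mem_nhdsLT hst] with w hw using (hQ w ⟨hw.1.le, hw.2⟩).symm
  have hnoise : ∫ u in Ioc s t, (θ.α 0 + θ.a ⬝ᵥ Function.leftLim y u) ∂Q.measure =
      z ^ 2 * (θ.α 0 + θ.a ⬝ᵥ flow θ (t - s) (y s)) := by
    have h0 : Q.measure (Ioo s t) = 0 := by rw [Q.measure_Ioo, hQleft, sub_self, ENNReal.ofReal_zero]
    have h1 : (Ioc s t : Set ℝ) =ᵐ[Q.measure] ({t} : Set ℝ) := by
      rw [← Ioo_union_right hst]
      exact union_ae_eq_right_of_ae_eq_empty (ae_eq_empty.2 h0)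
    rw [setIntegral_congr_set h1, integral_singleton, hleft t ⟨hst, le_rfl⟩, Measure.real,
      Q.measure_singleton, hQleft, hz, ENNReal.toReal_ofReal (sq_nonneg z), smul_eq_mul]
  rw [h.eq_add hs hst.le, hdrift, hnoise, kick_eq]
  congr 1
  · abel
  · rw [mul_comm]

end SolvesStateEquation

end Equation

section Solution

variable {Ω : Type*} [MeasurableSpace Ω] {μ : Measure Ω} {τ : ℝ} {p q : ℕ} {θ : Params p q}
  {X : SimpleCompoundPoisson μ τ}

/-- The state equation is solved explicitly by moving from one arrival time to the next. -/
theorem SolvesStateEquation.eq_J_mulVec_add_K {Q : StieltjesFunction ℝ} {y : ℝ → Fin q → ℝ}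
    (h : SolvesStateEquation θ Q y) {ω : Ω} (hω : X.UnitJumps ω)
    (hQ : ∀ t, 0 ≤ t → Q t = X.sqSum t ω) {s t : ℝ} (hs : 0 ≤ s) (hst : s ≤ t) :
    y t = J θ X s t ω *ᵥ y s + K θ X s t ω := by
  have ht := hs.trans hst
  have hNst := X.N_le hs hst ω
  rw [J_mulVec_add_K θ hs hst]
  set T := updateTime X s ω with hT
  set M := X.N t ω - X.N s ω with hM
  have hTs (k : ℕ) : s ≤ T k := le_max_left _ _
  have hQN {u v : ℝ} (hu : 0 ≤ u) (hv : 0 ≤ v) (huv : X.N u ω = X.N v ω) : Q u = Q v := by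
    rw [hQ u hu, hQ v hv, SimpleCompoundPoisson.sqSum, SimpleCompoundPoisson.sqSum, huv]
  have hNT {k : ℕ} (hk : k ≤ M) : X.N (T k) ω = X.N s ω + k := by
    cases k with
    | zero => rw [hT, updateTime_zero hs, add_zero]
    | succ k =>
      rw [hT, (updateTime_succ hs hst hk).1]
      exact hω.N_arrival ht (by omega)
  have htraj {k : ℕ} (hk : k ≤ M) : y (T k) = traj θ T (jumpAfter X s ω) (y s) k := by
    induction k with
    | zero => rw [hT, updateTime_zero hs]; rfl
    | succ k ih =>
      have h1 := hNT (Nat.le_of_succ_le hk)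
      have h2 := hNT hk
      have hlt : T k < T (k + 1) := by
        refine lt_of_le_of_ne (updateTime_mono hs hst hk) fun heq => ?_
        rw [heq, h2] at h1
        omega
      have hTk := hs.trans (hTs k)
      rw [traj, ← ih (by omega)]
      refine h.eq_kick_flow hTk hlt (fun u hu => ?_) ?_
      · have hu0 := hTk.trans hu.1
        refine hQN hu0 hTk (le_antisymm ?_ (X.N_le hTk hu.1 ω))
        -- fewer than `k + 1` jumps after time `s` occur before the time of the next one
        by_contra! hlt'
        have h3 : X.N s ω + k + 1 ≤ X.N u ω := by omega
        have h4 := X.arrival_le hu0 h3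
        rw [← (updateTime_succ hs hst hk).1] at h4
        exact absurd hu.2 (not_lt.2 h4)
      · rw [hQ _ (hs.trans (hTs _)), hQ _ hTk, SimpleCompoundPoisson.sqSum,
          SimpleCompoundPoisson.sqSum, h1, h2, ← add_assoc, Finset.sum_range_succ,
          add_sub_cancel_left]
        rfl
  rw [← htraj le_rfl]
  have hle : T M ≤ t := updateTime_le hs hst le_rfl
  rcases eq_or_lt_of_le hle with heq | hlt
  · rw [heq, sub_self, flow_zero]
  · have hTM := hs.trans (hTs M)
    have hNM : X.N (T M) ω = X.N t ω := by rw [hNT le_rfl]; omega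
    have hconst : ∀ u, T M ≤ u → u ≤ t → Q u = Q (T M) := fun u hu hut =>
      hQN (hTM.trans hu) hTM (le_antisymm ((X.N_le (hTM.trans hu) hut ω).trans hNM.ge)
        (X.N_le hTM hu ω))
    rw [h.eq_kick_flow (z := 0) hTM hlt (fun u hu => hconst u hu.1 hu.2.le)
      (by rw [hconst t hlt.le le_rfl]; simp), kick_zero]

theorem IsStateProcess.ae_eq_J_mulVec_add_K {Q : Ω → StieltjesFunction ℝ}
    {Y : ℝ → Ω → Fin q → ℝ} (hQ : IsQuadraticVariation μ X.S Q) [IsProbabilityMeasure μ]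
    (hY : IsStateProcess θ X Q Y) : ∀ᵐ ω ∂μ, ∀ s t : ℝ, 0 ≤ s → s ≤ t →
      Y t ω = J θ X s t ω *ᵥ Y s ω + K θ X s t ω := by
  filter_upwards [X.ae_unitJumps, X.ae_quadraticVariation_eq hQ, hY.rightCont, hY.leftLimit,
    hY.sde] with ω h1 h2 h3 h4 h5 s t hs hst
  exact SolvesStateEquation.eq_J_mulVec_add_K (y := fun u => Y u ω) ⟨h3, h4, h5⟩ h1 h2 hs hst

end Solution

/-! ### The norm adapted to a diagonalization of `B` -/

section LpNorm

variable {q : ℕ} (r : ℝ≥0∞) [Fact (1 ≤ r)]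

lemma norm_toLp_mono {x y : Fin q → ℂ} (h : ∀ i, ‖x i‖ ≤ ‖y i‖) :
    ‖WithLp.toLp r x‖ ≤ ‖WithLp.toLp r y‖ := by
  rcases eq_or_ne r ∞ with rfl | hr
  · rw [PiLp.norm_toLp, PiLp.norm_toLp, pi_norm_le_iff_of_nonneg (norm_nonneg _)]
    exact fun i => (h i).trans (norm_le_pi_norm y i)
  · have h0 : 0 < r.toReal :=
      ENNReal.toReal_pos (zero_lt_one.trans_le (Fact.out : 1 ≤ r)).ne' hr
    rw [PiLp.norm_eq_sum h0, PiLp.norm_eq_sum h0]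
    refine Real.rpow_le_rpow (Finset.sum_nonneg fun i _ => by positivity)
      (Finset.sum_le_sum fun i _ => Real.rpow_le_rpow (norm_nonneg _) (h i) h0.le) (by positivity)

lemma norm_toLp_mulVec_le (C : Matrix (Fin q) (Fin q) ℂ) (x : Fin q → ℂ) :
    ‖WithLp.toLp r (C *ᵥ x)‖ ≤ lpMatrixNorm r C * ‖WithLp.toLp r x‖ :=
  (LinearMap.toContinuousLinearMap (Matrix.toLpLin r r C)).le_opNorm (WithLp.toLp r x)

lemma lpMatrixNorm_nonneg (C : Matrix (Fin q) (Fin q) ℂ) : 0 ≤ lpMatrixNorm r C := norm_nonneg _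

lemma lpMatrixNorm_le {C : Matrix (Fin q) (Fin q) ℂ} {M : ℝ} (hM : 0 ≤ M)
    (h : ∀ x, ‖WithLp.toLp r (C *ᵥ x)‖ ≤ M * ‖WithLp.toLp r x‖) : lpMatrixNorm r C ≤ M :=
  ContinuousLinearMap.opNorm_le_bound _ hM fun x => h (WithLp.ofLp x)

lemma lpMatrixNorm_mul_le (C D : Matrix (Fin q) (Fin q) ℂ) :
    lpMatrixNorm r (C * D) ≤ lpMatrixNorm r C * lpMatrixNorm r D := by
  have hC := lpMatrixNorm_nonneg r C
  refine lpMatrixNorm_le r (mul_nonneg hC (lpMatrixNorm_nonneg r D)) fun x => ?_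
  rw [← Matrix.mulVec_mulVec, mul_assoc]
  exact (norm_toLp_mulVec_le r C _).trans
    (mul_le_mul_of_nonneg_left (norm_toLp_mulVec_le r D x) hC)

lemma lpMatrixNorm_one_add_smul_le (C : Matrix (Fin q) (Fin q) ℂ) {a : ℝ} (ha : 0 ≤ a) :
    lpMatrixNorm r (1 + (a : ℂ) • C) ≤ 1 + lpMatrixNorm r C * a := by
  have hC := lpMatrixNorm_nonneg r C
  refine lpMatrixNorm_le r (by positivity) fun x => ?_
  rw [Matrix.add_mulVec, Matrix.one_mulVec, Matrix.smul_mulVec, WithLp.toLp_add, WithLp.toLp_smul,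
    add_mul, one_mul, mul_comm _ a, mul_assoc]
  refine (norm_add_le _ _).trans (add_le_add le_rfl ?_)
  rw [norm_smul, Complex.norm_real, Real.norm_of_nonneg ha]
  exact mul_le_mul_of_nonneg_left (norm_toLp_mulVec_le r C x) ha

lemma lpMatrixNorm_diagonal_le {d : Fin q → ℂ} {M : ℝ} (hM : 0 ≤ M) (h : ∀ i, ‖d i‖ ≤ M) :
    lpMatrixNorm r (Matrix.diagonal d) ≤ M := by
  refine lpMatrixNorm_le r hM fun x => ?_
  have h1 : M * ‖WithLp.toLp r x‖ = ‖WithLp.toLp r ((M : ℂ) • x)‖ := by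
    rw [WithLp.toLp_smul, norm_smul, Complex.norm_real, Real.norm_of_nonneg hM]
  rw [h1]
  refine norm_toLp_mono r fun i => ?_
  rw [Matrix.mulVec_diagonal, norm_mul, Pi.smul_apply, smul_eq_mul, norm_mul, Complex.norm_real,
    Real.norm_of_nonneg hM]
  exact mul_le_mul_of_nonneg_right (h i) (norm_nonneg _)

end LpNorm

section Adapted

variable {p q : ℕ} (θ : Params p q) (P : Matrix (Fin q) (Fin q) ℂ) (r : ℝ≥0∞) [Fact (1 ≤ r)]

/-- The matrix `P⁻¹ M P` for a real matrix `M`. -/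
noncomputable def conj (M : Matrix (Fin q) (Fin q) ℝ) : Matrix (Fin q) (Fin q) ℂ :=
  P⁻¹ * M.map (algebraMap ℝ ℂ) * P

/-- The norm `‖P⁻¹ v‖_r` of a real vector. -/
noncomputable def vecNorm (v : Fin q → ℝ) : ℝ :=
  ‖WithLp.toLp r (P⁻¹ *ᵥ fun i => (v i : ℂ))‖

lemma vecNorm_nonneg (v : Fin q → ℝ) : 0 ≤ vecNorm P r v := norm_nonneg _

lemma vecNorm_zero : vecNorm P r (0 : Fin q → ℝ) = 0 := by
  have : (fun _ : Fin q => (0 : ℂ)) = 0 := rfl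
  simp [vecNorm, this]

lemma vecNorm_add_le (v w : Fin q → ℝ) : vecNorm P r (v + w) ≤ vecNorm P r v + vecNorm P r w := by
  have : (fun i => ((v + w) i : ℂ)) = (fun i => (v i : ℂ)) + fun i => (w i : ℂ) := by
    ext i; simp
  rw [vecNorm, this, Matrix.mulVec_add, WithLp.toLp_add]
  exact norm_add_le _ _

lemma vecNorm_smul (a : ℝ) (v : Fin q → ℝ) : vecNorm P r (a • v) = |a| * vecNorm P r v := by
  have : (fun i => ((a • v) i : ℂ)) = (a : ℂ) • fun i => (v i : ℂ) := by
    ext i; simp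
  rw [vecNorm, this, Matrix.mulVec_smul, WithLp.toLp_smul, norm_smul, Complex.norm_real,
    Real.norm_eq_abs, vecNorm]

lemma continuous_vecNorm : Continuous (vecNorm (q := q) P r) := by
  unfold vecNorm
  refine continuous_norm.comp ((PiLp.continuous_toLp r _).comp ?_)
  exact continuous_const.matrix_mulVec
    (continuous_pi fun i => Complex.continuous_ofReal.comp (continuous_apply i))

variable {P}

lemma inv_mul_cancel_of_isUnit (hP : IsUnit P) : P⁻¹ * P = 1 :=
  Matrix.nonsing_inv_mul P ((Matrix.isUnit_iff_isUnit_det P).1 hP)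

lemma mul_inv_cancel_of_isUnit (hP : IsUnit P) : P * P⁻¹ = 1 :=
  Matrix.mul_nonsing_inv P ((Matrix.isUnit_iff_isUnit_det P).1 hP)

lemma exists_norm_le_mul_vecNorm (hP : IsUnit P) :
    ∃ κ, 0 ≤ κ ∧ ∀ v : Fin q → ℝ, ‖v‖ ≤ κ * vecNorm P r v := by
  refine ⟨lpMatrixNorm r P, lpMatrixNorm_nonneg r P, fun v => ?_⟩
  have h := norm_toLp_mulVec_le r P (P⁻¹ *ᵥ fun i => (v i : ℂ))
  rw [Matrix.mulVec_mulVec, mul_inv_cancel_of_isUnit hP, Matrix.one_mulVec] at h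
  refine le_trans ?_ h
  rw [pi_norm_le_iff_of_nonneg (norm_nonneg _)]
  intro i
  have := PiLp.norm_apply_le (WithLp.toLp r fun i => (v i : ℂ)) i
  simpa using this

lemma conj_mul (hP : IsUnit P) (M M' : Matrix (Fin q) (Fin q) ℝ) :
    conj P (M * M') = conj P M * conj P M' := by
  simp only [conj, Matrix.map_mul]
  calc _ = P⁻¹ * M.map (algebraMap ℝ ℂ) * 1 * (M'.map (algebraMap ℝ ℂ) * P) := by
        simp only [Matrix.mul_assoc, Matrix.one_mul]
    _ = _ := by rw [← mul_inv_cancel_of_isUnit hP]; simp only [Matrix.mul_assoc]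

lemma vecNorm_mulVec_le (hP : IsUnit P) (M : Matrix (Fin q) (Fin q) ℝ) (v : Fin q → ℝ) :
    vecNorm P r (M *ᵥ v) ≤ lpMatrixNorm r (conj P M) * vecNorm P r v := by
  have h := norm_toLp_mulVec_le r (conj P M) (P⁻¹ *ᵥ fun i => (v i : ℂ))
  rw [conj, Matrix.mulVec_mulVec, Matrix.mul_assoc, mul_inv_cancel_of_isUnit hP, Matrix.mul_one,
    ← Matrix.mulVec_mulVec] at h
  refine le_trans (le_of_eq ?_) h
  rw [vecNorm]
  congr 3
  ext i
  simp [Matrix.mulVec, dotProduct]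

lemma lpMatrixNorm_conj_jump_le (hP : IsUnit P) (z : ℝ) :
    lpMatrixNorm r (conj P (1 + z ^ 2 • Matrix.vecMulVec θ.e θ.a)) ≤
      1 + lpMatrixNorm r (P⁻¹ * θ.eac * P) * z ^ 2 := by
  have h : conj P (1 + z ^ 2 • Matrix.vecMulVec θ.e θ.a) =
      1 + ((z ^ 2 : ℝ) : ℂ) • (P⁻¹ * θ.eac * P) := by
    have h1 : (1 + z ^ 2 • Matrix.vecMulVec θ.e θ.a : Matrix (Fin q) (Fin q) ℝ).map
        (algebraMap ℝ ℂ) = 1 + ((z ^ 2 : ℝ) : ℂ) • θ.eac := by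
      ext i j
      by_cases hij : i = j <;> simp [Params.eac, hij]
    rw [conj, h1, Matrix.mul_add, Matrix.add_mul, Matrix.mul_one, inv_mul_cancel_of_isUnit hP,
      Matrix.mul_smul, Matrix.smul_mul]
  rw [h]
  exact lpMatrixNorm_one_add_smul_le r _ (sq_nonneg z)

lemma re_le_eta {z : ℂ} (hz : z ∈ spectrum ℂ θ.Bc) : z.re ≤ θ.eta :=
  le_csSup ((Matrix.finite_spectrum θ.Bc).image _).bddAbove (mem_image_of_mem _ hz)

section

attribute [local instance] Matrix.linftyOpNormedRing Matrix.linftyOpNormedAlgebra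

lemma map_exp_algebraMap (M : Matrix (Fin q) (Fin q) ℝ) :
    (NormedSpace.exp M).map (algebraMap ℝ ℂ) = NormedSpace.exp (M.map (algebraMap ℝ ℂ)) :=
  NormedSpace.map_exp (algebraMap ℝ ℂ).mapMatrix
    (continuous_id.matrix_map Complex.continuous_ofReal) M

end

/-- In the coordinates that diagonalize `B` the flow is the diagonal matrix of the `exp (d λᵢ)`. -/
lemma lpMatrixNorm_conj_exp_le (hP : IsUnit P) (hD : (P⁻¹ * θ.Bc * P).IsDiag) {d : ℝ}
    (hd : 0 ≤ d) :
    lpMatrixNorm r (conj P (NormedSpace.exp (d • θ.B))) ≤ Real.exp (θ.eta * d) := by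
  set D := P⁻¹ * θ.Bc * P with hDdef
  have hspec (i : Fin q) : D i i ∈ spectrum ℂ θ.Bc := by
    have h1 : spectrum ℂ D = spectrum ℂ θ.Bc := by
      obtain ⟨u, rfl⟩ := hP
      rw [hDdef, ← Matrix.coe_units_inv]
      exact spectrum.units_conjugate'
    rw [← h1]
    have h2 := hD.diagonal_diag
    rw [← h2, spectrum_diagonal]
    exact ⟨i, by simp [Matrix.diag]⟩
  have hmap : (NormedSpace.exp (d • θ.B)).map (algebraMap ℝ ℂ) =
      NormedSpace.exp ((d : ℂ) • θ.Bc) := by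
    rw [map_exp_algebraMap]
    congr 1
    ext i j
    simp [Params.Bc]
  have hexp : conj P (NormedSpace.exp (d • θ.B)) =
      Matrix.diagonal (NormedSpace.exp ((d : ℂ) • Matrix.diag D)) := by
    rw [conj, hmap, ← Matrix.exp_conj' _ _ hP, ← Matrix.exp_diagonal, Matrix.diagonal_smul,
      hD.diagonal_diag, hDdef, Matrix.mul_smul, Matrix.smul_mul]
  rw [hexp]
  refine lpMatrixNorm_diagonal_le r (Real.exp_pos _).le fun i => ?_
  rw [Pi.coe_exp, ← Complex.exp_eq_exp_ℂ, Complex.norm_exp, Real.exp_le_exp, Pi.smul_apply,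
    smul_eq_mul, Complex.re_ofReal_mul, mul_comm]
  exact mul_le_mul_of_nonneg_right (re_le_eta θ (hspec i)) hd

end Adapted

/-! ### Moments of the random coefficients -/

section Bounds

variable {Ω : Type*} [MeasurableSpace Ω] {μ : Measure Ω} {τ : ℝ} {p q : ℕ} (θ : Params p q)
  {P : Matrix (Fin q) (Fin q) ℂ} (r : ℝ≥0∞) [Fact (1 ≤ r)] {X : SimpleCompoundPoisson μ τ}
  {s t : ℝ} {ω : Ω}

lemma lpMatrixNorm_conj_jumpsJ_le (hP : IsUnit P) (hD : (P⁻¹ * θ.Bc * P).IsDiag) (hs : 0 ≤ s)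
    (hst : s ≤ t) {k : ℕ} (hk : k ≤ X.N t ω - X.N s ω) :
    lpMatrixNorm r (conj P (jumpsJ θ X s ω k)) ≤ Real.exp (θ.eta * (updateTime X s ω k - s)) *
      ∏ i ∈ Finset.range k, (1 + lpMatrixNorm r (P⁻¹ * θ.eac * P) * jumpAfter X s ω i ^ 2) := by
  have hc := lpMatrixNorm_nonneg r (P⁻¹ * θ.eac * P)
  induction k with
  | zero =>
    rw [updateTime_zero hs, sub_self, mul_zero, Real.exp_zero, Finset.prod_range_zero, mul_one]
    refine lpMatrixNorm_le r zero_le_one fun x => ?_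
    simp [jumpsJ, conj, Matrix.map_one, inv_mul_cancel_of_isUnit hP]
  | succ k ih =>
    have hd : 0 ≤ updateTime X s ω (k + 1) - updateTime X s ω k :=
      sub_nonneg.2 (updateTime_mono hs hst hk)
    have hstep : stepMatrix θ X s (X.N s ω + k) ω =
        (1 + jumpAfter X s ω k ^ 2 • Matrix.vecMulVec θ.e θ.a) *
          NormedSpace.exp ((updateTime X s ω (k + 1) - updateTime X s ω k) • θ.B) := by
      rw [(updateTime_succ hs hst hk).1]; rfl
    rw [jumpsJ, conj_mul hP, hstep, conj_mul hP, Finset.prod_range_succ]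
    calc _ ≤ (lpMatrixNorm r (conj P (1 + jumpAfter X s ω k ^ 2 • Matrix.vecMulVec θ.e θ.a)) *
            lpMatrixNorm r (conj P (NormedSpace.exp
              ((updateTime X s ω (k + 1) - updateTime X s ω k) • θ.B)))) *
            lpMatrixNorm r (conj P (jumpsJ θ X s ω k)) :=
          (lpMatrixNorm_mul_le r _ _).trans (mul_le_mul_of_nonneg_right
            (lpMatrixNorm_mul_le r _ _) (lpMatrixNorm_nonneg r _))
      _ ≤ ((1 + lpMatrixNorm r (P⁻¹ * θ.eac * P) * jumpAfter X s ω k ^ 2) *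
            Real.exp (θ.eta * (updateTime X s ω (k + 1) - updateTime X s ω k))) *
            (Real.exp (θ.eta * (updateTime X s ω k - s)) * ∏ i ∈ Finset.range k,
              (1 + lpMatrixNorm r (P⁻¹ * θ.eac * P) * jumpAfter X s ω i ^ 2)) := by
          have h1 := lpMatrixNorm_conj_jump_le θ r hP (jumpAfter X s ω k)
          have h2 := lpMatrixNorm_conj_exp_le θ r hP hD hd
          have h3 := ih (Nat.le_of_succ_le hk)
          exact mul_le_mul (mul_le_mul h1 h2 (lpMatrixNorm_nonneg r _) (by positivity)) h3
            (lpMatrixNorm_nonneg r _) (by positivity)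
      _ = _ := by
          rw [show θ.eta * (updateTime X s ω (k + 1) - s) =
            θ.eta * (updateTime X s ω (k + 1) - updateTime X s ω k) +
              θ.eta * (updateTime X s ω k - s) by ring, Real.exp_add]
          ring

lemma max_arrival_eq_updateTime (hs : 0 ≤ s) (hst : s ≤ t) :
    max s (X.arrival (X.N t ω) ω) = updateTime X s ω (X.N t ω - X.N s ω) := by
  rw [updateTime, Nat.add_sub_cancel' (X.N_le hs hst ω)]

lemma lpMatrixNorm_conj_J_le (hP : IsUnit P) (hD : (P⁻¹ * θ.Bc * P).IsDiag) (hs : 0 ≤ s)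
    (hst : s ≤ t) :
    lpMatrixNorm r (conj P (J θ X s t ω)) ≤ Real.exp (θ.eta * (t - s)) *
      ∏ i ∈ Finset.range (X.N t ω - X.N s ω),
        (1 + lpMatrixNorm r (P⁻¹ * θ.eac * P) * jumpAfter X s ω i ^ 2) := by
  rw [J, max_arrival_eq_updateTime hs hst, conj_mul hP]
  set u := updateTime X s ω (X.N t ω - X.N s ω)
  have hu : 0 ≤ t - u := sub_nonneg.2 (updateTime_le hs hst le_rfl)
  refine (lpMatrixNorm_mul_le r _ _).trans ((mul_le_mul (lpMatrixNorm_conj_exp_le θ r hP hD hu)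
    (lpMatrixNorm_conj_jumpsJ_le θ r hP hD hs hst le_rfl) (lpMatrixNorm_nonneg r _)
    (Real.exp_pos _).le).trans (le_of_eq ?_))
  rw [← mul_assoc, ← Real.exp_add]
  congr 2
  ring

/-- The constant that controls the effect of a jump on the adapted norm of the state. -/
noncomputable def jumpConst (θ : Params p q) (P : Matrix (Fin q) (Fin q) ℂ) (r : ℝ≥0∞)
    [Fact (1 ≤ r)] : ℝ :=
  lpMatrixNorm r (P⁻¹ * θ.eac * P) + θ.α 0 * vecNorm P r θ.e

lemma jumpConst_nonneg : 0 ≤ jumpConst θ P r :=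
  add_nonneg (lpMatrixNorm_nonneg r _) (mul_nonneg θ.α_zero_pos.le (vecNorm_nonneg P r _))

lemma one_add_vecNorm_jumpsK_le (hP : IsUnit P) (hD : (P⁻¹ * θ.Bc * P).IsDiag) (hη : θ.eta ≤ 0)
    (hs : 0 ≤ s) (hst : s ≤ t) {k : ℕ} (hk : k ≤ X.N t ω - X.N s ω) :
    1 + vecNorm P r (jumpsK θ X s ω k) ≤
      ∏ i ∈ Finset.range k, (1 + jumpConst θ P r * jumpAfter X s ω i ^ 2) := by
  induction k with
  | zero => simp [jumpsK, vecNorm_zero]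
  | succ k ih =>
    have hd : 0 ≤ updateTime X s ω (k + 1) - updateTime X s ω k :=
      sub_nonneg.2 (updateTime_mono hs hst hk)
    have hstep : stepMatrix θ X s (X.N s ω + k) ω =
        (1 + jumpAfter X s ω k ^ 2 • Matrix.vecMulVec θ.e θ.a) *
          NormedSpace.exp ((updateTime X s ω (k + 1) - updateTime X s ω k) • θ.B) := by
      rw [(updateTime_succ hs hst hk).1]; rfl
    set z := jumpAfter X s ω k with hz
    set c := lpMatrixNorm r (P⁻¹ * θ.eac * P) with hc
    have hc0 : 0 ≤ c := lpMatrixNorm_nonneg r _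
    have hα := θ.α_zero_pos
    set n := vecNorm P r (jumpsK θ X s ω k) with hn
    have hn0 : 0 ≤ n := vecNorm_nonneg P r _
    have he0 := vecNorm_nonneg P r θ.e
    have h1 : lpMatrixNorm r (conj P (stepMatrix θ X s (X.N s ω + k) ω)) ≤ 1 + c * z ^ 2 := by
      rw [hstep, conj_mul hP]
      refine (lpMatrixNorm_mul_le r _ _).trans ?_
      have h2 : lpMatrixNorm r (conj P (NormedSpace.exp
          ((updateTime X s ω (k + 1) - updateTime X s ω k) • θ.B))) ≤ 1 :=
        (lpMatrixNorm_conj_exp_le θ r hP hD hd).trans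
          (Real.exp_le_one_iff.2 (mul_nonpos_of_nonpos_of_nonneg hη hd))
      calc _ ≤ (1 + c * z ^ 2) * 1 := mul_le_mul (lpMatrixNorm_conj_jump_le θ r hP z) h2
            (lpMatrixNorm_nonneg r _) (by positivity)
        _ = _ := mul_one _
    have h2 : vecNorm P r (jumpsK θ X s ω (k + 1)) ≤
        (1 + c * z ^ 2) * n + θ.α 0 * z ^ 2 * vecNorm P r θ.e := by
      rw [jumpsK]
      refine (vecNorm_add_le P r _ _).trans (add_le_add ((vecNorm_mulVec_le r hP _ _).trans
        (mul_le_mul_of_nonneg_right h1 hn0)) ?_)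
      rw [vecNorm_smul, abs_of_nonneg (by positivity)]
      rfl
    rw [Finset.prod_range_succ]
    calc 1 + vecNorm P r (jumpsK θ X s ω (k + 1))
        ≤ 1 + ((1 + c * z ^ 2) * n + θ.α 0 * z ^ 2 * vecNorm P r θ.e) := by gcongr
      _ ≤ (1 + n) * (1 + jumpConst θ P r * z ^ 2) := by
          have : 0 ≤ c * z ^ 2 + n * (θ.α 0 * vecNorm P r θ.e) * z ^ 2 := by positivity
          rw [jumpConst, ← hc]
          linarith
      _ ≤ _ := mul_le_mul_of_nonneg_right (ih (by omega))
          (by have := jumpConst_nonneg θ (P := P) r; positivity)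

lemma one_add_vecNorm_K_le (hP : IsUnit P) (hD : (P⁻¹ * θ.Bc * P).IsDiag) (hη : θ.eta ≤ 0)
    (hs : 0 ≤ s) (hst : s ≤ t) :
    1 + vecNorm P r (K θ X s t ω) ≤ ∏ i ∈ Finset.range (X.N t ω - X.N s ω),
      (1 + jumpConst θ P r * jumpAfter X s ω i ^ 2) := by
  refine le_trans ?_ (one_add_vecNorm_jumpsK_le θ r hP hD hη hs hst le_rfl)
  rw [K, max_arrival_eq_updateTime hs hst]
  set u := updateTime X s ω (X.N t ω - X.N s ω)
  have hu : 0 ≤ t - u := sub_nonneg.2 (updateTime_le hs hst le_rfl)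
  have h := (lpMatrixNorm_conj_exp_le θ r hP hD hu).trans
    (Real.exp_le_one_iff.2 (mul_nonpos_of_nonpos_of_nonneg hη hu))
  gcongr
  exact (vecNorm_mulVec_le r hP _ _).trans
    (mul_le_of_le_one_left (vecNorm_nonneg P r _) h)

end Bounds

section Moments

variable {Ω : Type*} [MeasurableSpace Ω] {μ : Measure Ω} {τ : ℝ}
  (X : SimpleCompoundPoisson μ τ)

lemma SimpleCompoundPoisson.isProbabilityMeasure_F [IsProbabilityMeasure μ] (j : Fin X.l) :
    IsProbabilityMeasure (X.F j) := by
  rw [← X.Z_law 1 j le_rfl]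
  exact Measure.isProbabilityMeasure_map (X.measurable_Z 1 j le_rfl).aemeasurable

lemma SimpleCompoundPoisson.measurable_sum_jump {g : ℝ → ℝ} (hg : Measurable g) {t : ℝ}
    (ht : 0 ≤ t) : Measurable fun ω => ∑ n ∈ Finset.range (X.N t ω), g (X.jump (n + 1) ω) := by
  have h : Measurable fun x : ℕ × Ω => ∑ n ∈ Finset.range x.1, g (X.jump (n + 1) x.2) :=
    measurable_from_prod_countable_right fun k =>
      Finset.measurable_fun_sum (Finset.range k) fun n _ => hg.comp (X.measurable_jump n)
  exact Measurable.comp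
    (g := fun x : ℕ × Ω => ∑ n ∈ Finset.range x.1, g (X.jump (n + 1) x.2))
    (f := fun ω => (X.N t ω, ω)) h ((X.measurable_N t ht).prodMk measurable_id)

/-- The mean of a sum over the jumps in `(s, t]`, a compound Poisson sum whose marks have laws among
the `F j`. -/
lemma integrable_sum_jumpAfter [IsProbabilityMeasure μ] {g : ℝ → ℝ} (hg : Measurable g)
    (hg0 : g 0 = 0) (hnn : ∀ z, 0 ≤ g z)
    (hint : ∀ j, Integrable g (X.F j)) {m : ℝ} (hm0 : 0 ≤ m) (hm : ∀ j, ∫ z, g z ∂(X.F j) ≤ m)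
    {s t : ℝ} (hs : 0 ≤ s) (hst : s ≤ t) :
    Integrable (fun ω => ∑ k ∈ Finset.range (X.N t ω - X.N s ω), g (jumpAfter X s ω k)) μ ∧
      ∫ ω, ∑ k ∈ Finset.range (X.N t ω - X.N s ω), g (jumpAfter X s ω k) ∂μ ≤
        m * (X.cumRate t - X.cumRate s) := by
  set G : Ω → ℝ := fun ω => ∑ k ∈ Finset.range (X.N t ω - X.N s ω), g (jumpAfter X s ω k)
  have hG0 (ω) : 0 ≤ G ω := Finset.sum_nonneg fun _ _ => hnn _
  have hGm : Measurable G := by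
    have h : G = fun ω => ∑ n ∈ Finset.range (X.N t ω), g (X.jump (n + 1) ω) -
        ∑ n ∈ Finset.range (X.N s ω), g (X.jump (n + 1) ω) := by
      funext ω
      rw [← Finset.sum_range_add_sum_Ico _ (X.N_le hs hst ω), add_sub_cancel_left,
        Finset.sum_Ico_eq_sum_range]
      rfl
    rw [h]
    exact (X.measurable_sum_jump hg (hs.trans hst)).sub (X.measurable_sum_jump hg hs)
  have hΛ : 0 ≤ X.cumRate t - X.cumRate s := sub_nonneg.2 (X.cumRate_mono hs hst)
  have hbound : ∫⁻ ω, ENNReal.ofReal (G ω) ∂μ ≤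
      ENNReal.ofReal (m * (X.cumRate t - X.cumRate s)) := by
    rw [ENNReal.ofReal_mul hm0]
    refine le_trans (le_of_eq ?_) (X.lintegral_sum_jump_le (g := fun z => ENNReal.ofReal (g z))
      (ENNReal.measurable_ofReal.comp hg) (by simp [hg0]) (M := ENNReal.ofReal m) (fun j => ?_) hs hst)
    · exact lintegral_congr fun ω => ENNReal.ofReal_sum_of_nonneg fun _ _ => hnn _
    · rw [← ofReal_integral_eq_lintegral_ofReal (hint j) (Eventually.of_forall hnn)]
      exact ENNReal.ofReal_le_ofReal (hm j)
  have hGi : Integrable G μ := by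
    refine ⟨hGm.aestronglyMeasurable, ?_⟩
    rw [hasFiniteIntegral_iff_ofReal (Eventually.of_forall hG0)]
    exact hbound.trans_lt ENNReal.ofReal_lt_top
  refine ⟨hGi, ?_⟩
  rw [← ofReal_integral_eq_lintegral_ofReal hGi (Eventually.of_forall hG0)] at hbound
  exact (ENNReal.ofReal_le_ofReal_iff (mul_nonneg hm0 hΛ)).1 hbound

lemma log_one_add_mul_sq_le {c : ℝ} (hc : 0 ≤ c) (z : ℝ) : Real.log (1 + c * z ^ 2) ≤ c * z ^ 2 := by
  have := Real.log_le_sub_one_of_pos (x := 1 + c * z ^ 2) (by positivity)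
  linarith

lemma log_one_add_mul_sq_nonneg {c : ℝ} (hc : 0 ≤ c) (z : ℝ) : 0 ≤ Real.log (1 + c * z ^ 2) :=
  Real.log_nonneg (by linarith [mul_nonneg hc (sq_nonneg z)])

lemma measurable_log_one_add_mul_sq (c : ℝ) : Measurable fun z : ℝ => Real.log (1 + c * z ^ 2) :=
  Real.measurable_log.comp (by fun_prop)

lemma integrable_log_one_add_mul_sq {c : ℝ} (hc : 0 ≤ c) (j : Fin X.l) :
    Integrable (fun z : ℝ => Real.log (1 + c * z ^ 2)) (X.F j) := by
  refine ((X.F_sq_integrable j).const_mul c).mono'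
    (measurable_log_one_add_mul_sq c).aestronglyMeasurable (Eventually.of_forall fun z => ?_)
  rw [Real.norm_of_nonneg (log_one_add_mul_sq_nonneg hc z)]
  exact log_one_add_mul_sq_le hc z

/-- The sum of `log (1 + c z²)` over the jumps in `(s, t]`. -/
lemma integrable_log_prod_jumpAfter [IsProbabilityMeasure μ] {c : ℝ} (hc : 0 ≤ c) {m : ℝ}
    (hm : ∀ j, ∫ z, Real.log (1 + c * z ^ 2) ∂(X.F j) ≤ m) {s t : ℝ} (hs : 0 ≤ s) (hst : s ≤ t) :
    Integrable (fun ω => Real.log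
        (∏ k ∈ Finset.range (X.N t ω - X.N s ω), (1 + c * jumpAfter X s ω k ^ 2))) μ ∧
      ∫ ω, Real.log (∏ k ∈ Finset.range (X.N t ω - X.N s ω), (1 + c * jumpAfter X s ω k ^ 2)) ∂μ ≤
        m * (X.cumRate t - X.cumRate s) := by
  have hm0 : 0 ≤ m :=
    (integral_nonneg fun z => log_one_add_mul_sq_nonneg hc z).trans (hm ⟨0, X.l_pos⟩)
  have h (ω) : Real.log (∏ k ∈ Finset.range (X.N t ω - X.N s ω), (1 + c * jumpAfter X s ω k ^ 2)) =
      ∑ k ∈ Finset.range (X.N t ω - X.N s ω), Real.log (1 + c * jumpAfter X s ω k ^ 2) :=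
    Real.log_prod fun k _ => by positivity
  simp_rw [h]
  exact integrable_sum_jumpAfter X (measurable_log_one_add_mul_sq c) (by simp)
    (log_one_add_mul_sq_nonneg hc) (integrable_log_one_add_mul_sq X hc) hm0 hm hs hst

variable {p q : ℕ} {θ : Params p q} {P : Matrix (Fin q) (Fin q) ℂ} {r : ℝ≥0∞} [Fact (1 ≤ r)]
  {X}

/-- The log-moment condition at the left end points of the cells, with the intensity cancelled. -/
lemma LogMomentCondition.exists_bound [IsProbabilityMeasure μ]
    (h : LogMomentCondition θ X P r) :
    ∃ m, (∀ j, ∫ z, Real.log (1 + lpMatrixNorm r (P⁻¹ * θ.eac * P) * z ^ 2) ∂(X.F j) ≤ m) ∧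
      m * X.cumRate τ < -(θ.eta * τ) := by
  set c := lpMatrixNorm r (P⁻¹ * θ.eac * P) with hc
  have hc0 : 0 ≤ c := lpMatrixNorm_nonneg r _
  have hj (j : Fin X.l) :
      (∫ z, Real.log (1 + c * z ^ 2) ∂(X.F j)) * X.cumRate τ < -(θ.eta * τ) := by
    have hprob := X.isProbabilityMeasure_F j
    have h0 := X.node_nonneg j
    have hmem : X.node j ∈ X.cells j :=
      mem_iUnion.2 ⟨0, by simp, by simpa using X.node_strictMono (Nat.lt_succ_self j)⟩
    have hlt : X.node j < τ := (X.node_strictMono j.2).trans_eq X.node_l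
    have hν : X.levyMeasure (X.node j) = ENNReal.ofReal (X.rate (X.node j)) • X.F j := by
      rw [SimpleCompoundPoisson.levyMeasure, Finset.sum_eq_single j, if_pos hmem]
      · exact fun j' _ hne => if_neg fun hj' => hne (X.cells_disjoint hj' hmem)
      · exact fun h => absurd (Finset.mem_univ j) h
    have hcond := h (X.node j) ⟨h0, hlt⟩
    have hrate := X.rate_nonneg _ h0
    rw [hν, integral_smul_measure, X.cumRate_add_period h0, measureReal_ennreal_smul_apply,
      ENNReal.toReal_ofReal hrate, probReal_univ, smul_eq_mul, mul_one, ← hc] at hcond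
    set I := ∫ z, Real.log (1 + c * z ^ 2) ∂(X.F j)
    have hI : 0 ≤ I := integral_nonneg fun z => log_one_add_mul_sq_nonneg hc0 z
    have hΛ0 : 0 ≤ X.cumRate τ := by
      have := X.cumRate_mono le_rfl X.period_pos.le
      rwa [show X.cumRate 0 = 0 by simp [SimpleCompoundPoisson.cumRate]] at this
    -- if the intensity or its mean vanished, the condition would read `_ < 0` with `0 ≤ _`
    rcases eq_or_lt_of_le hrate with hr0 | hr0
    · simp [← hr0] at hcond
    rcases eq_or_lt_of_le hΛ0 with hΛ | hΛ
    · rw [← hΛ] at hcond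
      have : 0 ≤ X.rate (X.node j) * I := by positivity
      simp at hcond
      linarith
    · have h1 : X.rate (X.node j) * I < X.rate (X.node j) * (-(θ.eta * τ) / X.cumRate τ) := by
        refine hcond.trans_eq ?_
        field_simp
      exact (lt_div_iff₀ hΛ).1 (lt_of_mul_lt_mul_left h1 hr0.le)
  have : Nonempty (Fin X.l) := ⟨⟨0, X.l_pos⟩⟩
  obtain ⟨j, hmax⟩ := Finite.exists_max fun j => ∫ z, Real.log (1 + c * z ^ 2) ∂(X.F j)
  exact ⟨_, hmax, hj j⟩

end Moments

/-! ### Laws of the random coefficients and the stationary law -/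

section Coefficients

variable {Ω : Type*} [MeasurableSpace Ω] {μ : Measure Ω} {τ : ℝ} {p q : ℕ} (θ : Params p q)
  (X : SimpleCompoundPoisson μ τ)

lemma ae_coeffPath_block_eq {s t : ℝ} (hs : 0 ≤ s) (hst : s ≤ t) (k : ℕ) :
    (fun ω => coeffPath θ (t - s).toNNReal (X.block (s.toNNReal + k * X.period) ω)) =ᵐ[μ]
      coeffPair θ X (s + k * τ) (t + k * τ) := by
  filter_upwards [X.ae_unitJumps] with ω hω
  rw [coeffPath_block θ hω]
  congr 1
  · push_cast
    rw [Real.coe_toNNReal s hs, X.coe_period]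
  · push_cast
    rw [Real.coe_toNNReal s hs, Real.coe_toNNReal _ (sub_nonneg.2 hst), X.coe_period]
    ring

variable [IsProbabilityMeasure μ]

theorem identDistrib_coeffPair {s t : ℝ} (hs : 0 ≤ s) (hst : s ≤ t) (k : ℕ) :
    IdentDistrib (coeffPair θ X (s + k * τ) (t + k * τ)) (coeffPair θ X s t) μ μ := by
  have hm (k : ℕ) : Measurable fun ω =>
      coeffPath θ (t - s).toNNReal (X.block (s.toNNReal + k * X.period) ω) :=
    (measurable_coeffPath θ _).comp (X.measurable_block _)
  have h0 := ae_coeffPath_block_eq θ X hs hst 0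
  simp only [Nat.cast_zero, zero_mul, add_zero] at h0
  have hk := ae_coeffPath_block_eq θ X hs hst k
  have hm0 := hm 0
  simp only [Nat.cast_zero, zero_mul, add_zero] at hm0
  refine ⟨⟨_, hm k, hk.symm⟩, ⟨_, hm0, h0.symm⟩, ?_⟩
  rw [← Measure.map_congr hk, ← Measure.map_congr h0]
  have h (a : ℝ≥0) : μ.map (fun ω => coeffPath θ (t - s).toNNReal (X.block a ω)) =
      (μ.map (X.block a)).map (coeffPath θ (t - s).toNNReal) :=
    (Measure.map_map (measurable_coeffPath θ _) (X.measurable_block _)).symm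
  rw [h, h, X.map_block_add_nsmul]

lemma iIndepFun_coeffPath_block (a : ℝ≥0) {h : ℝ≥0} (hh : h ≤ X.period) :
    iIndepFun (fun (k : ℕ) ω => coeffPath θ h (X.block (a + k * X.period) ω)) μ := by
  have := (X.iIndepFun_block a hh).comp (fun _ => coeffPath θ h) fun _ => measurable_coeffPath θ h
  refine this.congr fun k => .of_eq (funext fun ω => ?_)
  exact coeffPath_min θ h _

theorem iIndepFun_coeffPair {s t : ℝ} (hs : 0 ≤ s) (hst : s ≤ t) (h : t - s ≤ τ) :
    iIndepFun (fun k : ℕ => coeffPair θ X (s + k * τ) (t + k * τ)) μ := by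
  have hh : (t - s).toNNReal ≤ X.period := by
    rw [← NNReal.coe_le_coe, Real.coe_toNNReal _ (sub_nonneg.2 hst), X.coe_period]
    exact h
  exact (iIndepFun_coeffPath_block θ X s.toNNReal hh).congr
    fun k => ae_coeffPath_block_eq θ X hs hst k

end Coefficients

section Stationary

variable {Ω : Type*} [MeasurableSpace Ω] {μ : Measure Ω} {τ : ℝ} {p q : ℕ} {θ : Params p q}
  {P : Matrix (Fin q) (Fin q) ℂ} {r : ℝ≥0∞} [Fact (1 ≤ r)]
  {X : SimpleCompoundPoisson μ τ}

/-- The affine map with the given coefficients. -/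
def affineAct (c : (Fin q → Fin q → ℝ) × (Fin q → ℝ)) (x : Fin q → ℝ) : Fin q → ℝ :=
  Matrix.of c.1 *ᵥ x + c.2

lemma continuous_uncurry_affineAct : Continuous (Function.uncurry (affineAct (q := q))) := by
  have h : Continuous fun y : ((Fin q → Fin q → ℝ) × (Fin q → ℝ)) × (Fin q → ℝ) =>
      (Matrix.of y.1.1 : Matrix (Fin q) (Fin q) ℝ) := continuous_fst.fst
  exact (h.matrix_mulVec continuous_snd).add continuous_fst.snd

lemma affineAct_coeffPair (s t : ℝ) (ω : Ω) (x : Fin q → ℝ) :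
    affineAct (coeffPair θ X s t ω) x = J θ X s t ω *ᵥ x + K θ X s t ω := rfl

lemma continuous_lpMatrixNorm_conj :
    Continuous fun M : Matrix (Fin q) (Fin q) ℝ => lpMatrixNorm r (conj P M) := by
  have h1 : Continuous fun M : Matrix (Fin q) (Fin q) ℝ => conj P M :=
    (continuous_const.matrix_mul (continuous_id.matrix_map Complex.continuous_ofReal)).matrix_mul
      continuous_const
  have h2 : Continuous fun C : Matrix (Fin q) (Fin q) ℂ =>
      LinearMap.toContinuousLinearMap (Matrix.toLpLin r r C) :=
    LinearMap.continuous_of_finiteDimensional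
      ((LinearMap.toContinuousLinearMap : (WithLp r (Fin q → ℂ) →ₗ[ℂ] WithLp r (Fin q → ℂ)) ≃ₗ[ℂ]
        (WithLp r (Fin q → ℂ) →L[ℂ] WithLp r (Fin q → ℂ))).toLinearMap ∘ₗ
        (Matrix.toLpLin (R := ℂ) (m := Fin q) (n := Fin q) r r).toLinearMap)
  exact continuous_norm.comp (h2.comp h1)

variable [IsProbabilityMeasure μ]

/-- Over one period the random affine map contracts on average in the adapted norm. -/
theorem exists_stationary_law_coeff (hη : θ.eta ≤ 0) (hP : IsUnit P)
    (hD : (P⁻¹ * θ.Bc * P).IsDiag) (hlog : LogMomentCondition θ X P r) {t : ℝ} (ht : 0 ≤ t) :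
    ∃ π : ProbabilityMeasure (Fin q → ℝ), SolvesRecurrence θ X t (π : Measure (Fin q → ℝ)) ∧
      (∀ π' : ProbabilityMeasure (Fin q → ℝ),
        SolvesRecurrence θ X t (π' : Measure (Fin q → ℝ)) → π' = π) ∧
      ∀ Y : Ω → Fin q → ℝ, Measurable Y → TendstoInDistribution
        (fun m ω => forwardIter affineAct (fun i => coeffPair θ X (t + i * τ) (t + τ + i * τ) ω) m
          (Y ω)) atTop id (fun _ => μ) (π : Measure (Fin q → ℝ)) := by
  have hτ := X.period_pos
  have htτ : t ≤ t + τ := by linarith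
  have hper : (t + τ - t).toNNReal = X.period := by
    rw [add_sub_cancel_left]
    exact NNReal.coe_injective (by rw [Real.coe_toNNReal _ hτ.le, X.coe_period])
  set C : ℕ → Ω → (Fin q → Fin q → ℝ) × (Fin q → ℝ) := fun k ω =>
    coeffPath θ X.period (X.block (t.toNNReal + k * X.period) ω) with hC
  have hCm (k) : Measurable (C k) := (measurable_coeffPath θ _).comp (X.measurable_block _)
  have hCae (k : ℕ) : C k =ᵐ[μ] coeffPair θ X (t + k * τ) (t + τ + k * τ) := by
    have := ae_coeffPath_block_eq θ X ht htτ k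
    rwa [hper] at this
  have hC0 : C 0 =ᵐ[μ] coeffPair θ X t (t + τ) := by simpa using hCae 0
  have hCi : iIndepFun C μ := iIndepFun_coeffPath_block θ X _ le_rfl
  have hCid (k) : μ.map (C k) = μ.map (C 0) := by
    have h (k : ℕ) : μ.map (C k) =
        (μ.map (X.block (t.toNNReal + k * X.period))).map (coeffPath θ X.period) :=
      (Measure.map_map (measurable_coeffPath θ _) (X.measurable_block _)).symm
    rw [h, h, X.map_block_add_nsmul, X.map_block_add_nsmul]
  set ℓ : (Fin q → Fin q → ℝ) × (Fin q → ℝ) → ℝ := fun c =>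
    max (lpMatrixNorm r (conj P (Matrix.of c.1))) (Real.exp (θ.eta * τ)) with hℓ
  have hℓpos (c) : 0 < ℓ c := lt_max_of_lt_right (Real.exp_pos _)
  have hℓm : Measurable ℓ := by
    have h1 : Continuous fun c : (Fin q → Fin q → ℝ) × (Fin q → ℝ) =>
        lpMatrixNorm r (conj P (Matrix.of c.1)) :=
      (continuous_lpMatrixNorm_conj (P := P) (r := r)).comp
        (g := fun M : Matrix (Fin q) (Fin q) ℝ => lpMatrixNorm r (conj P M))
        (f := fun c : (Fin q → Fin q → ℝ) × (Fin q → ℝ) => Matrix.of c.1) continuous_fst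
    exact (h1.max continuous_const).measurable
  obtain ⟨κ, hκ0, hκ⟩ := exists_norm_le_mul_vecNorm r hP
  have hlip (c) (x y : Fin q → ℝ) : vecNorm P r (affineAct c x - affineAct c y) ≤
      ℓ c * vecNorm P r (x - y) := by
    rw [affineAct, affineAct, add_sub_add_right_eq_sub, ← Matrix.mulVec_sub]
    exact (vecNorm_mulVec_le r hP _ _).trans
      (mul_le_mul_of_nonneg_right (le_max_left _ _) (vecNorm_nonneg P r _))
  -- the logarithm of the contraction factor
  obtain ⟨m, hm, hmneg⟩ := hlog.exists_bound
  set c := lpMatrixNorm r (P⁻¹ * θ.eac * P) with hc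
  have hc0 : 0 ≤ c := lpMatrixNorm_nonneg r _
  obtain ⟨hLi, hLle⟩ := integrable_log_prod_jumpAfter X hc0 hm ht htτ
  set L : Ω → ℝ := fun ω => Real.log
    (∏ k ∈ Finset.range (X.N (t + τ) ω - X.N t ω), (1 + c * jumpAfter X t ω k ^ 2)) with hL
  have hprod (c : ℝ) (hc : 0 ≤ c) (ω : Ω) :
      1 ≤ ∏ k ∈ Finset.range (X.N (t + τ) ω - X.N t ω), (1 + c * jumpAfter X t ω k ^ 2) :=
    Finset.prod_induction _ (1 ≤ ·) (fun _ _ => one_le_mul_of_one_le_of_one_le) le_rfl fun k _ => by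
      have := mul_nonneg hc (sq_nonneg (jumpAfter X t ω k)); linarith
  have hL0 (ω) : 0 ≤ L ω := Real.log_nonneg (hprod c hc0 ω)
  have hbounds : ∀ᵐ ω ∂μ, θ.eta * τ ≤ Real.log (ℓ (C 0 ω)) ∧
      Real.log (ℓ (C 0 ω)) ≤ θ.eta * τ + L ω := by
    filter_upwards [hC0] with ω hω
    constructor
    · rw [Real.le_log_iff_exp_le (hℓpos _)]
      exact le_max_right _ _
    · rw [Real.log_le_iff_le_exp (hℓpos _), Real.exp_add, hL,
        Real.exp_log (zero_lt_one.trans_le (hprod c hc0 ω)), hω]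
      refine max_le ?_ (le_mul_of_one_le_right (Real.exp_pos _).le (hprod c hc0 ω))
      have := lpMatrixNorm_conj_J_le θ r (ω := ω) (X := X) hP hD ht htτ
      rwa [add_sub_cancel_left] at this
  have hint : Integrable (fun ω => Real.log (ℓ (C 0 ω))) μ := by
    refine ((integrable_const |θ.eta * τ|).add hLi).mono'
      (Real.measurable_log.comp (hℓm.comp (hCm 0))).aestronglyMeasurable ?_
    filter_upwards [hbounds] with ω hω
    rw [Real.norm_eq_abs, Pi.add_apply, abs_le]
    constructor <;> linarith [hω.1, hω.2, hL0 ω, neg_abs_le (θ.eta * τ), le_abs_self (θ.eta * τ)]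
  have hneg : ∫ ω, Real.log (ℓ (C 0 ω)) ∂μ < 0 := by
    calc ∫ ω, Real.log (ℓ (C 0 ω)) ∂μ ≤ ∫ ω, (θ.eta * τ + L ω) ∂μ :=
          integral_mono_ae hint ((integrable_const _).add hLi) (hbounds.mono fun ω h => h.2)
      _ = θ.eta * τ + ∫ ω, L ω ∂μ := by
          rw [integral_add (integrable_const _) hLi]; simp
      _ ≤ θ.eta * τ + m * X.cumRate τ := by
          rw [X.cumRate_add_period ht] at hLle
          gcongr
      _ < 0 := by linarith
  -- the size of the inhomogeneous part
  have hc'0 := jumpConst_nonneg θ (P := P) r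
  set c' := jumpConst θ P r with hc'
  obtain ⟨hL'i, -⟩ := integrable_log_prod_jumpAfter X hc'0
    (m := ∑ j, ∫ z, Real.log (1 + c' * z ^ 2) ∂(X.F j))
    (fun j => Finset.single_le_sum (f := fun j => ∫ z, Real.log (1 + c' * z ^ 2) ∂(X.F j))
      (fun j _ => integral_nonneg fun z => log_one_add_mul_sq_nonneg hc'0 z) (Finset.mem_univ j))
    ht htτ
  have hact0 : Continuous fun c => affineAct (q := q) c 0 :=
    continuous_uncurry_affineAct.comp (continuous_id.prodMk continuous_const)
  have hint' : Integrable (fun ω => Real.log (1 + vecNorm P r (affineAct (C 0 ω) 0))) μ := by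
    refine hL'i.mono' (Real.measurable_log.comp (measurable_const.add
      ((continuous_vecNorm P r).measurable.comp
        (hact0.measurable.comp (hCm 0))))).aestronglyMeasurable ?_
    filter_upwards [hC0] with ω hω
    have h0 := vecNorm_nonneg P r (affineAct (C 0 ω) 0)
    rw [Real.norm_of_nonneg (Real.log_nonneg (by linarith))]
    refine Real.log_le_log (by linarith) ?_
    rw [hω, affineAct_coeffPair, Matrix.mulVec_zero, zero_add]
    exact one_add_vecNorm_K_le θ r hP hD hη ht htτ
  obtain ⟨π, h1, h2, h3⟩ := exists_stationary_law (act := affineAct (q := q)) (X := C) (μ := μ)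
    continuous_uncurry_affineAct.measurable
    (fun c => continuous_uncurry_affineAct.comp (continuous_const.prodMk continuous_id))
    hCm hCi hCid hℓpos hℓm
    hκ0 hκ (vecNorm_nonneg P r) (continuous_vecNorm P r).measurable hlip hint hneg hint'
  have hsolve (π' : ProbabilityMeasure (Fin q → ℝ)) :
      ((π' : Measure (Fin q → ℝ)).prod μ).map (fun x => affineAct (C 0 x.2) x.1) =
      ((π' : Measure (Fin q → ℝ)).prod μ).map
        (fun x => J θ X t (t + τ) x.2 *ᵥ x.1 + K θ X t (t + τ) x.2) := by
    refine Measure.map_congr ?_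
    filter_upwards [Measure.quasiMeasurePreserving_snd.ae hC0] with x hx
    rw [hx, affineAct_coeffPair]
  refine ⟨π, ?_, fun π' h => h2 π' ?_, fun Y hY => ?_⟩
  · rw [SolvesRecurrence, ← hsolve, h1]
  · rwa [hsolve]
  · refine (h3 Y hY).congr (fun m => ?_) (.refl _ _)
    filter_upwards [ae_all_iff.2 hCae] with ω hω
    congr 1
    exact funext hω

end Stationary

/-! ### Periodic stationarity -/

section Stationarity

variable {Ω : Type*} [MeasurableSpace Ω] {μ : Measure Ω} [IsProbabilityMeasure μ] {τ : ℝ} {p q : ℕ}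
  {θ : Params p q} {X : SimpleCompoundPoisson μ τ} {Q : Ω → StieltjesFunction ℝ}
  {Y : ℝ → Ω → Fin q → ℝ}

/-- The state after time `h` when it is started from `x` and driven by the increments `w`. -/
noncomputable def stateAfter (θ : Params p q) (h : ℝ≥0) (y : (Fin q → ℝ) × (ℝ≥0 → ℝ)) :
    Fin q → ℝ :=
  affineAct (coeffPath θ h y.2) y.1

lemma measurable_stateAfter (h : ℝ≥0) : Measurable (stateAfter θ h) :=
  Measurable.comp (g := Function.uncurry affineAct)
    (f := fun y : (Fin q → ℝ) × (ℝ≥0 → ℝ) => (coeffPath θ h y.2, y.1))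
    continuous_uncurry_affineAct.measurable
    (((measurable_coeffPath θ h).comp measurable_snd).prodMk measurable_fst)

lemma ae_eq_stateAfter (hQ : IsQuadraticVariation μ X.S Q) (hY : IsStateProcess θ X Q Y) :
    ∀ᵐ ω ∂μ, ∀ a h : ℝ≥0, Y (a + h : ℝ≥0) ω = stateAfter θ h (Y a ω, X.block a ω) := by
  filter_upwards [hY.ae_eq_J_mulVec_add_K hQ, X.ae_unitJumps] with ω h1 h2 a h
  rw [h1 a (a + h : ℝ≥0) a.coe_nonneg (NNReal.coe_le_coe.2 le_self_add), stateAfter,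
    coeffPath_block θ h2, affineAct_coeffPair]

/-- The state at time `a` is a function of `Y 0` and of the jumps up to time `a`, hence independent
of the jumps after time `a`. -/
lemma indepFun_state_block (hQ : IsQuadraticVariation μ X.S Q) (hY : IsStateProcess θ X Q Y)
    (a : ℝ≥0) : IndepFun (Y a) (X.block a) μ := by
  have hcomp : Measurable fun ω (u : ℝ≥0) => X.comp (min u a : ℝ≥0) ω :=
    measurable_pi_lambda _ fun u => X.measurable_comp _
  have h0 : IndepFun (Y 0)
      (fun ω => ((fun u : ℝ≥0 => X.comp (min u a : ℝ≥0) ω), X.block a ω)) μ := by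
    let G : (ℝ≥0 → ℝ) → (ℝ≥0 → ℝ) × (ℝ≥0 → ℝ) := fun w =>
      (fun u => w (min u a) - X.drift (min u a : ℝ≥0),
        fun u => (w (a + u) - X.drift (a + u : ℝ≥0)) - (w a - X.drift a))
    have hG : Measurable G := by
      refine Measurable.prodMk (measurable_pi_lambda _ fun u => ?_)
        (measurable_pi_lambda _ fun u => ?_)
      · exact (measurable_pi_apply _).sub_const _
      · exact ((measurable_pi_apply _).sub_const _).sub ((measurable_pi_apply _).sub_const _)
    refine (hY.indep.comp measurable_id hG).congr .rfl (.of_eq ?_)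
    funext ω
    simp only [Function.comp_apply, G, X.S_eq, add_sub_cancel_left]
    rfl
  have h1 := IndepFun.prodMk_left_of_indepFun (hY.measurable 0 le_rfl) hcomp (X.measurable_block a)
    h0 (X.indepFun_comp_block a)
  refine (h1.comp (measurable_stateAfter (θ := θ) a) measurable_id).congr ?_ .rfl
  filter_upwards [ae_eq_stateAfter hQ hY] with ω hω
  have h2 := hω 0 a
  have h3 : (fun u : ℝ≥0 => X.comp (min u a : ℝ≥0) ω) = fun u => X.block 0 ω (min u a) := by
    funext u
    simp [SimpleCompoundPoisson.block, X.comp_zero]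
  rw [zero_add, NNReal.coe_zero] at h2
  rw [h2, Function.comp_apply, stateAfter, stateAfter, h3, coeffPath_min]

/-- Once the law at time `0` solves the recurrence, the law of the state at a multiple of the period,
jointly with the subsequent jumps, does not depend on the multiple. -/
lemma map_state_block (hQ : IsQuadraticVariation μ X.S Q) (hY : IsStateProcess θ X Q Y)
    (h : SolvesRecurrence θ X 0 (μ.map (Y 0))) (k : ℕ) :
    μ.map (fun ω => (Y (k * X.period : ℝ≥0) ω, X.block (k * X.period) ω)) =
      (μ.map (Y 0)).prod (μ.map (X.block 0)) := by
  have hYm (a : ℝ≥0) : Measurable (Y a) := hY.measurable _ a.coe_nonneg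
  have hjoint (k : ℕ) : μ.map (fun ω => (Y (k * X.period : ℝ≥0) ω, X.block (k * X.period) ω)) =
      (μ.map (Y (k * X.period : ℝ≥0))).prod (μ.map (X.block 0)) := by
    rw [(indepFun_state_block hQ hY _).map_prod_eq_prod_map_map (hYm _).aemeasurable
      (X.measurable_block _).aemeasurable]
    have := X.map_block_add_nsmul 0 k
    rw [zero_add] at this
    rw [this]
  rw [hjoint]
  congr 1
  induction k with
  | zero => simp
  | succ k ih =>
    have hnext : Y ((k + 1 : ℕ) * X.period : ℝ≥0) =ᵐ[μ]
        fun ω => stateAfter θ X.period (Y (k * X.period : ℝ≥0) ω, X.block (k * X.period) ω) := by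
      filter_upwards [ae_eq_stateAfter hQ hY] with ω hω
      rw [← hω]
      congr 2
      push_cast; ring
    have hpair : Measurable fun ω => (Y (k * X.period : ℝ≥0) ω, X.block (k * X.period) ω) :=
      (hYm _).prodMk (X.measurable_block _)
    have hP1 := Measure.isProbabilityMeasure_map (μ := μ) (hY.measurable 0 le_rfl).aemeasurable
    have hprod : (μ.map (Y 0)).prod (μ.map (X.block 0)) =
        ((μ.map (Y 0)).prod μ).map (Prod.map id (X.block 0)) := by
      rw [← Measure.map_prod_map _ _ measurable_id (X.measurable_block 0), Measure.map_id]
    rw [Measure.map_congr hnext, ← Function.comp_def (stateAfter θ X.period),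
      ← Measure.map_map (measurable_stateAfter _) hpair, hjoint, ih, hprod,
      Measure.map_map (measurable_stateAfter _) (measurable_id.prodMap (X.measurable_block 0))]
    conv_rhs => rw [← h]
    refine Measure.map_congr ?_
    filter_upwards [Measure.quasiMeasurePreserving_snd.ae X.ae_unitJumps] with x hx
    have h1 := coeffPath_block θ hx 0 X.period
    rw [zero_add, NNReal.coe_zero, X.coe_period] at h1
    rw [Function.comp_apply, stateAfter, Prod.map_snd, Prod.map_fst, h1, affineAct_coeffPair,
      zero_add]
    rfl

theorem strictlyPeriodicallyStationary_state (hQ : IsQuadraticVariation μ X.S Q)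
    (hY : IsStateProcess θ X Q Y) (h : SolvesRecurrence θ X 0 (μ.map (Y 0))) :
    StrictlyPeriodicallyStationary μ τ Y := by
  intro n s A hs hA k
  have hYm (a : ℝ≥0) : Measurable (Y a) := hY.measurable _ a.coe_nonneg
  set E : Set ((Fin q → ℝ) × (ℝ≥0 → ℝ)) := {y | ∀ i, stateAfter θ (s i).toNNReal y ∈ A i} with hE
  have hEm : MeasurableSet E := by
    have : E = ⋂ i, stateAfter θ (s i).toNNReal ⁻¹' A i := by ext; simp [hE]
    rw [this]
    exact MeasurableSet.iInter fun i => measurable_stateAfter _ (hA i)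
  have key (k : ℕ) : μ {ω | ∀ i, Y (s i + k * τ) ω ∈ A i} =
      (μ.map (Y 0)).prod (μ.map (X.block 0)) E := by
    rw [← map_state_block hQ hY h k, Measure.map_apply ((hYm _).prodMk (X.measurable_block _)) hEm]
    refine measure_congr ?_
    filter_upwards [ae_eq_stateAfter hQ hY] with ω hω
    refine propext (forall_congr' fun i => ?_)
    rw [← hω]
    have : s i + k * τ = (k * X.period + (s i).toNNReal : ℝ≥0) := by
      push_cast
      rw [X.coe_period, Real.coe_toNNReal _ (hs i), add_comm]
    rw [this]
  have h0 := key 0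
  simp only [Nat.cast_zero, zero_mul, add_zero] at h0
  rw [h0, key k]

/-- At a fixed time there is almost surely no jump, so that the left limit may be dropped. -/
lemma ae_volatility_eq (hQ : IsQuadraticVariation μ X.S Q) (hY : IsStateProcess θ X Q Y) {t : ℝ}
    (ht : 0 ≤ t) : ∀ᵐ ω ∂μ, volatility θ Y t ω = θ.α 0 + θ.a ⬝ᵥ Y t ω := by
  rcases eq_or_lt_of_le ht with rfl | h0
  · exact Eventually.of_forall fun ω => by simp [volatility]
  filter_upwards [hY.ae_eq_J_mulVec_add_K hQ, X.ae_exists_N_eq h0] with ω h1 ⟨s, hs, hst, hN⟩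
  have hflow : ∀ u ∈ Icc s t, Y u ω = flow θ (u - s) (Y s ω) := by
    intro u hu
    have hNu : X.N u ω - X.N s ω = 0 :=
      Nat.sub_eq_zero_of_le ((X.N_le (hs.trans hu.1) hu.2 ω).trans hN.ge)
    rw [h1 s u hs hu.1, J_mulVec_add_K θ hs hu.1, hNu, updateTime_zero hs]
    rfl
  have hleft : Function.leftLim (fun v => Y v ω) t = Y t ω := by
    refine leftLim_eq_of_tendsto ?_
    have hc : Continuous fun u => flow θ (u - s) (Y s ω) :=
      (continuous_flow_left (Y s ω)).comp (continuous_id.sub continuous_const)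
    rw [hflow t (right_mem_Icc.2 hst.le)]
    refine ((hc.tendsto t).mono_left nhdsWithin_le_nhds).congr' ?_
    filter_upwards [Ioo_mem_nhdsLT hst] with u hu using (hflow u ⟨hu.1.le, hu.2.le⟩).symm
  rw [volatility, if_neg h0.ne', hleft]

theorem strictlyPeriodicallyStationary_volatility (hQ : IsQuadraticVariation μ X.S Q)
    (hY : IsStateProcess θ X Q Y) (h : StrictlyPeriodicallyStationary μ τ Y) :
    StrictlyPeriodicallyStationary μ τ (volatility θ Y) := by
  intro n s I hs hI k
  have hτ := X.period_pos
  have hg : Measurable fun x : Fin q → ℝ => θ.α 0 + θ.a ⬝ᵥ x :=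
    (continuous_const.add (continuous_const.dotProduct continuous_id)).measurable
  have key (k : ℕ) : μ {ω | ∀ i, volatility θ Y (s i + k * τ) ω ∈ I i} =
      μ {ω | ∀ i, Y (s i + k * τ) ω ∈ (fun x => θ.α 0 + θ.a ⬝ᵥ x) ⁻¹' I i} := by
    refine measure_congr ?_
    filter_upwards [ae_all_iff.2 fun i => ae_volatility_eq hQ hY
      (add_nonneg (hs i) (mul_nonneg k.cast_nonneg hτ.le))] with ω hω
    exact propext (forall_congr' fun i => by rw [hω i]; rfl)
  have h0 := key 0
  simp only [Nat.cast_zero, zero_mul, add_zero] at h0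
  rw [h0, key k]
  exact h n s _ hs (fun i => hg (hI i)) k

/-- At times separated by periods, the state follows the iterated random affine maps. -/
lemma ae_state_eq_forwardIter (hQ : IsQuadraticVariation μ X.S Q) (hY : IsStateProcess θ X Q Y)
    {t : ℝ} (ht : 0 ≤ t) : ∀ᵐ ω ∂μ, ∀ m : ℕ, Y (t + m * τ) ω =
      forwardIter affineAct (fun i => coeffPair θ X (t + i * τ) (t + τ + i * τ) ω) m (Y t ω) := by
  filter_upwards [hY.ae_eq_J_mulVec_add_K hQ] with ω hω m
  have hτ := X.period_pos
  induction m with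
  | zero => simp [forwardIter]
  | succ m ih =>
    rw [forwardIter, ← ih, affineAct_coeffPair, ← hω _ _ (by positivity) (by linarith)]
    congr 1
    push_cast; ring

end Stationarity

end SSCogarch

theorem theorem3p1 {Ω : Type*} [MeasurableSpace Ω] (μ : Measure Ω) [IsProbabilityMeasure μ]
    (τ : ℝ) (p q : ℕ) (θ : SSCogarch.Params p q) (X : SSCogarch.SimpleCompoundPoisson μ τ)
    (Q : Ω → StieltjesFunction ℝ) (hQ : SSCogarch.IsQuadraticVariation μ X.S Q)
    (Y : ℝ → Ω → Fin q → ℝ) (hY : SSCogarch.IsStateProcess θ X Q Y) :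
    -- (a)
    ((∀ᵐ ω ∂μ, ∀ s t : ℝ, 0 ≤ s → s ≤ t →
        Y t ω = SSCogarch.J θ X s t ω *ᵥ Y s ω + SSCogarch.K θ X s t ω) ∧
      (∀ s t : ℝ, 0 ≤ s → s ≤ t → ∀ k : ℕ,
        IdentDistrib (SSCogarch.coeffPair θ X (s + k * τ) (t + k * τ))
          (SSCogarch.coeffPair θ X s t) μ μ) ∧
      (∀ s t : ℝ, 0 ≤ s → s ≤ t → t - s ≤ τ →
        iIndepFun (fun k : ℕ => SSCogarch.coeffPair θ X (s + k * τ) (t + k * τ)) μ)) ∧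
    -- hypotheses of (b) and (c)
    ((∀ η ∈ spectrum ℂ θ.Bc, η.re < 0) →
      ∀ P : Matrix (Fin q) (Fin q) ℂ, IsUnit P → (P⁻¹ * θ.Bc * P).IsDiag →
      ∀ (r : ℝ≥0∞) [Fact (1 ≤ r)], SSCogarch.LogMomentCondition θ X P r →
      ∃ U : ℝ → ProbabilityMeasure (Fin q → ℝ),
        -- (b)
        (∀ t ∈ Ico 0 τ,
          TendstoInDistribution (fun (m : ℕ) => Y (t + m * τ)) atTop id (fun _ => μ)
            (U t : Measure (Fin q → ℝ)) ∧
          SSCogarch.SolvesRecurrence θ X t (U t : Measure (Fin q → ℝ)) ∧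
          ∀ π : ProbabilityMeasure (Fin q → ℝ),
            SSCogarch.SolvesRecurrence θ X t (π : Measure (Fin q → ℝ)) → π = U t) ∧
        -- (c)
        (μ.map (Y 0) = (U 0 : Measure (Fin q → ℝ)) →
          SSCogarch.StrictlyPeriodicallyStationary μ τ Y ∧
          SSCogarch.StrictlyPeriodicallyStationary μ τ (SSCogarch.volatility θ Y))) := by
  refine ⟨⟨hY.ae_eq_J_mulVec_add_K hQ, fun s t hs hst k =>
    SSCogarch.identDistrib_coeffPair θ X hs hst k,
    fun s t hs hst h => SSCogarch.iIndepFun_coeffPair θ X hs hst h⟩, ?_⟩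
  intro hspec P hP hD r _ hlog
  have hη : θ.eta ≤ 0 := Real.sSup_nonpos (by rintro _ ⟨z, hz, rfl⟩; exact (hspec z hz).le)
  have hlaw (t : ℝ) (ht : 0 ≤ t) := SSCogarch.exists_stationary_law_coeff hη hP hD hlog ht
  choose! U hU using hlaw
  have hU0 := (hU 0 le_rfl).1
  refine ⟨U, fun t ht => ⟨?_, (hU t ht.1).1, (hU t ht.1).2.1⟩, fun h0 => ?_⟩
  · refine ((hU t ht.1).2.2 (Y t) (hY.measurable t ht.1)).congr (fun m => ?_) (.refl _ _)
    filter_upwards [SSCogarch.ae_state_eq_forwardIter hQ hY ht.1] with ω hω using (hω m).symm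
  · rw [← h0] at hU0
    have hst := SSCogarch.strictlyPeriodicallyStationary_state hQ hY hU0
    exact ⟨hst, SSCogarch.strictlyPeriodicallyStationary_volatility hQ hY hst⟩
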